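/- Let $\ell>0$, let $q:\mathbb R\to\mathbb R$ be locally integrable and $\ell$-periodic, and let $\alpha\in[0,\pi)$. Consider $-y''+qy=\lambda y$ on $[0,\infty)$ (solutions have locally absolutely continuous $y,y'$ and satisfy the equation almost everywhere). For $\lambda\in\mathbb C$ let $\theta,\phi$ be the solutions with $\theta(0)=\cos\alpha$, $\theta'(0)=\sin\alpha$, $\phi(0)=-\sin\alpha$, $\phi'(0)=\cos\alpha$, and let $u,v$ be those with $u(0)=v'(0)=1$, $u'(0)=v(0)=0$. For $\operatorname{Im}\lambda\ne0$ let $m(\lambda)$ be the Titchmarsh–Weyl coefficient, i.e. the number with $\theta+m(\lambda)\phi\in L^2(0,\infty)$. Let $\Lambda$ be the cutoff point (the equation is nonoscillatory for $\lambda<\Lambda$, oscillatory for $\lambda>\Lambda$), let $\rho(\lambda)=\lim_{\varepsilon\to0+}\frac1\pi\int_\Lambda^\lambda\operatorname{Im}m(\mu+i\varepsilon)\,d\mu$ be the spectral function, and let $f(\lambda)=\rho'(\lambda)=\frac1\pi\lim_{\varepsilon\to0+}\operatorname{Im}m(\lambda+i\varepsilon)$ be the spectral density function. Let $\lambda_0\le\lambda_1\le\cdots$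 and $\mu_0\le\mu_1\le\cdots$ be the eigenvalues, repeated according to multiplicity, of the equation on $[0,\ell]$ with the periodic conditions $y(0)=y(\ell)$, $y'(0)=y'(\ell)$ and the semi-periodic conditions $y(0)=-y(\ell)$, $y'(0)=-y'(\ell)$, respectively. Let $\lambda$ lie in a stability interval, i.e. in one of the open intervals $(\lambda_{2m},\mu_{2m})$, $(\mu_{2m+1},\lambda_{2m+1})$, $m\ge0$. Then Appell's system $$P'=(\lambda-q)Q,\qquad Q'=-2P+2(\lambda-q)R,\qquad R'=-Q$$ has on $[0,\infty)$ a real $\ell$-periodic solution $U=(P,Q,R)^T$ with $4PR-Q^2=4$, and it is unique up to sign. The limit defining $f(\lambda)$ exists, is positive, and equals $\rho'(\lambda)$. For each such $U$ there are real $a,b,c$ with $$\begin{pmatrix}P\\Q\\R\end{pmatrix}=a\begin{pmatrix}u'^2\\-2uu'\\u^2\end{pmatrix}+b\begin{pmatrix}u'v'\\-(u'v+uv')\\uv\end{pmatrix}+c\begin{pmatrix}v'^2\\-2vv'\\v^2\end{pmatrix},$$ and for any such $a,b,c$, $$f(\lambda)=\left|\frac1{\pi[c\sin^2\alpha+b\sin\alpha\cos\alpha+a\cos^2\alpha]}\right|=\left|\frac1{\pi[P(0)\sin^2\alpha-Q(0)\sin\alpha\cos\alpha+R(0)\cos^2\alpha]}\right|=\left|\frac1{\pi[P(x)\phi(x)^2+Q(x)\phi(x)\phi'(x)+R(x)\phi'(x)^2]}\right|$$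 for every $x\ge0$, where $P\phi^2+Q\phi\phi'+R\phi'^2$ does not depend on $x$. -/

import Mathlib

open Filter Topology MeasureTheory

/-- `(y, dy)` is a solution, together with its derivative, of `-y'' + q y = z y` on `[0, ∞)`.
For a locally integrable potential this is the usual (Carathéodory) notion: `y` and `y' = dy` are
locally absolutely continuous and the equation holds almost everywhere, written in integrated form.
For a continuous potential these are the classical solutions. -/
structure IsHillSolution {𝕜 : Type*} [RCLike 𝕜] (q : ℝ → ℝ) (z : 𝕜) (y dy : ℝ → 𝕜) : Prop where
  continuousOn : ContinuousOn y (Set.Ici 0)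
  continuousOn_deriv : ContinuousOn dy (Set.Ici 0)
  eq : ∀ x, 0 ≤ x → y x = y 0 + ∫ t in (0 : ℝ)..x, dy t
  deriv_eq : ∀ x, 0 ≤ x → dy x = dy 0 + ∫ t in (0 : ℝ)..x, ((q t : 𝕜) - z) * y t

/-- `(P, Q, R)` is a solution on `[0, ∞)` of Appell's system
`P' = (lam - q) Q`, `Q' = -2 P + 2 (lam - q) R`, `R' = -Q`, in the same sense. -/
structure IsAppellSolution (q : ℝ → ℝ) (lam : ℝ) (P Q R : ℝ → ℝ) : Prop where
  continuousOn_P : ContinuousOn P (Set.Ici 0)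
  continuousOn_Q : ContinuousOn Q (Set.Ici 0)
  continuousOn_R : ContinuousOn R (Set.Ici 0)
  eq_P : ∀ x, 0 ≤ x → P x = P 0 + ∫ t in (0 : ℝ)..x, (lam - q t) * Q t
  eq_Q : ∀ x, 0 ≤ x → Q x = Q 0 + ∫ t in (0 : ℝ)..x, (-2 * P t + 2 * (lam - q t) * R t)
  eq_R : ∀ x, 0 ≤ x → R x = R 0 + ∫ t in (0 : ℝ)..x, -Q t

/-- `(P, Q, R)` is an `ℓ`-periodic solution of Appell's system with `4 P R - Q ^ 2 = 4`. -/
structure IsNormalizedPeriodicAppell (q : ℝ → ℝ) (ℓ lam : ℝ) (P Q R : ℝ → ℝ) : Prop where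
  solution : IsAppellSolution q lam P Q R
  periodic_P : ∀ x, 0 ≤ x → P (x + ℓ) = P x
  periodic_Q : ∀ x, 0 ≤ x → Q (x + ℓ) = Q x
  periodic_R : ∀ x, 0 ≤ x → R (x + ℓ) = R x
  normalized : ∀ x, 0 ≤ x → 4 * P x * R x - Q x ^ 2 = 4

/-- `(P, Q, R) = a U₁ + b U₂ + c U₃`, where `U₁, U₂, U₃` is the fundamental system of Appell's
system that is generated by two solutions `u`, `v` of the equation. -/
def HasAppellCoordinates (u du v dv P Q R : ℝ → ℝ) (a b c : ℝ) : Prop :=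
  ∀ x, 0 ≤ x →
    P x = a * du x ^ 2 + b * (du x * dv x) + c * dv x ^ 2 ∧
    Q x = a * (-2 * u x * du x) + b * (-(du x * v x + u x * dv x)) + c * (-2 * v x * dv x) ∧
    R x = a * u x ^ 2 + b * (u x * v x) + c * v x ^ 2

/-! ### Stability intervals -/

/-- The multiplicity of `μ` as an eigenvalue of `-y'' + q y = μ y` on `[0, ℓ]` with the boundary
conditions `y 0 = s * y ℓ`, `y' 0 = s * y' ℓ` (periodic for `s = 1`, semi-periodic for `s = -1`):
the dimension of the space of eigenfunctions, which are identified with their initial data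
`(y 0, y' 0)`. It is `0` if `μ` is not an eigenvalue. -/
noncomputable def eigenvalueMultiplicity (q : ℝ → ℝ) (ℓ s μ : ℝ) : ℕ :=
  Set.finrank ℝ {d : ℝ × ℝ | ∃ y dy : ℝ → ℝ, IsHillSolution q μ y dy ∧
    y 0 = d.1 ∧ dy 0 = d.2 ∧ y 0 = s * y ℓ ∧ dy 0 = s * dy ℓ}

/-- `e 0 ≤ e 1 ≤ e 2 ≤ ⋯` lists all eigenvalues of the problem above, each as often as its
multiplicity says. -/
def IsEigenvalueSequence (q : ℝ → ℝ) (ℓ s : ℝ) (e : ℕ → ℝ) : Prop :=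
  Monotone e ∧ ∀ μ : ℝ, {n : ℕ | e n = μ}.encard = (eigenvalueMultiplicity q ℓ s μ : ℕ∞)

/-- `lam` lies in one of the open stability intervals `(λ_{2m}, μ_{2m})`,
`(μ_{2m+1}, λ_{2m+1})`, where `λ_n` and `μ_n` are the periodic and the semi-periodic
eigenvalues. -/
def InStabilityInterval (q : ℝ → ℝ) (ℓ lam : ℝ) : Prop :=
  ∃ per semi : ℕ → ℝ, IsEigenvalueSequence q ℓ 1 per ∧ IsEigenvalueSequence q ℓ (-1) semi ∧
    ∃ m : ℕ, lam ∈ Set.Ioo (per (2 * m)) (semi (2 * m)) ∨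
      lam ∈ Set.Ioo (semi (2 * m + 1)) (per (2 * m + 1))

/-! ### The Titchmarsh–Weyl function, the spectral function and the spectral density -/

/-- `θ + m φ` is square integrable on `(0, ∞)`, where `θ`, `φ` are the solutions with
`θ 0 = cos α`, `θ' 0 = sin α`, `φ 0 = -sin α`, `φ' 0 = cos α`. -/
def IsWeylCoefficient (q : ℝ → ℝ) (α : ℝ) (z m : ℂ) : Prop :=
  ∃ θ dθ φ dφ : ℝ → ℂ, IsHillSolution q z θ dθ ∧ IsHillSolution q z φ dφ ∧
    θ 0 = Real.cos α ∧ dθ 0 = Real.sin α ∧ φ 0 = -Real.sin α ∧ dφ 0 = Real.cos α ∧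
    MemLp (fun x => θ x + m * φ x) 2 (volume.restrict (Set.Ioi 0))

/-- The Titchmarsh–Weyl `m`-function (for `z.im ≠ 0`). -/
noncomputable def weylM (q : ℝ → ℝ) (α : ℝ) (z : ℂ) : ℂ :=
  Classical.epsilon (IsWeylCoefficient q α z)

/-- Every nontrivial real solution has arbitrarily large zeros. -/
def IsOscillatory (q : ℝ → ℝ) (μ : ℝ) : Prop :=
  ∀ y dy : ℝ → ℝ, IsHillSolution q μ y dy → (∃ x, 0 ≤ x ∧ y x ≠ 0) →
    ∀ X : ℝ, ∃ x, 0 ≤ x ∧ X ≤ x ∧ y x = 0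

/-- No nontrivial real solution has arbitrarily large zeros. -/
def IsNonoscillatory (q : ℝ → ℝ) (μ : ℝ) : Prop :=
  ∀ y dy : ℝ → ℝ, IsHillSolution q μ y dy → (∃ x, 0 ≤ x ∧ y x ≠ 0) →
    ∃ X : ℝ, ∀ x, 0 ≤ x → X ≤ x → y x ≠ 0

/-- The cutoff point: nonoscillation below `Λ`, oscillation above `Λ`. -/
def IsCutoff (q : ℝ → ℝ) (Λ : ℝ) : Prop :=
  (∀ μ, μ < Λ → IsNonoscillatory q μ) ∧ ∀ μ, Λ < μ → IsOscillatory q μ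

/-- `ρ` is the spectral function on `[Λ, ∞)` given by the Titchmarsh–Kodaira formula. -/
def IsSpectralFunction (q : ℝ → ℝ) (α Λ : ℝ) (ρ : ℝ → ℝ) : Prop :=
  ∀ μ, Λ ≤ μ → Tendsto
    (fun ε : ℝ => 1 / Real.pi * ∫ t in Λ..μ, (weylM q α (t + ε * Complex.I)).im)
    (𝓝[>] 0) (𝓝 (ρ μ))

/-- The spectral density `f(lam) = (1/π) lim_{ε → 0+} Im m(lam + i ε)`. -/
noncomputable def spectralDensity (q : ℝ → ℝ) (α lam : ℝ) : ℝ :=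
  limUnder (𝓝[>] (0 : ℝ)) fun ε : ℝ => 1 / Real.pi * (weylM q α (lam + ε * Complex.I)).im

/-! Let `M` be the monodromy matrix, with rows `(u, v)` and `(u', v')` at `ℓ`. It has determinant 1;
let `D` be its trace. The argument computes both sides of the formula from `M`.

In a stability interval `|D| < 2`. As the spectral parameter increases, `D` starts above 2
(`exists_two_lt_disc`), has no critical point where `|D| < 2`, and at `±2` either crosses
transversally (simple eigenvalue) or touches from inside (double eigenvalue). The pair of numbers of
periodic and semi-periodic eigenvalues below a point therefore runs through a fixed cycle
(`IsDiscriminant.position`), and this pair identifies the stability intervals (`sq_lt_four_of_mem`).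

For `Im z > 0`, Green's identity over one period shows that no eigenvalue of `M` has modulus 1. With
`|τ| < 1` the Floquet solution for `τ` is square integrable and the one for `τ⁻¹` is not. Hence `θ +
m φ` is a multiple of the former, and `m` is an explicit quotient in `τ` and the entries of `M`
(`weylM_eq`). At a real point with `|D| < 2` the roots `(D ± i √(4 - D²)) / 2` are distinct, so this
quotient extends continuously to the real axis (`exists_boundary_extension`). This gives `Im m → √(4
- D²) / (2 |N|)`, where `N = v cos² α + (v' - u) sin α cos α - u' sin² α` at `ℓ`. The same extension
justifies differentiating the spectral function.

For a solution `(P, Q, R)` of Appell's system, the form `P y² + Q y y' + R y'²` is constant along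
solutions `y` of Hill's equation (`bilinear_eq`). Periodicity means that the form at 0 is invariant
under `M`. For `|D| < 2` the invariant forms are the multiples `k (-u', u - v', v)`, and `4 P R - Q²
= k² (4 - D²)`, so the normalization forces `k = ±2 / √(4 - D²)` (`exists_initial_eq`). On the
initial data of `φ` the form equals `k N`, so `1 / (π |k N|)` is the density. -/

/-! ### Absolutely continuous functions on `[0, ∞)` and their densities -/

/-- `F` is a primitive on `[0, ∞)` of the locally integrable function `f`. -/
structure IsPrimitive {𝕜 : Type*} [RCLike 𝕜] (F f : ℝ → 𝕜) : Prop where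
  intervalIntegrable : ∀ x, 0 ≤ x → IntervalIntegrable f volume 0 x
  eq : ∀ x, 0 ≤ x → F x = F 0 + ∫ t in (0 : ℝ)..x, f t

namespace IsPrimitive

variable {𝕜 : Type*} [RCLike 𝕜] {F f G g : ℝ → 𝕜}

theorem continuousOn (h : IsPrimitive F f) : ContinuousOn F (Set.Ici 0) := by
  intro x hx
  have hx0 : (0 : ℝ) ≤ x := hx
  have h1 : ContinuousOn (fun b => F 0 + ∫ t in (0 : ℝ)..b, f t) (Set.uIcc 0 (x + 1)) :=
    continuousOn_const.add (intervalIntegral.continuousOn_primitive_interval'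
      (h.intervalIntegrable (x + 1) (by linarith)) Set.left_mem_uIcc)
  rw [Set.uIcc_of_le (by linarith)] at h1
  have h2 : ContinuousOn F (Set.Icc 0 (x + 1)) := h1.congr fun y hy => h.eq y hy.1
  refine (h2 x ⟨hx0, by linarith⟩).mono_of_mem_nhdsWithin ?_
  rw [← Set.Ici_inter_Iic]
  exact inter_mem_nhdsWithin _ (Iic_mem_nhds (by linarith))

theorem continuousOn_uIcc (h : IsPrimitive F f) {x : ℝ} (hx : 0 ≤ x) :
    ContinuousOn F (Set.uIcc 0 x) := by
  rw [Set.uIcc_of_le hx]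
  exact h.continuousOn.mono Set.Icc_subset_Ici_self

theorem of_continuousOn (hf : ContinuousOn f (Set.Ici 0))
    (h : ∀ x, 0 ≤ x → F x = F 0 + ∫ t in (0 : ℝ)..x, f t) : IsPrimitive F f where
  intervalIntegrable x hx := by
    apply ContinuousOn.intervalIntegrable
    rw [Set.uIcc_of_le hx]
    exact hf.mono Set.Icc_subset_Ici_self
  eq := h

theorem congr_density (h : IsPrimitive F f) (hfg : ∀ x, 0 ≤ x → f x = g x) :
    IsPrimitive F g where
  intervalIntegrable x hx := (h.intervalIntegrable x hx).congr fun t ht => by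
    rw [Set.uIoc_of_le hx] at ht
    exact hfg t ht.1.le
  eq x hx := by
    rw [h.eq x hx, intervalIntegral.integral_congr fun t ht => ?_]
    rw [Set.uIcc_of_le hx] at ht
    exact hfg t ht.1

theorem congr (h : IsPrimitive F f) (hFG : ∀ x, 0 ≤ x → F x = G x) : IsPrimitive G f where
  intervalIntegrable := h.intervalIntegrable
  eq x hx := by rw [← hFG x hx, ← hFG 0 le_rfl, h.eq x hx]

theorem add (hF : IsPrimitive F f) (hG : IsPrimitive G g) :
    IsPrimitive (fun x => F x + G x) (fun x => f x + g x) where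
  intervalIntegrable x hx := (hF.intervalIntegrable x hx).add (hG.intervalIntegrable x hx)
  eq x hx := by
    rw [intervalIntegral.integral_add (hF.intervalIntegrable x hx) (hG.intervalIntegrable x hx),
      hF.eq x hx, hG.eq x hx]
    ring

theorem const_mul (c : 𝕜) (hF : IsPrimitive F f) :
    IsPrimitive (fun x => c * F x) (fun x => c * f x) where
  intervalIntegrable x hx := (hF.intervalIntegrable x hx).const_mul c
  eq x hx := by
    rw [intervalIntegral.integral_const_mul, hF.eq x hx]
    ring

theorem sub (hF : IsPrimitive F f) (hG : IsPrimitive G g) :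
    IsPrimitive (fun x => F x - G x) (fun x => f x - g x) where
  intervalIntegrable x hx := (hF.intervalIntegrable x hx).sub (hG.intervalIntegrable x hx)
  eq x hx := by
    rw [intervalIntegral.integral_sub (hF.intervalIntegrable x hx) (hG.intervalIntegrable x hx),
      hF.eq x hx, hG.eq x hx]
    ring

theorem re (hF : IsPrimitive F f) :
    IsPrimitive (fun x => RCLike.re (F x)) (fun x => RCLike.re (f x)) where
  intervalIntegrable x hx :=
    (RCLike.reCLM (K := 𝕜)).integrable_comp (intervalIntegrable_iff.1 (hF.intervalIntegrable x hx))
      |> intervalIntegrable_iff.2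
  eq x hx := by
    have := (RCLike.reCLM (K := 𝕜)).intervalIntegral_comp_comm (hF.intervalIntegrable x hx)
    simp only [RCLike.reCLM_apply] at this
    rw [this, hF.eq x hx, map_add]

theorem im (hF : IsPrimitive F f) :
    IsPrimitive (fun x => RCLike.im (F x)) (fun x => RCLike.im (f x)) where
  intervalIntegrable x hx :=
    (RCLike.imCLM (K := 𝕜)).integrable_comp (intervalIntegrable_iff.1 (hF.intervalIntegrable x hx))
      |> intervalIntegrable_iff.2
  eq x hx := by
    have := (RCLike.imCLM (K := 𝕜)).intervalIntegral_comp_comm (hF.intervalIntegrable x hx)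
    simp only [RCLike.imCLM_apply] at this
    rw [this, hF.eq x hx, map_add]

theorem ofReal {F f : ℝ → ℝ} (hF : IsPrimitive F f) :
    IsPrimitive (fun x => (F x : 𝕜)) (fun x => (f x : 𝕜)) where
  intervalIntegrable x hx :=
    (RCLike.ofRealCLM (K := 𝕜)).integrable_comp
      (intervalIntegrable_iff.1 (hF.intervalIntegrable x hx)) |> intervalIntegrable_iff.2
  eq x hx := by
    have := (RCLike.ofRealCLM (K := 𝕜)).intervalIntegral_comp_comm (hF.intervalIntegrable x hx)
    simp only [RCLike.ofRealCLM_apply] at this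
    rw [this, hF.eq x hx, RCLike.ofReal_add]

theorem mul_real {F f G g : ℝ → ℝ} (hF : IsPrimitive F f) (hG : IsPrimitive G g) :
    IsPrimitive (fun x => F x * G x) (fun x => f x * G x + F x * g x) where
  intervalIntegrable x hx :=
    ((hF.intervalIntegrable x hx).mul_continuousOn (hG.continuousOn_uIcc hx)).add
      ((hG.intervalIntegrable x hx).continuousOn_mul (hF.continuousOn_uIcc hx))
  eq x hx := by
    -- A primitive is arbitrary to the left of 0, so the integral expression stands in for it. The
    -- latter is absolutely continuous on the interval with the expected derivative almost
    -- everywhere, and integration by parts applies.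
    have ac {H h : ℝ → ℝ} (hH : IsPrimitive H h) :
        AbsolutelyContinuousOnInterval (fun x => H 0 + ∫ t in (0 : ℝ)..x, h t) 0 x ∧
        ∀ᵐ y, y ∈ Set.uIcc 0 x → deriv (fun x => H 0 + ∫ t in (0 : ℝ)..x, h t) y = h y := by
      constructor
      · exact AbsolutelyContinuousOnInterval.add
          (LipschitzOnWith.absolutelyContinuousOnInterval
            (LipschitzWith.const (H 0)).lipschitzOnWith)
          ((hH.intervalIntegrable x hx).absolutelyContinuousOnInterval_intervalIntegral
            Set.left_mem_uIcc)
      · filter_upwards [(hH.intervalIntegrable x hx).ae_hasDerivAt_integral] with y hy hyx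
        exact ((hy hyx 0 Set.left_mem_uIcc).const_add (H 0)).deriv
    have key := (ac hF).1.integral_deriv_mul_eq_sub (ac hG).1
    rw [← hF.eq x hx, ← hG.eq x hx] at key
    simp only [intervalIntegral.integral_same, add_zero] at key
    rw [← sub_eq_iff_eq_add', ← key]
    apply intervalIntegral.integral_congr_ae
    filter_upwards [(ac hF).2, (ac hG).2] with y h1 h2 hy
    have hy' := Set.uIoc_subset_uIcc hy
    rw [h1 hy', h2 hy']
    rw [Set.uIcc_of_le hx] at hy'
    rw [← hF.eq y hy'.1, ← hG.eq y hy'.1]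

theorem of_re_im (hre : IsPrimitive (fun x => RCLike.re (F x)) (fun x => RCLike.re (f x)))
    (him : IsPrimitive (fun x => RCLike.im (F x)) (fun x => RCLike.im (f x))) :
    IsPrimitive F f := by
  have h := (hre.ofReal (𝕜 := 𝕜)).add ((him.ofReal (𝕜 := 𝕜)).const_mul RCLike.I)
  refine (h.congr fun x _ => ?_).congr_density fun x _ => ?_ <;>
  · rw [mul_comm]
    exact RCLike.re_add_im _

theorem mul (hF : IsPrimitive F f) (hG : IsPrimitive G g) :
    IsPrimitive (fun x => F x * G x) (fun x => f x * G x + F x * g x) := by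
  refine of_re_im ?_ ?_
  · refine ((((hF.re).mul_real hG.re).sub (hF.im.mul_real hG.im)).congr fun x _ => ?_).congr_density
      fun x _ => ?_
    · simp [RCLike.mul_re]
    · simp [RCLike.mul_re]; ring
  · refine ((((hF.re).mul_real hG.im).add (hF.im.mul_real hG.re)).congr fun x _ => ?_).congr_density
      fun x _ => ?_
    · simp [RCLike.mul_im]
    · simp [RCLike.mul_im]; ring

theorem conj (hF : IsPrimitive F f) :
    IsPrimitive (fun x => (starRingEnd 𝕜) (F x)) (fun x => (starRingEnd 𝕜) (f x)) := by
  refine of_re_im ?_ ?_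
  · simpa using hF.re
  · simpa using hF.im.const_mul (-1)

theorem hasDerivAt (hF : IsPrimitive F f) (hf : ContinuousOn f (Set.Ici 0)) {x : ℝ} (hx : 0 < x) :
    HasDerivAt F (f x) x := by
  have h1 : HasDerivAt (fun b => F 0 + ∫ t in (0 : ℝ)..b, f t) (f x) x := by
    refine HasDerivAt.const_add _ (intervalIntegral.integral_hasDerivAt_right
      (hF.intervalIntegrable x hx.le) ?_ ((hf x hx.le).continuousAt (Ici_mem_nhds hx)))
    exact (hf.mono Set.Ioi_subset_Ici_self).stronglyMeasurableAtFilter isOpen_Ioi x hx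
  refine h1.congr_of_eventuallyEq ?_
  filter_upwards [Ioi_mem_nhds hx] with y hy using hF.eq y (le_of_lt hy)

theorem sub_eq (hF : IsPrimitive F f) {x y : ℝ} (hx : 0 ≤ x) (hy : 0 ≤ y) :
    F y - F x = ∫ t in x..y, f t := by
  rw [hF.eq x hx, hF.eq y hy, add_sub_add_left_eq_sub, intervalIntegral.integral_interval_sub_left
    (hF.intervalIntegrable y hy) (hF.intervalIntegrable x hx)]

theorem comp_add_right (hF : IsPrimitive F f) {c : ℝ} (hc : 0 ≤ c) :
    IsPrimitive (fun x => F (x + c)) (fun x => f (x + c)) where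
  intervalIntegrable x hx := by
    have h := ((hF.intervalIntegrable c hc).symm.trans
      (hF.intervalIntegrable (x + c) (by positivity))).comp_add_right c
    simpa using h
  eq x hx := by
    rw [intervalIntegral.integral_comp_add_right, zero_add, ← hF.sub_eq hc (by positivity)]
    ring

theorem eq_of_density_eq_zero (hF : IsPrimitive F f) (hf : ∀ x, 0 ≤ x → f x = 0) {x : ℝ}
    (hx : 0 ≤ x) : F x = F 0 := by
  rw [(hF.congr_density hf).eq x hx]
  simp

end IsPrimitive

/-! ### Linear differential equations with a parameter -/

section LinearODE

variable {X E : Type*} [NormedAddCommGroup E] [NormedSpace ℝ E]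

/-- The terms of the Picard series of `Y' = A Y`, `Y 0 = e`. -/
noncomputable def picardTerm (A : X → ℝ → E →L[ℝ] E) (e : E) : ℕ → X → ℝ → E
  | 0, _, _ => e
  | n + 1, p, x => ∫ t in (0 : ℝ)..x, A p t (picardTerm A e n p t)

variable {A : X → ℝ → E →L[ℝ] E} {e : E}

theorem continuous_picardTerm [TopologicalSpace X]
    [FirstCountableTopology X] [LocallyCompactSpace X]
    (hA : Continuous (Function.uncurry A)) (n : ℕ) :
    Continuous (Function.uncurry (picardTerm A e n)) := by
  induction n with
  | zero => exact continuous_const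
  | succ n ih =>
    have h : Continuous (Function.uncurry fun p t => A p t (picardTerm A e n p t)) :=
      hA.clm_apply ih
    exact intervalIntegral.continuous_parametric_primitive_of_continuous h

/-- Each integration turns `(C t)^n / n!` into the next term of the exponential series. -/
theorem norm_picardTerm_le {p : X} {R C : ℝ} (hC : ∀ t ∈ Set.Icc 0 R, ‖A p t‖ ≤ C) (n : ℕ) :
    ∀ x ∈ Set.Icc 0 R, ‖picardTerm A e n p x‖ ≤ ‖e‖ * ((C * x) ^ n / n.factorial) := by
  induction n with
  | zero => intro x _; simp [picardTerm]
  | succ n ih =>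
    intro x hx
    have h : ∀ t ∈ Set.Ioc 0 x, ‖A p t (picardTerm A e n p t)‖ ≤
        C * (‖e‖ * ((C * t) ^ n / n.factorial)) := fun t ht => by
      have ht' : t ∈ Set.Icc 0 R := ⟨ht.1.le, ht.2.trans hx.2⟩
      have hC0 : 0 ≤ C := (norm_nonneg _).trans (hC t ht')
      exact (ContinuousLinearMap.le_opNorm _ _).trans
        (mul_le_mul (hC t ht') (ih t ht') (norm_nonneg _) hC0)
    refine (intervalIntegral.norm_integral_le_of_norm_le hx.1
      (Eventually.of_forall h) (Continuous.intervalIntegrable (by fun_prop) _ _)).trans_eq ?_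
    have : (fun t : ℝ => C * (‖e‖ * ((C * t) ^ n / n.factorial))) =
        fun t : ℝ => (C ^ (n + 1) * ‖e‖ / n.factorial) * t ^ n := by
      ext t; rw [mul_pow]; ring
    rw [this, intervalIntegral.integral_const_mul, integral_pow, Nat.factorial_succ]
    push_cast
    rw [mul_pow]
    field_simp
    simp

/-- The Picard series converges uniformly on compact sets of parameters and positions, so joint
continuity passes to the sum, and the integral equation follows by integrating termwise. -/
theorem exists_continuous_linear_ode_solution [TopologicalSpace X]
    [FirstCountableTopology X] [LocallyCompactSpace X]
    [CompleteSpace E] (A : X → ℝ → E →L[ℝ] E) (hA : Continuous (Function.uncurry A)) (e : E) :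
    ∃ Y : X → ℝ → E, Continuous (Function.uncurry Y) ∧
      ∀ p x, 0 ≤ x → Y p x = e + ∫ t in (0 : ℝ)..x, A p t (Y p t) := by
  -- Clamping the position at 0 makes the bound valid for every position at most `R`, hence on a
  -- full neighbourhood of each point, 0 included.
  set T : ℕ → X × ℝ → E := fun n a => picardTerm A e n a.1 (max a.2 0) with hT
  have hTc (n : ℕ) : Continuous (T n) := by
    have := continuous_picardTerm (e := e) hA n
    exact this.comp (continuous_fst.prodMk (continuous_snd.max continuous_const))
  have bound (K : Set X) (hK : IsCompact K) (R : ℝ) (hR : 0 ≤ R) : ∃ C : ℝ, ∀ n, ∀ a : X × ℝ,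
      a ∈ K ×ˢ Set.Iic R → ‖T n a‖ ≤ ‖e‖ * ((C * R) ^ n / n.factorial) := by
    obtain ⟨C, hC⟩ := (hK.prod (isCompact_Icc (a := (0 : ℝ)) (b := R))).exists_bound_of_continuousOn
      hA.continuousOn
    refine ⟨C, fun n a ha => ?_⟩
    have hm : max a.2 0 ∈ Set.Icc 0 R := ⟨le_max_right _ _, max_le ha.2 hR⟩
    have hC0 : 0 ≤ C := (norm_nonneg _).trans (hC (a.1, 0) ⟨ha.1, le_rfl, hR⟩)
    refine (norm_picardTerm_le (fun t ht => hC (a.1, t) ⟨ha.1, ht⟩) n _ hm).trans ?_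
    have := hm.1
    have := hm.2
    gcongr
  have summ (C R : ℝ) : Summable fun n : ℕ => ‖e‖ * ((C * R) ^ n / n.factorial) :=
    (Real.summable_pow_div_factorial (C * R)).mul_left _
  refine ⟨fun p x => ∑' n, T n (p, x), ?_, fun p x hx => ?_⟩
  · rw [continuous_iff_continuousAt]
    rintro ⟨p, x⟩
    obtain ⟨K, hK, hpK⟩ := exists_compact_mem_nhds p
    obtain ⟨C, hC⟩ := bound K hK (|x| + 1) (by positivity)
    refine (continuousOn_tsum (fun n => (hTc n).continuousOn) (summ C (|x| + 1)) hC).continuousAt ?_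
    exact prod_mem_nhds hpK (Iic_mem_nhds (by linarith [le_abs_self x]))
  · obtain ⟨C, hC⟩ := bound {p} isCompact_singleton x hx
    have hsum : ∀ t ≤ x, HasSum (fun n => T n (p, t)) (∑' n, T n (p, t)) := fun t ht =>
      (Summable.of_norm_bounded (summ C x) fun n => hC n (p, t) ⟨rfl, ht⟩).hasSum
    have hpT (n : ℕ) : Continuous fun t => T n (p, t) := (hTc n).comp (by fun_prop)
    have hpA : Continuous fun t => A p t := hA.comp (by fun_prop : Continuous fun t => (p, t))
    obtain ⟨B, hB⟩ := (isCompact_Icc (a := (0 : ℝ)) (b := x)).exists_bound_of_continuousOn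
      hpA.continuousOn
    have h_int : HasSum (fun n => ∫ t in (0 : ℝ)..x, A p t (T n (p, t)))
        (∫ t in (0 : ℝ)..x, A p t (∑' n, T n (p, t))) := by
      refine intervalIntegral.hasSum_integral_of_dominated_convergence
        (fun n _ => B * (‖e‖ * ((C * x) ^ n / n.factorial))) (fun n => ?_) (fun n => ?_) ?_ ?_ ?_
      · exact (hpA.clm_apply (hpT n)).aestronglyMeasurable
      · refine Eventually.of_forall fun t ht => ?_
        rw [Set.uIoc_of_le hx] at ht
        have hBt := hB t ⟨ht.1.le, ht.2⟩
        exact (ContinuousLinearMap.le_opNorm _ _).trans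
          (mul_le_mul hBt (hC n (p, t) ⟨rfl, ht.2⟩) (norm_nonneg _) ((norm_nonneg _).trans hBt))
      · exact Eventually.of_forall fun t _ => (summ C x).mul_left B
      · exact intervalIntegrable_const
      · refine Eventually.of_forall fun t ht => ?_
        rw [Set.uIoc_of_le hx] at ht
        exact (A p t).hasSum (hsum t ht.2)
    have h0 : T 0 (p, x) = e := rfl
    have hs (n : ℕ) : T (n + 1) (p, x) = ∫ t in (0 : ℝ)..x, A p t (T n (p, t)) := by
      simp only [hT, picardTerm, max_eq_left hx]
      refine intervalIntegral.integral_congr fun t ht => ?_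
      rw [Set.uIcc_of_le hx] at ht
      simp only [max_eq_left ht.1]
    simp only
    rw [(hsum x le_rfl).summable.tsum_eq_zero_add, h0]
    simp only [hs]
    rw [h_int.tsum_eq]

end LinearODE

/-! ### Solutions of Hill's equation -/

theorem MeasureTheory.LocallyIntegrable.intervalIntegrable_volume {q : ℝ → ℝ}
    (hq : LocallyIntegrable q volume) (a b : ℝ) : IntervalIntegrable q volume a b :=
  (hq.integrableOn_isCompact isCompact_uIcc).intervalIntegrable

namespace IsHillSolution

variable {𝕜 : Type*} [RCLike 𝕜] {q : ℝ → ℝ} {z z' : 𝕜} {y dy w dw : ℝ → 𝕜}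

theorem isPrimitive (h : IsHillSolution q z y dy) : IsPrimitive y dy :=
  .of_continuousOn h.continuousOn_deriv h.eq

theorem isPrimitive_deriv (hq : LocallyIntegrable q volume) (h : IsHillSolution q z y dy) :
    IsPrimitive dy (fun t => ((q t : 𝕜) - z) * y t) where
  intervalIntegrable x hx := by
    refine IntervalIntegrable.mul_continuousOn ?_ (h.isPrimitive.continuousOn_uIcc hx)
    refine IntervalIntegrable.sub ?_ intervalIntegrable_const
    exact intervalIntegrable_iff.2 ((RCLike.ofRealCLM (K := 𝕜)).integrable_comp
      (intervalIntegrable_iff.1 (hq.intervalIntegrable_volume 0 x)))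
  eq := h.deriv_eq

theorem of_isPrimitive (h : IsPrimitive y dy)
    (h' : IsPrimitive dy (fun t => ((q t : 𝕜) - z) * y t)) : IsHillSolution q z y dy where
  continuousOn := h.continuousOn
  continuousOn_deriv := h'.continuousOn
  eq := h.eq
  deriv_eq := h'.eq

theorem linear_comb (hq : LocallyIntegrable q volume) (h : IsHillSolution q z y dy)
    (h' : IsHillSolution q z w dw) (a b : 𝕜) :
    IsHillSolution q z (fun x => a * y x + b * w x) (fun x => a * dy x + b * dw x) := by
  refine of_isPrimitive ((h.isPrimitive.const_mul a).add (h'.isPrimitive.const_mul b)) ?_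
  refine (((h.isPrimitive_deriv hq).const_mul a).add
    ((h'.isPrimitive_deriv hq).const_mul b)).congr_density fun x _ => ?_
  ring

theorem ofReal (hq : LocallyIntegrable q volume) {z : ℝ} {y dy : ℝ → ℝ}
    (h : IsHillSolution q z y dy) :
    IsHillSolution q (z : 𝕜) (fun x => (y x : 𝕜)) (fun x => (dy x : 𝕜)) := by
  refine of_isPrimitive h.isPrimitive.ofReal ?_
  refine (h.isPrimitive_deriv hq).ofReal.congr_density fun x _ => ?_
  simp

theorem comp_add_right (hq : LocallyIntegrable q volume) {ℓ : ℝ} (hℓ : 0 ≤ ℓ)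
    (hper : Function.Periodic q ℓ) (h : IsHillSolution q z y dy) :
    IsHillSolution q z (fun x => y (x + ℓ)) (fun x => dy (x + ℓ)) := by
  refine of_isPrimitive (h.isPrimitive.comp_add_right hℓ) ?_
  refine ((h.isPrimitive_deriv hq).comp_add_right hℓ).congr_density fun x _ => ?_
  rw [hper x]

/-- Lagrange's identity. -/
theorem lagrange (hq : LocallyIntegrable q volume) (h : IsHillSolution q z y dy)
    (h' : IsHillSolution q z' w dw) :
    IsPrimitive (fun x => y x * dw x - w x * dy x) (fun x => (z - z') * (y x * w x)) := by
  refine ((h.isPrimitive.mul (h'.isPrimitive_deriv hq)).sub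
    (h'.isPrimitive.mul (h.isPrimitive_deriv hq))).congr_density fun x _ => ?_
  ring

theorem wronskian_eq (hq : LocallyIntegrable q volume) (h : IsHillSolution q z y dy)
    (h' : IsHillSolution q z w dw) {x : ℝ} (hx : 0 ≤ x) :
    y x * dw x - w x * dy x = y 0 * dw 0 - w 0 * dy 0 :=
  (h.lagrange hq h').eq_of_density_eq_zero (fun _ _ => by ring) hx

/-- If `y` vanishes on the period, the integral equation makes `dy` constant there, and `y ℓ = y 0 +
ℓ * dy 0` forces that constant to be 0. -/
theorem initial_eq_zero {ℓ : ℝ} (hℓ : 0 < ℓ) (h : IsHillSolution q z y dy)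
    (h0 : ∀ x ∈ Set.Icc 0 ℓ, y x = 0) : y 0 = 0 ∧ dy 0 = 0 := by
  refine ⟨h0 0 ⟨le_rfl, hℓ.le⟩, ?_⟩
  have hd : ∀ x ∈ Set.Icc 0 ℓ, dy x = dy 0 := fun x hx => by
    rw [h.deriv_eq x hx.1, intervalIntegral.integral_congr (g := fun _ => 0)]
    · simp
    · intro t ht
      rw [Set.uIcc_of_le hx.1] at ht
      simp [h0 t ⟨ht.1, ht.2.trans hx.2⟩]
  have h1 := h.eq ℓ hℓ.le
  rw [h0 ℓ ⟨hℓ.le, le_rfl⟩, h0 0 ⟨le_rfl, hℓ.le⟩,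
    intervalIntegral.integral_congr (g := fun _ => dy 0)] at h1
  · simpa [hℓ.ne'] using h1.symm
  · intro t ht
    rw [Set.uIcc_of_le hℓ.le] at ht
    exact hd t ht

theorem integral_norm_sq_pos {ℓ : ℝ} (hℓ : 0 < ℓ) (h : IsHillSolution q z y dy)
    (h0 : ¬(y 0 = 0 ∧ dy 0 = 0)) : 0 < ∫ t in (0 : ℝ)..ℓ, ‖y t‖ ^ 2 := by
  have hc : ContinuousOn (fun t => ‖y t‖ ^ 2) (Set.Icc 0 ℓ) :=
    ((h.continuousOn.mono Set.Icc_subset_Ici_self).norm).pow 2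
  obtain ⟨c, hc1, hc2⟩ : ∃ c ∈ Set.Icc 0 ℓ, y c ≠ 0 := by
    by_contra! hcon
    exact h0 (h.initial_eq_zero hℓ hcon)
  exact intervalIntegral.integral_pos hℓ hc (fun _ _ => by positivity) ⟨c, hc1, by positivity⟩

end IsHillSolution

/-- Two solutions `u`, `v` of Hill's equation for each value of the spectral parameter, with
`u 0 = v' 0 = 1` and `u' 0 = v 0 = 0`, continuous in the parameter. -/
structure HillSystem (𝕜 : Type*) [RCLike 𝕜] (q : ℝ → ℝ) where
  (u du v dv : 𝕜 → ℝ → 𝕜)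
  continuous_u : Continuous (Function.uncurry u)
  continuous_du : Continuous (Function.uncurry du)
  continuous_v : Continuous (Function.uncurry v)
  continuous_dv : Continuous (Function.uncurry dv)
  solution_u : ∀ z, IsHillSolution q z (u z) (du z)
  solution_v : ∀ z, IsHillSolution q z (v z) (dv z)
  u_zero : ∀ z, u z 0 = 1
  du_zero : ∀ z, du z 0 = 0
  v_zero : ∀ z, v z 0 = 0
  dv_zero : ∀ z, dv z 0 = 1

/-- A merely integrable `q` is removed by the quasi-derivative `y' - S y` with `S = ∫ q`. The pair
`(y, y' - S y)` solves a first order system whose coefficients `S` and `z + S²` are continuous, so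
the Picard series applies and gives continuity in `z`. -/
theorem exists_isHillSolution (𝕜 : Type*) [RCLike 𝕜] {q : ℝ → ℝ} (hq : LocallyIntegrable q volume)
    (a b : 𝕜) : ∃ y dy : 𝕜 → ℝ → 𝕜, Continuous (Function.uncurry y) ∧
      Continuous (Function.uncurry dy) ∧
      ∀ z, IsHillSolution q z (y z) (dy z) ∧ y z 0 = a ∧ dy z 0 = b := by
  set S : ℝ → 𝕜 := fun x => ((∫ t in (0 : ℝ)..x, q t : ℝ) : 𝕜) with hS
  have hSc : Continuous S := by
    have := intervalIntegral.continuous_primitive hq.intervalIntegrable_volume 0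
    exact RCLike.continuous_ofReal.comp this
  have hSp : IsPrimitive S fun t => (q t : 𝕜) :=
    IsPrimitive.ofReal (F := fun x => ∫ t in (0 : ℝ)..x, q t) (f := q)
      ⟨fun x _ => hq.intervalIntegrable_volume 0 x, fun x _ => by simp⟩
  let f₁ : 𝕜 × 𝕜 →L[ℝ] 𝕜 := ContinuousLinearMap.fst ℝ 𝕜 𝕜
  let f₂ : 𝕜 × 𝕜 →L[ℝ] 𝕜 := ContinuousLinearMap.snd ℝ 𝕜 𝕜
  let m : 𝕜 → 𝕜 →L[ℝ] 𝕜 := fun c => ContinuousLinearMap.mul ℝ 𝕜 c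
  have hm : Continuous m := (ContinuousLinearMap.mul ℝ 𝕜).continuous
  let A : 𝕜 → ℝ → 𝕜 × 𝕜 →L[ℝ] 𝕜 × 𝕜 := fun z t =>
    (ContinuousLinearMap.inl ℝ 𝕜 𝕜).comp ((m (S t)).comp f₁ + f₂) -
      (ContinuousLinearMap.inr ℝ 𝕜 𝕜).comp ((m (z + S t ^ 2)).comp f₁ + (m (S t)).comp f₂)
  have hA : Continuous (Function.uncurry A) := by
    have h1 : Continuous fun p : 𝕜 × ℝ => m (S p.2) := hm.comp (hSc.comp continuous_snd)
    have h2 : Continuous fun p : 𝕜 × ℝ => m (p.1 + S p.2 ^ 2) :=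
      hm.comp (continuous_fst.add ((hSc.comp continuous_snd).pow 2))
    exact (continuous_const.clm_comp ((h1.clm_comp continuous_const).add continuous_const)).sub
      (continuous_const.clm_comp ((h2.clm_comp continuous_const).add
        (h1.clm_comp continuous_const)))
  obtain ⟨Y, hYc, hY⟩ := exists_continuous_linear_ode_solution A hA (a, b)
  have hAY (z : 𝕜) (t : ℝ) : A z t (Y z t) = (S t * (Y z t).1 + (Y z t).2,
      -((z + S t ^ 2) * (Y z t).1 + S t * (Y z t).2)) := by
    simp [A, f₁, f₂, m]
    ring
  have hYz (z : 𝕜) : Continuous (Y z) := hYc.comp (by fun_prop : Continuous fun t => (z, t))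
  have hAYc (z : 𝕜) : Continuous fun t => A z t (Y z t) :=
    (hA.comp (by fun_prop : Continuous fun t => (z, t))).clm_apply (hYz z)
  have hY0 (z : 𝕜) : Y z 0 = (a, b) := by simpa using hY z 0 le_rfl
  have p₁ (z : 𝕜) : IsPrimitive (fun x => (Y z x).1) fun t => S t * (Y z t).1 + (Y z t).2 := by
    refine .of_continuousOn ?_ fun x hx => ?_
    · simpa only [hAY] using (hAYc z).fst.continuousOn
    · have h := (ContinuousLinearMap.fst ℝ 𝕜 𝕜).intervalIntegral_comp_comm
        ((hAYc z).intervalIntegrable (μ := volume) 0 x)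
      simp only [ContinuousLinearMap.coe_fst', hAY] at h
      rw [h, hY0]
      have := congrArg Prod.fst (hY z x hx)
      simpa only [hAY, Prod.fst_add, Prod.snd_add] using this
  have p₂ (z : 𝕜) : IsPrimitive (fun x => (Y z x).2)
      fun t => -((z + S t ^ 2) * (Y z t).1 + S t * (Y z t).2) := by
    refine .of_continuousOn ?_ fun x hx => ?_
    · simpa only [hAY] using (hAYc z).snd.continuousOn
    · have h := (ContinuousLinearMap.snd ℝ 𝕜 𝕜).intervalIntegral_comp_comm
        ((hAYc z).intervalIntegrable (μ := volume) 0 x)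
      simp only [ContinuousLinearMap.coe_snd', hAY] at h
      rw [h, hY0]
      have := congrArg Prod.snd (hY z x hx)
      simpa only [hAY, Prod.fst_add, Prod.snd_add] using this
  refine ⟨fun z x => (Y z x).1, fun z x => S x * (Y z x).1 + (Y z x).2, hYc.fst,
    ((hSc.comp continuous_snd).mul hYc.fst).add hYc.snd, fun z => ⟨?_, ?_, ?_⟩⟩
  · refine IsHillSolution.of_isPrimitive (p₁ z) ?_
    refine ((hSp.mul (p₁ z)).add (p₂ z)).congr_density fun x _ => ?_
    ring
  · simp [hY0]
  · simp [hY0, hS]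

theorem nonempty_hillSystem (𝕜 : Type*) [RCLike 𝕜] {q : ℝ → ℝ} (hq : LocallyIntegrable q volume) :
    Nonempty (HillSystem 𝕜 q) := by
  obtain ⟨u, du, h1, h2, hu⟩ := exists_isHillSolution 𝕜 hq 1 0
  obtain ⟨v, dv, h3, h4, hv⟩ := exists_isHillSolution 𝕜 hq 0 1
  exact ⟨⟨u, du, v, dv, h1, h2, h3, h4, fun z => (hu z).1, fun z => (hv z).1,
    fun z => (hu z).2.1, fun z => (hu z).2.2, fun z => (hv z).2.1, fun z => (hv z).2.2⟩⟩

namespace HillSystem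

variable {𝕜 : Type*} [RCLike 𝕜] {q : ℝ → ℝ} (S : HillSystem 𝕜 q) {z : 𝕜} {y dy : ℝ → 𝕜}

theorem wronskian (hq : LocallyIntegrable q volume) (z : 𝕜) {x : ℝ} (hx : 0 ≤ x) :
    S.u z x * S.dv z x - S.v z x * S.du z x = 1 := by
  rw [(S.solution_u z).wronskian_eq hq (S.solution_v z) hx, S.u_zero, S.dv_zero, S.v_zero]
  ring

/-- The Wronskians of `y` with `u` and `v` are constant and known at 0; since `u` and `v` have
Wronskian 1, Cramer's rule recovers `y`. Uniqueness for the initial value problem follows without a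
Gronwall estimate. -/
theorem eq_comb (hq : LocallyIntegrable q volume) (h : IsHillSolution q z y dy) {x : ℝ}
    (hx : 0 ≤ x) : y x = y 0 * S.u z x + dy 0 * S.v z x ∧
      dy x = y 0 * S.du z x + dy 0 * S.dv z x := by
  have hu := h.wronskian_eq hq (S.solution_u z) hx
  have hv := h.wronskian_eq hq (S.solution_v z) hx
  have hw := S.wronskian hq z hx
  rw [S.u_zero, S.du_zero] at hu
  rw [S.v_zero, S.dv_zero] at hv
  constructor
  · linear_combination S.u z x * hv - S.v z x * hu - y x * hw
  · linear_combination S.du z x * hv - S.dv z x * hu - dy x * hw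

end HillSystem

theorem IsHillSolution.unique {𝕜 : Type*} [RCLike 𝕜] {q : ℝ → ℝ} {z : 𝕜} {y dy w dw : ℝ → 𝕜}
    (hq : LocallyIntegrable q volume) (h : IsHillSolution q z y dy) (h' : IsHillSolution q z w dw)
    (h0 : y 0 = w 0) (h1 : dy 0 = dw 0) {x : ℝ} (hx : 0 ≤ x) : y x = w x ∧ dy x = dw x := by
  obtain ⟨S⟩ := nonempty_hillSystem 𝕜 hq
  rw [(S.eq_comb hq h hx).1, (S.eq_comb hq h hx).2, (S.eq_comb hq h' hx).1,
    (S.eq_comb hq h' hx).2, h0, h1]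
  exact ⟨rfl, rfl⟩

/-! ### Interlacing of the periodic and semi-periodic eigenvalues -/

/-- What is needed about the discriminant `D` and the multiplicities `mp`, `mm` of the periodic and
semi-periodic eigenvalues in order to locate the stability intervals. -/
structure IsDiscriminant (D D' : ℝ → ℝ) (mp mm : ℝ → ℕ) : Prop where
  hasDerivAt : ∀ x, HasDerivAt D (D' x) x
  continuous_deriv : Continuous D'
  mp_eq_zero : ∀ x, D x ≠ 2 → mp x = 0
  mm_eq_zero : ∀ x, D x ≠ -2 → mm x = 0
  mp_cases : ∀ x, D x = 2 →
    (mp x = 1 ∧ D' x ≠ 0) ∨ (mp x = 2 ∧ ∀ᶠ y in 𝓝[≠] x, D y ^ 2 < 4)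
  mm_cases : ∀ x, D x = -2 →
    (mm x = 1 ∧ D' x ≠ 0) ∨ (mm x = 2 ∧ ∀ᶠ y in 𝓝[≠] x, D y ^ 2 < 4)
  deriv_ne_zero : ∀ x, D x ^ 2 < 4 → D' x ≠ 0
  two_lt : ∃ x₀, ∀ x ≤ x₀, 2 < D x

/-- `e` is monotone and takes each value `x` exactly `m x` times. -/
def IsListing (e : ℕ → ℝ) (m : ℝ → ℕ) : Prop :=
  Monotone e ∧ ∀ x, {n : ℕ | e n = x}.encard = (m x : ℕ∞)

/-- Every listed value in `[y, z)` has positive multiplicity, so it can only be `x`. -/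
theorem IsListing.encard_lt_eq_add {e : ℕ → ℝ} {m : ℝ → ℕ} (h : IsListing e m) {x y z : ℝ}
    (hyx : y ≤ x) (hxz : x < z) (h0 : ∀ w ∈ Set.Ico y z, w ≠ x → m w = 0) :
    {n | e n < z}.encard = {n | e n < y}.encard + m x := by
  rw [← h.2 x, ← Set.encard_union_eq]
  · congr 1
    ext n
    simp only [Set.mem_ofPred_eq, Set.mem_union]
    constructor
    · intro hn
      by_contra! hcon
      have h1 := h.2 (e n)
      rw [h0 (e n) ⟨hcon.1, hn⟩ hcon.2, Nat.cast_zero, Set.encard_eq_zero] at h1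
      exact (Set.eq_empty_iff_forall_notMem.1 h1 n) rfl
    · rintro (hn | hn) <;> linarith
  · rw [Set.disjoint_left]
    intro n hn hn'
    simp only [Set.mem_ofPred_eq] at hn hn'
    linarith

theorem neg_of_continuousOn_of_ne_zero {g : ℝ → ℝ} {y z : ℝ}
    (hg : ContinuousOn g (Set.uIcc y z)) (h0 : ∀ w ∈ Set.uIcc y z, g w ≠ 0) (hy : g y < 0) :
    g z < 0 := by
  by_contra! hz
  obtain ⟨w, hw, hw'⟩ := intermediate_value_uIcc hg
    (Set.mem_uIcc.2 (Or.inl ⟨hy.le, hz⟩) : (0 : ℝ) ∈ Set.uIcc (g y) (g z))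
  exact h0 w hw hw'

theorem pos_of_continuousOn_of_ne_zero {g : ℝ → ℝ} {y z : ℝ}
    (hg : ContinuousOn g (Set.uIcc y z)) (h0 : ∀ w ∈ Set.uIcc y z, g w ≠ 0) (hy : 0 < g y) :
    0 < g z := by
  have := neg_of_continuousOn_of_ne_zero hg.neg (fun w hw => neg_ne_zero.2 (h0 w hw))
    (neg_lt_zero.2 hy)
  exact neg_lt_zero.1 this

namespace IsDiscriminant

variable {D D' : ℝ → ℝ} {mp mm : ℝ → ℕ} {per semi : ℕ → ℝ}

/-- The four possible positions of a point that is not an eigenvalue, with the numbers of periodic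
and of semi-periodic eigenvalues below it. -/
def Position (D D' : ℝ → ℝ) (per semi : ℕ → ℝ) (x : ℝ) : Prop :=
  ∃ k : ℕ,
    (2 < D x ∧ {n | per n < x}.encard = (2 * k : ℕ) ∧ {n | semi n < x}.encard = (2 * k : ℕ)) ∨
    (D x ^ 2 < 4 ∧ D' x < 0 ∧ {n | per n < x}.encard = (2 * k + 1 : ℕ) ∧
      {n | semi n < x}.encard = (2 * k : ℕ)) ∨
    (D x < -2 ∧ {n | per n < x}.encard = (2 * k + 1 : ℕ) ∧
      {n | semi n < x}.encard = (2 * k + 1 : ℕ)) ∨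
    (D x ^ 2 < 4 ∧ 0 < D' x ∧ {n | per n < x}.encard = (2 * k + 1 : ℕ) ∧
      {n | semi n < x}.encard = (2 * k + 2 : ℕ))

theorem continuous (h : IsDiscriminant D D' mp mm) : Continuous D :=
  continuous_iff_continuousAt.2 fun x => (h.hasDerivAt x).continuousAt

theorem sq_lt_four (h : IsDiscriminant D D' mp mm) {y z : ℝ}
    (h4 : ∀ w ∈ Set.uIcc y z, D w ^ 2 ≠ 4) (hy : D y ^ 2 < 4) :
    ∀ w ∈ Set.uIcc y z, D w ^ 2 < 4 := fun w hw => by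
  have hsub : Set.uIcc y w ⊆ Set.uIcc y z := Set.uIcc_subset_uIcc_left hw
  have := neg_of_continuousOn_of_ne_zero (g := fun x => D x ^ 2 - 4) (y := y) (z := w)
    ((h.continuous.pow 2).sub continuous_const).continuousOn
    (fun t ht => sub_ne_zero.2 (h4 t (hsub ht))) (by linarith)
  linarith

theorem deriv_neg (h : IsDiscriminant D D' mp mm) {y z : ℝ}
    (h4 : ∀ w ∈ Set.uIcc y z, D w ^ 2 < 4) (hy : D' y < 0) : D' z < 0 :=
  neg_of_continuousOn_of_ne_zero h.continuous_deriv.continuousOn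
    (fun w hw => h.deriv_ne_zero w (h4 w hw)) hy

theorem deriv_pos (h : IsDiscriminant D D' mp mm) {y z : ℝ}
    (h4 : ∀ w ∈ Set.uIcc y z, D w ^ 2 < 4) (hy : 0 < D' y) : 0 < D' z :=
  pos_of_continuousOn_of_ne_zero h.continuous_deriv.continuousOn
    (fun w hw => h.deriv_ne_zero w (h4 w hw)) hy

theorem mult_eq_zero (h : IsDiscriminant D D' mp mm) {x : ℝ} (hx : D x ^ 2 ≠ 4) :
    mp x = 0 ∧ mm x = 0 :=
  ⟨h.mp_eq_zero x fun h2 => hx (by rw [h2]; norm_num),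
    h.mm_eq_zero x fun h2 => hx (by rw [h2]; norm_num)⟩

/-- While `D` avoids `±2` no eigenvalue is passed, and by the intermediate value theorem `D - 2`, `D
+ 2` and `D² - 4` keep their signs. So does `D'` where `D² < 4`, since it has no zero there. -/
theorem position_of_ne (h : IsDiscriminant D D' mp mm) (hp : IsListing per mp)
    (hm : IsListing semi mm) {y z : ℝ} (hyz : y < z) (h4 : ∀ w ∈ Set.Icc y z, D w ^ 2 ≠ 4)
    (hy : Position D D' per semi y) : Position D D' per semi z := by
  have e0 := h.mult_eq_zero (h4 y ⟨le_rfl, hyz.le⟩)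
  have ep := hp.encard_lt_eq_add le_rfl hyz fun w hw _ =>
    (h.mult_eq_zero (h4 w ⟨hw.1, hw.2.le⟩)).1
  have em := hm.encard_lt_eq_add le_rfl hyz fun w hw _ =>
    (h.mult_eq_zero (h4 w ⟨hw.1, hw.2.le⟩)).2
  rw [e0.1, Nat.cast_zero, add_zero] at ep
  rw [e0.2, Nat.cast_zero, add_zero] at em
  rw [← Set.uIcc_of_le hyz.le] at h4
  obtain ⟨k, hk⟩ := hy
  refine ⟨k, ?_⟩
  rw [ep, em]
  rcases hk with ⟨h1, h2⟩ | ⟨h1, h2, h3⟩ | ⟨h1, h2⟩ | ⟨h1, h2, h3⟩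
  · refine Or.inl ⟨?_, h2⟩
    have := pos_of_continuousOn_of_ne_zero (g := fun x => D x - 2) (y := y) (z := z)
      (h.continuous.sub continuous_const).continuousOn
      (fun t ht h0 => h4 t ht (by rw [sub_eq_zero.1 h0]; norm_num)) (by linarith)
    linarith
  · have := h.sq_lt_four h4 h1
    exact Or.inr (Or.inl ⟨this z Set.right_mem_uIcc, h.deriv_neg this h2, h3⟩)
  · refine Or.inr (Or.inr (Or.inl ⟨?_, h2⟩))
    have := neg_of_continuousOn_of_ne_zero (g := fun x => D x + 2) (y := y) (z := z)
      (h.continuous.add continuous_const).continuousOn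
      (fun t ht h0 => h4 t ht (by rw [eq_neg_of_add_eq_zero_left h0]; norm_num)) (by linarith)
    linarith
  · have := h.sq_lt_four h4 h1
    exact Or.inr (Or.inr (Or.inr ⟨this z Set.right_mem_uIcc, h.deriv_pos this h2, h3⟩))

theorem exists_monotone_nhds (h : IsDiscriminant D D' mp mm) {x : ℝ} (hx : D' x ≠ 0) :
    ∃ δ > 0, (D' x < 0 ∧ (∀ y ∈ Set.Ioo (x - δ) (x + δ), D' y < 0) ∧
        StrictAntiOn D (Set.Ioo (x - δ) (x + δ))) ∨
      (0 < D' x ∧ (∀ y ∈ Set.Ioo (x - δ) (x + δ), 0 < D' y) ∧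
        StrictMonoOn D (Set.Ioo (x - δ) (x + δ))) := by
  rcases lt_or_gt_of_ne hx with hx | hx
  · obtain ⟨δ, hδ, hb⟩ := Metric.eventually_nhds_iff_ball.1
      (h.continuous_deriv.continuousAt.eventually_lt continuousAt_const hx)
    rw [Real.ball_eq_Ioo] at hb
    refine ⟨δ, hδ, Or.inl ⟨hx, hb, strictAntiOn_of_deriv_neg (convex_Ioo _ _)
      h.continuous.continuousOn fun y hy => ?_⟩⟩
    rw [(h.hasDerivAt y).deriv]
    exact hb y (interior_subset hy)
  · obtain ⟨δ, hδ, hb⟩ := Metric.eventually_nhds_iff_ball.1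
      (continuousAt_const.eventually_lt h.continuous_deriv.continuousAt hx)
    rw [Real.ball_eq_Ioo] at hb
    refine ⟨δ, hδ, Or.inr ⟨hx, hb, strictMonoOn_of_deriv_pos (convex_Ioo _ _)
      h.continuous.continuousOn fun y hy => ?_⟩⟩
    rw [(h.hasDerivAt y).deriv]
    exact hb y (interior_subset hy)

/-- Near a double eigenvalue, `D` tends to `±2` from inside `(-2, 2)`. -/
theorem deriv_signs (h : IsDiscriminant D D' mp mm) {x y z : ℝ} (hyx : y < x) (hxz : x < z)
    (hlt : ∀ w ∈ Set.Icc y z, w ≠ x → D w ^ 2 < 4) :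
    (D x = 2 → 0 < D' y ∧ D' z < 0) ∧ (D x = -2 → D' y < 0 ∧ 0 < D' z) := by
  -- The mean value theorem gives the sign of `D'` at one point on each side of `x`; as `D'` does
  -- not vanish where `D² < 4`, the sign carries over to `y` and `z`.
  obtain ⟨c, hc, hcd⟩ := exists_hasDerivAt_eq_slope D D' hyx h.continuous.continuousOn
    fun w _ => h.hasDerivAt w
  obtain ⟨d, hd, hdd⟩ := exists_hasDerivAt_eq_slope D D' hxz h.continuous.continuousOn
    fun w _ => h.hasDerivAt w
  have hy2 := hlt y ⟨le_rfl, by linarith⟩ hyx.ne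
  have hz2 := hlt z ⟨by linarith, le_rfl⟩ hxz.ne'
  have hyc : ∀ w ∈ Set.uIcc c y, D w ^ 2 < 4 := fun w hw => by
    rw [Set.uIcc_of_ge hc.1.le] at hw
    exact hlt w ⟨hw.1, by linarith [hw.2, hc.2]⟩ (by linarith [hw.2, hc.2] : w < x).ne
  have hdz : ∀ w ∈ Set.uIcc d z, D w ^ 2 < 4 := fun w hw => by
    rw [Set.uIcc_of_le hd.2.le] at hw
    exact hlt w ⟨by linarith [hw.1, hd.1], hw.2⟩ (by linarith [hw.1, hd.1] : x < w).ne'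
  constructor
  · intro hx
    constructor
    · refine h.deriv_pos hyc ?_
      rw [hcd, hx]
      exact div_pos (by nlinarith) (by linarith)
    · refine h.deriv_neg hdz ?_
      rw [hdd, hx]
      exact div_neg_of_neg_of_pos (by nlinarith) (by linarith)
  · intro hx
    constructor
    · refine h.deriv_neg hyc ?_
      rw [hcd, hx]
      exact div_neg_of_neg_of_pos (by nlinarith) (by linarith)
    · refine h.deriv_pos hdz ?_
      rw [hdd, hx]
      exact div_pos (by nlinarith) (by linarith)

/-- The position changes in the expected way when an eigenvalue is crossed. -/
theorem exists_position_of_eq (h : IsDiscriminant D D' mp mm) (hp : IsListing per mp)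
    (hm : IsListing semi mm) {x : ℝ} (hx : D x ^ 2 = 4) :
    ∃ δ > 0, (∀ w ∈ Set.Ioo (x - δ) (x + δ), w ≠ x → D w ^ 2 ≠ 4) ∧
      ∀ y ∈ Set.Ioo (x - δ) x, ∀ z ∈ Set.Ioo x (x + δ), Position D D' per semi y →
        Position D D' per semi z := by
  have hcase : D x = 2 ∨ D x = -2 := by
    have : (D x - 2) * (D x + 2) = 0 := by linarith
    rcases mul_eq_zero.1 this with h | h
    · left; linarith
    · right; linarith
  -- Staying within 1 of `D x = ±2` keeps `D` away from the opposite value `∓2`.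
  obtain ⟨ε, hε, hb⟩ := Metric.eventually_nhds_iff_ball.1 (Metric.continuousAt_iff'.1
    h.continuous.continuousAt 1 one_pos : ∀ᶠ y in 𝓝 x, dist (D y) (D x) < 1)
  simp only [Real.ball_eq_Ioo, Real.dist_eq] at hb
  have count {δ y z : ℝ} (h4 : ∀ w ∈ Set.Ioo (x - δ) (x + δ), w ≠ x → D w ^ 2 ≠ 4)
      (hy : y ∈ Set.Ioo (x - δ) x) (hz : z ∈ Set.Ioo x (x + δ)) :
      {n | per n < z}.encard = {n | per n < y}.encard + mp x ∧
      {n | semi n < z}.encard = {n | semi n < y}.encard + mm x := by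
    have h0 : ∀ w ∈ Set.Ico y z, w ≠ x → mp w = 0 ∧ mm w = 0 := fun w hw hwx =>
      h.mult_eq_zero (h4 w ⟨hy.1.trans_le hw.1, hw.2.trans hz.2⟩ hwx)
    exact ⟨hp.encard_lt_eq_add hy.2.le hz.1 fun w hw hwx => (h0 w hw hwx).1,
      hm.encard_lt_eq_add hy.2.le hz.1 fun w hw hwx => (h0 w hw hwx).2⟩
  -- If `D' x = 0`, the eigenvalue is double and `D` stays inside `(-2, 2)` on both sides; otherwise
  -- it is simple and `D` passes through `±2` monotonically.
  by_cases hder : D' x = 0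
  · have hdouble : (∀ᶠ y in 𝓝[≠] x, D y ^ 2 < 4) ∧
        ((D x = 2 ∧ mp x = 2 ∧ mm x = 0) ∨ (D x = -2 ∧ mp x = 0 ∧ mm x = 2)) := by
      rcases hcase with h2 | h2
      · rcases h.mp_cases x h2 with h3 | h3
        · exact absurd hder h3.2
        · exact ⟨h3.2, Or.inl ⟨h2, h3.1, h.mm_eq_zero x (by rw [h2]; norm_num)⟩⟩
      · rcases h.mm_cases x h2 with h3 | h3
        · exact absurd hder h3.2
        · exact ⟨h3.2, Or.inr ⟨h2, h.mp_eq_zero x (by rw [h2]; norm_num), h3.1⟩⟩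
    obtain ⟨hev, hval⟩ := hdouble
    obtain ⟨δ, hδ, hlt⟩ := Metric.eventually_nhds_iff_ball.1 (eventually_nhdsWithin_iff.1 hev)
    rw [Real.ball_eq_Ioo] at hlt
    refine ⟨δ, hδ, fun w hw hwx => (hlt w hw hwx).ne, fun y hy z hz hpos => ?_⟩
    obtain ⟨cp, cm⟩ := count (fun w hw hwx => (hlt w hw hwx).ne) hy hz
    have hsig := h.deriv_signs hy.2 hz.1 fun w hw hwx =>
      hlt w ⟨hy.1.trans_le hw.1, hw.2.trans_lt hz.2⟩ hwx
    have hz4 := hlt z ⟨by linarith [hz.1], hz.2⟩ hz.1.ne'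
    have hy4 := hlt y ⟨hy.1, by linarith [hy.2]⟩ hy.2.ne
    obtain ⟨k, hk⟩ := hpos
    rcases hval with ⟨h2, h3, h4⟩ | ⟨h2, h3, h4⟩
    · obtain ⟨s1, s2⟩ := hsig.1 h2
      rcases hk with ⟨h5, _⟩ | ⟨_, h5, _⟩ | ⟨h5, _⟩ | ⟨_, _, h5, h6⟩
      · nlinarith
      · linarith
      · nlinarith
      · refine ⟨k + 1, Or.inr (Or.inl ⟨hz4, s2, ?_, ?_⟩)⟩
        · rw [cp, h5, h3]; norm_cast
        · rw [cm, h6, h4]; norm_cast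
    · obtain ⟨s1, s2⟩ := hsig.2 h2
      rcases hk with ⟨h5, _⟩ | ⟨_, _, h5, h6⟩ | ⟨h5, _⟩ | ⟨_, h5, _⟩
      · nlinarith
      · refine ⟨k, Or.inr (Or.inr (Or.inr ⟨hz4, s2, ?_, ?_⟩))⟩
        · rw [cp, h5, h3]; norm_cast
        · rw [cm, h6, h4]; norm_cast
      · nlinarith
      · linarith
  · have hsimple : (D x = 2 ∧ mp x = 1 ∧ mm x = 0) ∨ (D x = -2 ∧ mp x = 0 ∧ mm x = 1) := by
      rcases hcase with h2 | h2
      · rcases h.mp_cases x h2 with h3 | h3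
        · exact Or.inl ⟨h2, h3.1, h.mm_eq_zero x (by rw [h2]; norm_num)⟩
        -- A double eigenvalue is a local extremum of `D`, contrary to `D' x ≠ 0`.
        · obtain ⟨δ, hδ, hlt⟩ := Metric.eventually_nhds_iff_ball.1
            (eventually_nhdsWithin_iff.1 h3.2)
          have hloc : IsLocalMax D x := by
            filter_upwards [Metric.ball_mem_nhds x hδ] with y hy
            rcases eq_or_ne y x with rfl | hne
            · exact le_rfl
            · nlinarith [hlt y hy hne]
          exact absurd (hloc.hasDerivAt_eq_zero (h.hasDerivAt x)) hder
      · rcases h.mm_cases x h2 with h3 | h3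
        · exact Or.inr ⟨h2, h.mp_eq_zero x (by rw [h2]; norm_num), h3.1⟩
        · obtain ⟨δ, hδ, hlt⟩ := Metric.eventually_nhds_iff_ball.1
            (eventually_nhdsWithin_iff.1 h3.2)
          have hloc : IsLocalMin D x := by
            filter_upwards [Metric.ball_mem_nhds x hδ] with y hy
            rcases eq_or_ne y x with rfl | hne
            · exact le_rfl
            · nlinarith [hlt y hy hne]
          exact absurd (hloc.hasDerivAt_eq_zero (h.hasDerivAt x)) hder
    obtain ⟨δ₀, hδ₀, hmon⟩ := h.exists_monotone_nhds hder
    obtain ⟨δ, hδ, hδε, hδδ⟩ : ∃ δ > 0, δ ≤ ε ∧ δ ≤ δ₀ :=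
      ⟨min ε δ₀, lt_min hε hδ₀, min_le_left _ _, min_le_right _ _⟩
    have hsub : Set.Ioo (x - δ) (x + δ) ⊆ Set.Ioo (x - δ₀) (x + δ₀) :=
      Set.Ioo_subset_Ioo (by linarith) (by linarith)
    have hxm : x ∈ Set.Ioo (x - δ) (x + δ) := ⟨by linarith, by linarith⟩
    have hmon' : (D' x < 0 ∧ (∀ y ∈ Set.Ioo (x - δ) (x + δ), D' y < 0) ∧
        StrictAntiOn D (Set.Ioo (x - δ) (x + δ))) ∨
      (0 < D' x ∧ (∀ y ∈ Set.Ioo (x - δ) (x + δ), 0 < D' y) ∧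
        StrictMonoOn D (Set.Ioo (x - δ) (x + δ))) :=
      hmon.imp (fun h => ⟨h.1, fun y hy => h.2.1 y (hsub hy), h.2.2.mono hsub⟩)
        (fun h => ⟨h.1, fun y hy => h.2.1 y (hsub hy), h.2.2.mono hsub⟩)
    have hclose : ∀ w ∈ Set.Ioo (x - δ) (x + δ), |D w - D x| < 1 := fun w hw =>
      hb w ⟨by linarith [hw.1], by linarith [hw.2]⟩
    have h4 : ∀ w ∈ Set.Ioo (x - δ) (x + δ), w ≠ x → D w ^ 2 ≠ 4 := fun w hw hwx hw4 => by
      have hinj : D w ≠ D x := by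
        rcases hmon' with h | h
        · exact fun he => hwx (h.2.2.injOn hw hxm he)
        · exact fun he => hwx (h.2.2.injOn hw hxm he)
      have h5 := abs_lt.1 (hclose w hw)
      have : (D w - D x) * (D w + D x) = 0 := by linarith
      rcases mul_eq_zero.1 this with h | h
      · exact hinj (by linarith)
      · rcases hcase with h2 | h2 <;> linarith
    refine ⟨δ, hδ, h4, fun y hy z hz hpos => ?_⟩
    obtain ⟨cp, cm⟩ := count h4 hy hz
    have hy' : y ∈ Set.Ioo (x - δ) (x + δ) := ⟨hy.1, by linarith [hy.2]⟩
    have hz' : z ∈ Set.Ioo (x - δ) (x + δ) := ⟨by linarith [hz.1], hz.2⟩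
    have cy := abs_lt.1 (hclose y hy')
    have cz := abs_lt.1 (hclose z hz')
    obtain ⟨k, hk⟩ := hpos
    rcases hmon' with ⟨_, dneg, anti⟩ | ⟨_, dpos, mono⟩
    · have l1 := anti hy' hxm hy.2
      have l2 := anti hxm hz' hz.1
      have dy := dneg y hy'
      have dz := dneg z hz'
      rcases hsimple with ⟨h2, h3, h4⟩ | ⟨h2, h3, h4⟩ <;> rw [h2] at l1 l2 cy cz
      · rcases hk with ⟨_, h5, h6⟩ | ⟨h5, _⟩ | ⟨h5, _⟩ | ⟨h5, _⟩
        · refine ⟨k, Or.inr (Or.inl ⟨by nlinarith, dz, ?_, ?_⟩)⟩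
          · rw [cp, h5, h3]; norm_cast
          · rw [cm, h6, h4]; norm_cast
        · nlinarith
        · linarith
        · nlinarith
      · rcases hk with ⟨h5, _⟩ | ⟨_, _, h5, h6⟩ | ⟨h5, _⟩ | ⟨_, h5, _⟩
        · linarith
        · refine ⟨k, Or.inr (Or.inr (Or.inl ⟨l2, ?_, ?_⟩))⟩
          · rw [cp, h5, h3]; norm_cast
          · rw [cm, h6, h4]; norm_cast
        · linarith
        · linarith
    · have l1 := mono hy' hxm hy.2
      have l2 := mono hxm hz' hz.1
      have dy := dpos y hy'
      have dz := dpos z hz'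
      rcases hsimple with ⟨h2, h3, h4⟩ | ⟨h2, h3, h4⟩ <;> rw [h2] at l1 l2 cy cz
      · rcases hk with ⟨h5, _⟩ | ⟨_, h5, _⟩ | ⟨h5, _⟩ | ⟨_, _, h5, h6⟩
        · linarith
        · linarith
        · linarith
        · refine ⟨k + 1, Or.inl ⟨l2, ?_, ?_⟩⟩
          · rw [cp, h5, h3]; norm_cast
          · rw [cm, h6, h4]; norm_cast
      · rcases hk with ⟨h5, _⟩ | ⟨h5, _⟩ | ⟨_, h5, h6⟩ | ⟨h5, _⟩
        · linarith
        · nlinarith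
        · refine ⟨k, Or.inr (Or.inr (Or.inr ⟨by nlinarith, dz, ?_, ?_⟩))⟩
          · rw [cp, h5, h3]; norm_cast
          · rw [cm, h6, h4]; norm_cast
        · nlinarith

/-- Continuous induction from the far left, where `D > 2` and both counts are 0. At the supremum of
the points up to which the claim holds, it can be pushed further, by crossing an eigenvalue or by
moving through a region without one. -/
theorem position (h : IsDiscriminant D D' mp mm) (hp : IsListing per mp)
    (hm : IsListing semi mm) {x : ℝ} (hx : D x ^ 2 ≠ 4) : Position D D' per semi x := by
  set A : Set ℝ := {x | ∀ y ≤ x, D y ^ 2 ≠ 4 → Position D D' per semi y} with hA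
  suffices hall : ∀ x, x ∈ A from hall x x le_rfl hx
  by_contra! hcon
  obtain ⟨b, hb⟩ := hcon
  have hbdd : BddAbove A := ⟨b, fun a ha => by
    by_contra! hab
    exact hb fun y hy => ha y (hy.trans hab.le)⟩
  obtain ⟨x₀, hx₀⟩ := h.two_lt
  have hempty {e : ℕ → ℝ} {m : ℝ → ℕ} (he : IsListing e m)
      (hm0 : ∀ x, D x ^ 2 ≠ 4 → m x = 0) {y : ℝ} (hy : y ≤ x₀) : {n | e n < y}.encard = 0 := by
    rw [Set.encard_eq_zero, Set.eq_empty_iff_forall_notMem]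
    intro n (hn : e n < y)
    have h1 := he.2 (e n)
    have h2 := hx₀ (e n) (by linarith)
    rw [hm0 (e n) (by nlinarith), Nat.cast_zero, Set.encard_eq_zero] at h1
    exact (Set.eq_empty_iff_forall_notMem.1 h1 n) rfl
  have hne : A.Nonempty := ⟨x₀, fun y hy _ => ⟨0, Or.inl ⟨hx₀ y hy, by
    simpa using hempty hp (fun x hx => (h.mult_eq_zero hx).1) hy, by
    simpa using hempty hm (fun x hx => (h.mult_eq_zero hx).2) hy⟩⟩⟩
  set s := sSup A
  have hlt : ∀ y < s, D y ^ 2 ≠ 4 → Position D D' per semi y := fun y hy => by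
    obtain ⟨a, ha, hya⟩ := exists_lt_of_lt_csSup hne hy
    exact ha y hya.le
  suffices hstep : ∃ δ > 0, ∀ z ∈ Set.Ico s (s + δ), D z ^ 2 ≠ 4 → Position D D' per semi z by
    obtain ⟨δ, hδ, hz⟩ := hstep
    have hmem : s + δ / 2 ∈ A := fun y hy hy4 => by
      rcases lt_or_ge y s with hys | hys
      · exact hlt y hys hy4
      · exact hz y ⟨hys, by linarith⟩ hy4
    have := le_csSup hbdd hmem
    linarith
  by_cases hs : D s ^ 2 = 4
  · obtain ⟨δ, hδ, h4, hcross⟩ := h.exists_position_of_eq hp hm hs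
    refine ⟨δ, hδ, fun z hz hz4 => ?_⟩
    have hzs : s < z := lt_of_le_of_ne hz.1 fun he => hz4 (he ▸ hs)
    have hmid : s - δ / 2 ∈ Set.Ioo (s - δ) s := ⟨by linarith, by linarith⟩
    exact hcross _ hmid z ⟨hzs, hz.2⟩
      (hlt _ hmid.2 (h4 _ ⟨hmid.1, by linarith⟩ hmid.2.ne))
  · obtain ⟨δ, hδ, h4⟩ := Metric.eventually_nhds_iff_ball.1
      ((h.continuous.pow 2).continuousAt.eventually_ne hs)
    rw [Real.ball_eq_Ioo] at h4
    refine ⟨δ, hδ, fun z hz _ => ?_⟩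
    refine h.position_of_ne hp hm (y := s - δ / 2) (by linarith [hz.1]) (fun w hw => ?_)
      (hlt _ (by linarith) (h4 _ ⟨by linarith, by linarith⟩))
    exact h4 w ⟨by linarith [hw.1], by linarith [hw.2, hz.2]⟩

theorem lt_encard {e : ℕ → ℝ} (he : Monotone e) {n : ℕ} {x : ℝ} (hx : e n < x) :
    ((n + 1 : ℕ) : ℕ∞) ≤ {k | e k < x}.encard := by
  have hsub : (Finset.range (n + 1) : Set ℕ) ⊆ {k | e k < x} := fun k hk => by
    simp only [Finset.coe_range, Set.mem_Iio] at hk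
    exact (he (by lia)).trans_lt hx
  calc ((n + 1 : ℕ) : ℕ∞) = (Finset.range (n + 1) : Set ℕ).encard := by
        rw [Set.encard_coe_eq_coe_finsetCard, Finset.card_range]
    _ ≤ _ := Set.encard_le_encard hsub

theorem encard_le {e : ℕ → ℝ} (he : Monotone e) {n : ℕ} {x : ℝ} (hx : x ≤ e n) :
    {k | e k < x}.encard ≤ (n : ℕ∞) := by
  have hsub : {k | e k < x} ⊆ (Finset.range n : Set ℕ) := fun k hk => by
    simp only [Finset.coe_range, Set.mem_Iio]
    by_contra! hnk
    exact absurd (he hnk) (not_le.2 ((hk : e k < x).trans_le hx))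
  calc _ ≤ (Finset.range n : Set ℕ).encard := Set.encard_le_encard hsub
    _ = n := by rw [Set.encard_coe_eq_coe_finsetCard, Finset.card_range]

/-- At `D = ±2` an eigenvalue of multiplicity at least 1 is passed, so one of the two counts would
jump. -/
theorem sq_ne_four_of_encard_eq (h : IsDiscriminant D D' mp mm) (hp : IsListing per mp)
    (hm : IsListing semi mm) {a b : ℕ} {x : ℝ}
    (hev : ∀ᶠ y in 𝓝 x, D y ^ 2 ≠ 4 → {n | per n < y}.encard = a ∧ {n | semi n < y}.encard = b) :
    D x ^ 2 ≠ 4 := fun hx4 => by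
  obtain ⟨δ, hδ, h4, -⟩ := h.exists_position_of_eq hp hm hx4
  obtain ⟨ε, hε, hb⟩ := Metric.eventually_nhds_iff_ball.1 hev
  rw [Real.ball_eq_Ioo] at hb
  obtain ⟨η, hη, h1, h2⟩ : ∃ η > 0, η < ε ∧ η < δ :=
    ⟨min ε δ / 2, by positivity, by linarith [min_le_left ε δ, lt_min hε hδ],
      by linarith [min_le_right ε δ, lt_min hε hδ]⟩
  obtain ⟨p1, s1⟩ := hb (x - η) ⟨by linarith, by linarith⟩
    (h4 _ ⟨by linarith, by linarith⟩ (by linarith))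
  obtain ⟨p2, s2⟩ := hb (x + η) ⟨by linarith, by linarith⟩
    (h4 _ ⟨by linarith, by linarith⟩ (by linarith))
  have h0 : ∀ w ∈ Set.Ico (x - η) (x + η), w ≠ x → mp w = 0 ∧ mm w = 0 := fun w hw hwx =>
    h.mult_eq_zero (h4 w ⟨by linarith [hw.1], by linarith [hw.2]⟩ hwx)
  have cp := hp.encard_lt_eq_add (x := x) (y := x - η) (z := x + η) (by linarith) (by linarith)
    fun w hw hwx => (h0 w hw hwx).1
  have cm := hm.encard_lt_eq_add (x := x) (y := x - η) (z := x + η) (by linarith) (by linarith)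
    fun w hw hwx => (h0 w hw hwx).2
  rw [p1, p2] at cp
  rw [s1, s2] at cm
  norm_cast at cp cm
  have : (D x - 2) * (D x + 2) = 0 := by linarith
  rcases mul_eq_zero.1 this with h3 | h3
  · rcases h.mp_cases x (by linarith) with h5 | h5 <;> lia
  · rcases h.mm_cases x (by linarith) with h5 | h5 <;> lia

/-- In `(per (2m), semi (2m))` at least `2m + 1` periodic and at most `2m` semi-periodic eigenvalues
lie below. Of the four possible pairs of counts only `(2k + 1, 2k)` with `k = m` fits, and there `D²
< 4`. The other kind of interval singles out `(2m + 1, 2m + 2)` in the same way. Points with `D² =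
4` are excluded because the counts are constant around them. -/
theorem sq_lt_four_of_mem (h : IsDiscriminant D D' mp mm) (hp : IsListing per mp)
    (hm : IsListing semi mm) {m : ℕ} {x : ℝ}
    (hx : x ∈ Set.Ioo (per (2 * m)) (semi (2 * m)) ∨
      x ∈ Set.Ioo (semi (2 * m + 1)) (per (2 * m + 1))) : D x ^ 2 < 4 := by
  rcases hx with hx | hx
  · have key : ∀ y ∈ Set.Ioo (per (2 * m)) (semi (2 * m)), D y ^ 2 ≠ 4 → D y ^ 2 < 4 ∧
        {n | per n < y}.encard = (2 * m + 1 : ℕ) ∧ {n | semi n < y}.encard = (2 * m : ℕ) := by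
      intro y hy hy4
      obtain ⟨k, hk⟩ := h.position hp hm hy4
      have a1 := lt_encard hp.1 hy.1
      have a2 := encard_le hm.1 hy.2.le
      rcases hk with ⟨_, h1, h2⟩ | ⟨h0, _, h1, h2⟩ | ⟨_, h1, h2⟩ | ⟨_, _, h1, h2⟩ <;>
        rw [h1] at a1 ⊢ <;> rw [h2] at a2 ⊢ <;> norm_cast at a1 a2 ⊢
      · lia
      · exact ⟨h0, by lia, by lia⟩
      · lia
      · lia
    refine (key x hx (h.sq_ne_four_of_encard_eq hp hm (a := 2 * m + 1) (b := 2 * m) ?_)).1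
    filter_upwards [isOpen_Ioo.mem_nhds hx] with y hy hy4 using (key y hy hy4).2
  · have key : ∀ y ∈ Set.Ioo (semi (2 * m + 1)) (per (2 * m + 1)), D y ^ 2 ≠ 4 → D y ^ 2 < 4 ∧
        {n | per n < y}.encard = (2 * m + 1 : ℕ) ∧ {n | semi n < y}.encard = (2 * m + 2 : ℕ) := by
      intro y hy hy4
      obtain ⟨k, hk⟩ := h.position hp hm hy4
      have a1 := lt_encard hm.1 hy.1
      have a2 := encard_le hp.1 hy.2.le
      rcases hk with ⟨_, h1, h2⟩ | ⟨_, _, h1, h2⟩ | ⟨_, h1, h2⟩ | ⟨h0, _, h1, h2⟩ <;>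
        rw [h2] at a1 ⊢ <;> rw [h1] at a2 ⊢ <;> norm_cast at a1 a2 ⊢
      · lia
      · lia
      · lia
      · exact ⟨h0, by lia, by lia⟩
    refine (key x hx (h.sq_ne_four_of_encard_eq hp hm (a := 2 * m + 1) (b := 2 * m + 2) ?_)).1
    filter_upwards [isOpen_Ioo.mem_nhds hx] with y hy hy4 using (key y hy hy4).2

end IsDiscriminant

/-! ### The discriminant -/

namespace HillSystem

section General

variable {𝕜 : Type*} [RCLike 𝕜] {q : ℝ → ℝ} (S : HillSystem 𝕜 q)

/-- Hill's discriminant, the trace of the monodromy matrix. -/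
def disc (ℓ : ℝ) (z : 𝕜) : 𝕜 := S.u z ℓ + S.dv z ℓ

theorem continuous_u_left (x : ℝ) : Continuous fun z => S.u z x :=
  S.continuous_u.comp (by fun_prop : Continuous fun z : 𝕜 => (z, x))

theorem continuous_du_left (x : ℝ) : Continuous fun z => S.du z x :=
  S.continuous_du.comp (by fun_prop : Continuous fun z : 𝕜 => (z, x))

theorem continuous_v_left (x : ℝ) : Continuous fun z => S.v z x :=
  S.continuous_v.comp (by fun_prop : Continuous fun z : 𝕜 => (z, x))

theorem continuous_dv_left (x : ℝ) : Continuous fun z => S.dv z x :=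
  S.continuous_dv.comp (by fun_prop : Continuous fun z : 𝕜 => (z, x))

theorem continuous_disc (ℓ : ℝ) : Continuous (S.disc ℓ) :=
  (S.continuous_u_left ℓ).add (S.continuous_dv_left ℓ)

/-- The discriminant of the characteristic polynomial of the monodromy matrix. -/
theorem disc_sq_sub_four (hq : LocallyIntegrable q volume) {ℓ : ℝ} (hℓ : 0 ≤ ℓ) (z : 𝕜) :
    S.disc ℓ z ^ 2 - 4 = (S.dv z ℓ - S.u z ℓ) ^ 2 + 4 * (S.v z ℓ * S.du z ℓ) := by
  have := S.wronskian hq z hℓ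
  rw [disc]
  linear_combination 4 * this

/-- The values after one period of a solution. -/
theorem translate (hq : LocallyIntegrable q volume) {ℓ : ℝ} (hℓ : 0 ≤ ℓ)
    (hper : Function.Periodic q ℓ) {z : 𝕜} {y dy : ℝ → 𝕜} (h : IsHillSolution q z y dy) {x : ℝ}
    (hx : 0 ≤ x) : y (x + ℓ) = y ℓ * S.u z x + dy ℓ * S.v z x ∧
      dy (x + ℓ) = y ℓ * S.du z x + dy ℓ * S.dv z x := by
  simpa using S.eq_comb hq (h.comp_add_right hq hℓ hper) hx

end General

variable {q : ℝ → ℝ} (S : HillSystem ℝ q)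

theorem v_ne_zero (hq : LocallyIntegrable q volume) {ℓ x : ℝ} (hℓ : 0 ≤ ℓ)
    (hD : S.disc ℓ x ^ 2 < 4) : S.v x ℓ ≠ 0 := fun h0 => by
  have := S.disc_sq_sub_four hq hℓ x
  rw [h0] at this
  nlinarith [sq_nonneg (S.dv x ℓ - S.u x ℓ)]

theorem continuous_integral_mul {f g : ℝ → ℝ → ℝ} (hf : Continuous (Function.uncurry f))
    (hg : Continuous (Function.uncurry g)) (ℓ : ℝ) :
    Continuous fun p : ℝ × ℝ => ∫ t in (0 : ℝ)..ℓ, f p.2 t * g p.1 t := by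
  refine intervalIntegral.continuous_parametric_intervalIntegral_of_continuous' ?_ 0 ℓ
  exact (hf.comp (by fun_prop : Continuous fun a : (ℝ × ℝ) × ℝ => (a.1.2, a.2))).mul
    (hg.comp (by fun_prop : Continuous fun a : (ℝ × ℝ) × ℝ => (a.1.1, a.2)))

/-- The difference quotient of the discriminant. -/
noncomputable def discSlope (ℓ : ℝ) (p : ℝ × ℝ) : ℝ :=
  S.u p.1 ℓ * (∫ t in (0 : ℝ)..ℓ, S.u p.2 t * S.v p.1 t)
    - S.v p.1 ℓ * (∫ t in (0 : ℝ)..ℓ, S.u p.2 t * S.u p.1 t)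
    + S.du p.1 ℓ * (∫ t in (0 : ℝ)..ℓ, S.v p.2 t * S.v p.1 t)
    - S.dv p.1 ℓ * (∫ t in (0 : ℝ)..ℓ, S.v p.2 t * S.u p.1 t)

theorem continuous_discSlope (ℓ : ℝ) : Continuous (S.discSlope ℓ) := by
  have hu := S.continuous_u
  have hv := S.continuous_v
  exact (((((S.continuous_u_left ℓ).comp continuous_fst).mul (continuous_integral_mul hu hv ℓ)).sub
    (((S.continuous_v_left ℓ).comp continuous_fst).mul (continuous_integral_mul hu hu ℓ))).add
    (((S.continuous_du_left ℓ).comp continuous_fst).mul (continuous_integral_mul hv hv ℓ))).sub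
    (((S.continuous_dv_left ℓ).comp continuous_fst).mul (continuous_integral_mul hv hu ℓ))

/-- The monodromy matrices at two parameters are related by Lagrange's identity. -/
theorem lagrange_entries (hq : LocallyIntegrable q volume) {ℓ : ℝ} (hℓ : 0 ≤ ℓ) (x y : ℝ) :
    S.u y ℓ * S.dv x ℓ - S.v x ℓ * S.du y ℓ =
        1 + (y - x) * ∫ t in (0 : ℝ)..ℓ, S.u y t * S.v x t ∧
    S.v y ℓ * S.dv x ℓ - S.v x ℓ * S.dv y ℓ =
        (y - x) * ∫ t in (0 : ℝ)..ℓ, S.v y t * S.v x t ∧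
    S.u y ℓ * S.du x ℓ - S.u x ℓ * S.du y ℓ =
        (y - x) * ∫ t in (0 : ℝ)..ℓ, S.u y t * S.u x t ∧
    S.v y ℓ * S.du x ℓ - S.u x ℓ * S.dv y ℓ =
        -1 + (y - x) * ∫ t in (0 : ℝ)..ℓ, S.v y t * S.u x t := by
  have h1 := ((S.solution_u y).lagrange hq (S.solution_v x)).eq ℓ hℓ
  have h2 := ((S.solution_v y).lagrange hq (S.solution_v x)).eq ℓ hℓ
  have h3 := ((S.solution_u y).lagrange hq (S.solution_u x)).eq ℓ hℓ
  have h4 := ((S.solution_v y).lagrange hq (S.solution_u x)).eq ℓ hℓ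
  simp only [intervalIntegral.integral_const_mul, S.u_zero, S.du_zero, S.v_zero, S.dv_zero] at *
  refine ⟨?_, ?_, ?_, ?_⟩ <;> linarith

/-- Up to sign, `lagrange_entries` lists the entries of `M(x)⁻¹ M(y)`, which is the identity plus `y
- x` times a matrix of integrals. Multiplying by `M(x)` and taking the trace gives an exact
difference quotient; its continuity yields the derivative without differentiating solutions in the
parameter. -/
theorem disc_sub_disc (hq : LocallyIntegrable q volume) {ℓ : ℝ} (hℓ : 0 ≤ ℓ) (x y : ℝ) :
    S.disc ℓ y - S.disc ℓ x = (y - x) * S.discSlope ℓ (x, y) := by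
  obtain ⟨h1, h2, h3, h4⟩ := S.lagrange_entries hq hℓ x y
  have hw := S.wronskian hq x hℓ
  simp only [disc, discSlope]
  linear_combination S.u x ℓ * h1 - S.v x ℓ * h3 + S.du x ℓ * h2 - S.dv x ℓ * h4
    - (S.u y ℓ + S.dv y ℓ) * hw

theorem hasDerivAt_disc (hq : LocallyIntegrable q volume) {ℓ : ℝ} (hℓ : 0 ≤ ℓ) (x : ℝ) :
    HasDerivAt (S.disc ℓ) (S.discSlope ℓ (x, x)) x := by
  rw [hasDerivAt_iff_tendsto_slope]
  have hc : Continuous fun y => S.discSlope ℓ (x, y) :=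
    (S.continuous_discSlope ℓ).comp (by fun_prop)
  refine ((hc.tendsto x).mono_left nhdsWithin_le_nhds).congr' ?_
  filter_upwards [self_mem_nhdsWithin] with y (hy : y ≠ x)
  rw [slope_def_field, S.disc_sub_disc hq hℓ, mul_div_cancel_left₀ _ (sub_ne_zero.2 hy)]

/-- The Gram matrix of `u` and `v` on a period is positive definite. -/
theorem gram_pos (hq : LocallyIntegrable q volume) {ℓ : ℝ} (hℓ : 0 < ℓ) (x : ℝ) {a b : ℝ}
    (hab : ¬(a = 0 ∧ b = 0)) :
    0 < a ^ 2 * (∫ t in (0 : ℝ)..ℓ, S.u x t * S.u x t)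
      + 2 * a * b * (∫ t in (0 : ℝ)..ℓ, S.u x t * S.v x t)
      + b ^ 2 * ∫ t in (0 : ℝ)..ℓ, S.v x t * S.v x t := by
  have hpos := ((S.solution_u x).linear_comb hq (S.solution_v x) a b).integral_norm_sq_pos hℓ
    (by simpa [S.u_zero, S.du_zero, S.v_zero, S.dv_zero] using hab)
  have hu : Continuous (S.u x) := S.continuous_u.comp (by fun_prop : Continuous fun t => (x, t))
  have hv : Continuous (S.v x) := S.continuous_v.comp (by fun_prop : Continuous fun t => (x, t))
  rw [← intervalIntegral.integral_const_mul, ← intervalIntegral.integral_const_mul,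
    ← intervalIntegral.integral_const_mul, ← intervalIntegral.integral_add,
    ← intervalIntegral.integral_add]
  · refine hpos.trans_eq (intervalIntegral.integral_congr fun t _ => ?_)
    simp only [Real.norm_eq_abs, sq_abs]
    ring
  all_goals exact Continuous.intervalIntegrable (by fun_prop) _ _

theorem gram_det_pos (hq : LocallyIntegrable q volume) {ℓ : ℝ} (hℓ : 0 < ℓ) (x : ℝ) :
    0 < (∫ t in (0 : ℝ)..ℓ, S.u x t * S.u x t) ∧ 0 < (∫ t in (0 : ℝ)..ℓ, S.v x t * S.v x t) ∧
    (∫ t in (0 : ℝ)..ℓ, S.u x t * S.v x t) ^ 2 <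
      (∫ t in (0 : ℝ)..ℓ, S.u x t * S.u x t) * ∫ t in (0 : ℝ)..ℓ, S.v x t * S.v x t := by
  have hA := S.gram_pos hq hℓ x (a := 1) (b := 0) (by simp)
  have hC := S.gram_pos hq hℓ x (a := 0) (b := 1) (by simp)
  -- With `A`, `B`, `C` the Gram entries, the form at `(C, -B)` equals `C (A C - B²)`.
  have h := S.gram_pos hq hℓ x (a := ∫ t in (0 : ℝ)..ℓ, S.v x t * S.v x t)
    (b := -∫ t in (0 : ℝ)..ℓ, S.u x t * S.v x t)
  set A := ∫ t in (0 : ℝ)..ℓ, S.u x t * S.u x t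
  set B := ∫ t in (0 : ℝ)..ℓ, S.u x t * S.v x t
  set C := ∫ t in (0 : ℝ)..ℓ, S.v x t * S.v x t
  have hC' : 0 < C := by linarith
  refine ⟨by linarith, hC', ?_⟩
  have h' := h fun h0 => hC'.ne' h0.1
  have : 0 < C * (A * C - B ^ 2) := by linarith
  linarith [pos_of_mul_pos_right this hC'.le]

theorem integral_vu_eq (ℓ x : ℝ) :
    (∫ t in (0 : ℝ)..ℓ, S.v x t * S.u x t) = ∫ t in (0 : ℝ)..ℓ, S.u x t * S.v x t := by
  simp only [mul_comm]

/-- A critical point of the discriminant where it lies in `[-2, 2]` is a double eigenvalue. -/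
theorem monodromy_of_discSlope_eq_zero (hq : LocallyIntegrable q volume) {ℓ : ℝ} (hℓ : 0 < ℓ)
    {x : ℝ} (h0 : S.discSlope ℓ (x, x) = 0) (h4 : S.disc ℓ x ^ 2 ≤ 4) :
    S.v x ℓ = 0 ∧ S.du x ℓ = 0 ∧ S.u x ℓ = S.dv x ℓ := by
  obtain ⟨hA, hC, hdet⟩ := S.gram_det_pos hq hℓ x
  have hD := S.disc_sq_sub_four hq hℓ.le x
  simp only [discSlope, integral_vu_eq] at h0
  set A := ∫ t in (0 : ℝ)..ℓ, S.u x t * S.u x t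
  set B := ∫ t in (0 : ℝ)..ℓ, S.u x t * S.v x t
  set C := ∫ t in (0 : ℝ)..ℓ, S.v x t * S.v x t
  -- In these variables the hypotheses read `p A + s C = -r B` and `r² ≤ 4 p s`. Hence `4 p s A C ≤
  -- (p A + s C)² = r² B² ≤ 4 p s B²`, and `B² < A C` forces `p s = 0`; then everything vanishes.
  obtain ⟨p, hp⟩ : ∃ p, p = S.v x ℓ := ⟨_, rfl⟩
  obtain ⟨s, hs⟩ : ∃ s, s = -S.du x ℓ := ⟨_, rfl⟩
  obtain ⟨r, hr⟩ : ∃ r, r = S.dv x ℓ - S.u x ℓ := ⟨_, rfl⟩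
  have hlin : p * A + s * C = -(r * B) := by rw [hp, hs, hr]; linarith
  have hrps : r ^ 2 ≤ 4 * (p * s) := by rw [hp, hs, hr]; linarith
  have hps : 0 ≤ p * s := by nlinarith [sq_nonneg r]
  have h1 : (p * A + s * C) ^ 2 = r ^ 2 * B ^ 2 := by rw [hlin]; ring
  have h2 : p * s * (A * C - B ^ 2) ≤ 0 := by
    have := mul_le_mul_of_nonneg_right hrps (sq_nonneg B)
    nlinarith [sq_nonneg (p * A - s * C)]
  have hps0 : p * s = 0 := by
    rcases hps.eq_or_lt with h | h
    · exact h.symm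
    · exact absurd h2 (not_le.2 (mul_pos h (sub_pos.2 hdet)))
  have hr0 : r = 0 := by
    have : r ^ 2 = 0 := le_antisymm (by linarith) (sq_nonneg r)
    exact pow_eq_zero_iff (two_ne_zero) |>.1 this
  rw [hr0, zero_mul, neg_zero] at hlin
  have hp0 : p = 0 := by
    rcases mul_eq_zero.1 hps0 with h | h
    · exact h
    · rw [h, zero_mul, add_zero] at hlin
      exact (mul_eq_zero.1 hlin).resolve_right hA.ne'
  have hs0 : s = 0 := by
    rw [hp0, zero_mul, zero_add] at hlin
    exact (mul_eq_zero.1 hlin).resolve_right hC.ne'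
  exact ⟨by linarith, by linarith, by linarith⟩

/-- Near a double eigenvalue the discriminant lies in `(-2, 2)`. -/
theorem eventually_disc_sq_lt (hq : LocallyIntegrable q volume) {ℓ : ℝ} (hℓ : 0 < ℓ)
    {x : ℝ} (hv : S.v x ℓ = 0) (hdu : S.du x ℓ = 0) (hu : S.u x ℓ = S.dv x ℓ) :
    ∀ᶠ y in 𝓝[≠] x, S.disc ℓ y ^ 2 < 4 := by
  obtain ⟨hA, hC, hdet⟩ := S.gram_det_pos hq hℓ x
  have cu := S.continuous_u
  have cv := S.continuous_v
  -- Since the monodromy matrix at `x` is `±1`, `D(y)² - 4 = (y - x)² F(x, y)`, and `F(x, x) = 4 (B²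
  -- - A C)` is negative by strict Cauchy–Schwarz.
  set F : ℝ × ℝ → ℝ := fun p =>
    ((∫ t in (0 : ℝ)..ℓ, S.u p.2 t * S.v p.1 t) + ∫ t in (0 : ℝ)..ℓ, S.v p.2 t * S.u p.1 t) ^ 2
      - 4 * ((∫ t in (0 : ℝ)..ℓ, S.v p.2 t * S.v p.1 t) *
        ∫ t in (0 : ℝ)..ℓ, S.u p.2 t * S.u p.1 t) with hF
  have hFc : Continuous F :=
    (((continuous_integral_mul cu cv ℓ).add (continuous_integral_mul cv cu ℓ)).pow 2).sub
      (continuous_const.mul ((continuous_integral_mul cv cv ℓ).mul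
        (continuous_integral_mul cu cu ℓ)))
  have hF0 : F (x, x) < 0 := by
    simp only [hF, integral_vu_eq]
    linarith
  have hFx : Continuous fun y => F (x, y) := hFc.comp (by fun_prop)
  have hev : ∀ᶠ y in 𝓝[≠] x, F (x, y) < 0 :=
    (hFx.continuousAt.eventually_lt continuousAt_const hF0).filter_mono nhdsWithin_le_nhds
  filter_upwards [hev, self_mem_nhdsWithin] with y hy (hyx : y ≠ x)
  have hw := S.wronskian hq x hℓ.le
  have h4 := S.disc_sq_sub_four hq hℓ.le y
  obtain ⟨e1, e2, e3, e4⟩ := S.lagrange_entries hq hℓ.le x y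
  simp only [hv, hdu, ← hu, zero_mul, mul_zero, sub_zero, zero_sub] at hw e1 e2 e3 e4
  simp only [hF] at hy
  set I₁ := ∫ t in (0 : ℝ)..ℓ, S.u y t * S.v x t
  set I₂ := ∫ t in (0 : ℝ)..ℓ, S.v y t * S.v x t
  set I₃ := ∫ t in (0 : ℝ)..ℓ, S.u y t * S.u x t
  set I₄ := ∫ t in (0 : ℝ)..ℓ, S.v y t * S.u x t
  have hneg : S.disc ℓ y ^ 2 - 4 = (y - x) ^ 2 * ((I₁ + I₄) ^ 2 - 4 * (I₂ * I₃)) := by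
    have f1 : (S.dv y ℓ - S.u y ℓ) * S.u x ℓ = -((y - x) * (I₁ + I₄)) := by linarith
    have f2 : S.v y ℓ * S.u x ℓ * (S.u x ℓ * S.du y ℓ) = -((y - x) ^ 2 * (I₂ * I₃)) := by
      rw [e2, ← neg_neg (S.u x ℓ * S.du y ℓ), e3]; ring
    calc S.disc ℓ y ^ 2 - 4 = (S.u x ℓ * S.u x ℓ) *
          ((S.dv y ℓ - S.u y ℓ) ^ 2 + 4 * (S.v y ℓ * S.du y ℓ)) := by rw [h4, hw, one_mul]
      _ = ((S.dv y ℓ - S.u y ℓ) * S.u x ℓ) ^ 2 +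
          4 * (S.v y ℓ * S.u x ℓ * (S.u x ℓ * S.du y ℓ)) := by ring
      _ = _ := by rw [f1, f2]; ring
  have : (y - x) ^ 2 * ((I₁ + I₄) ^ 2 - 4 * (I₂ * I₃)) < 0 :=
    mul_neg_of_pos_of_neg (by have := sub_ne_zero.2 hyx; positivity) hy
  linarith

/-! #### Multiplicities -/

/-- The initial data of the solutions that satisfy the boundary conditions. -/
def eigenspace (ℓ s x : ℝ) : Submodule ℝ (ℝ × ℝ) where
  carrier := {d | d.1 = s * (d.1 * S.u x ℓ + d.2 * S.v x ℓ) ∧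
    d.2 = s * (d.1 * S.du x ℓ + d.2 * S.dv x ℓ)}
  zero_mem' := by simp
  add_mem' := by
    rintro a b ⟨h1, h2⟩ ⟨h3, h4⟩
    constructor
    · simp only [Prod.fst_add, Prod.snd_add]
      linear_combination h1 + h3
    · simp only [Prod.fst_add, Prod.snd_add]
      linear_combination h2 + h4
  smul_mem' := by
    rintro c a ⟨h1, h2⟩
    constructor
    · simp only [Prod.smul_fst, Prod.smul_snd, smul_eq_mul]
      linear_combination c * h1
    · simp only [Prod.smul_fst, Prod.smul_snd, smul_eq_mul]
      linear_combination c * h2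

theorem mem_eigenspace {ℓ s x : ℝ} {d : ℝ × ℝ} : d ∈ S.eigenspace ℓ s x ↔
    d.1 = s * (d.1 * S.u x ℓ + d.2 * S.v x ℓ) ∧ d.2 = s * (d.1 * S.du x ℓ + d.2 * S.dv x ℓ) :=
  Iff.rfl

/-- The set of initial data is already a subspace, so the span taken by `Set.finrank` adds nothing.
-/
theorem eigenvalueMultiplicity_eq (hq : LocallyIntegrable q volume) {ℓ : ℝ} (hℓ : 0 ≤ ℓ)
    (s x : ℝ) : eigenvalueMultiplicity q ℓ s x = Module.finrank ℝ (S.eigenspace ℓ s x) := by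
  rw [eigenvalueMultiplicity, Set.finrank]
  have : {d : ℝ × ℝ | ∃ y dy : ℝ → ℝ, IsHillSolution q x y dy ∧
      y 0 = d.1 ∧ dy 0 = d.2 ∧ y 0 = s * y ℓ ∧ dy 0 = s * dy ℓ} = S.eigenspace ℓ s x := by
    ext d
    constructor
    · rintro ⟨y, dy, h, h1, h2, h3, h4⟩
      obtain ⟨e1, e2⟩ := S.eq_comb hq h hℓ
      rw [e1] at h3
      rw [e2] at h4
      rw [h1, h2] at h3 h4
      exact ⟨h3, h4⟩
    · rintro ⟨h1, h2⟩
      refine ⟨_, _, (S.solution_u x).linear_comb hq (S.solution_v x) d.1 d.2, ?_, ?_, ?_, ?_⟩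
      · simp [S.u_zero, S.v_zero]
      · simp [S.du_zero, S.dv_zero]
      · simpa [S.u_zero, S.v_zero] using h1
      · simpa [S.du_zero, S.dv_zero] using h2
  rw [this, Submodule.span_eq]

/-- For determinant 1, `M + M⁻¹ = D`. If `M d = s d` with `s² = 1`, then `(D - 2 s) d = 0`. -/
theorem eigenvalueMultiplicity_eq_zero (hq : LocallyIntegrable q volume) {ℓ : ℝ} (hℓ : 0 ≤ ℓ)
    {s x : ℝ} (hs : s * s = 1) (hD : S.disc ℓ x ≠ 2 * s) :
    eigenvalueMultiplicity q ℓ s x = 0 := by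
  rw [S.eigenvalueMultiplicity_eq hq hℓ]
  have : S.eigenspace ℓ s x = ⊥ := by
    rw [eq_bot_iff]
    rintro ⟨a, b⟩ ⟨h1, h2⟩
    have hw := S.wronskian hq x hℓ
    have hD' : S.u x ℓ + S.dv x ℓ - 2 * s ≠ 0 := sub_ne_zero.2 hD
    simp only at h1 h2
    have r1 : a * S.u x ℓ + b * S.v x ℓ = s * a := by
      linear_combination (-s) * h1 - (a * S.u x ℓ + b * S.v x ℓ) * hs
    have r2 : a * S.du x ℓ + b * S.dv x ℓ = s * b := by
      linear_combination (-s) * h2 - (a * S.du x ℓ + b * S.dv x ℓ) * hs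
    have ha : (S.u x ℓ + S.dv x ℓ - 2 * s) * a = 0 := by
      linear_combination r1 - s * (S.dv x ℓ * r1 - S.v x ℓ * r2 - a * hw)
        - (S.dv x ℓ * a - b * S.v x ℓ) * hs
    have hb : (S.u x ℓ + S.dv x ℓ - 2 * s) * b = 0 := by
      linear_combination r2 - s * (S.u x ℓ * r2 - S.du x ℓ * r1 - b * hw)
        - (S.u x ℓ * b - a * S.du x ℓ) * hs
    simp [(mul_eq_zero.1 ha).resolve_left hD', (mul_eq_zero.1 hb).resolve_left hD']
  rw [this, finrank_bot]

theorem eigenvalueMultiplicity_eq_two (hq : LocallyIntegrable q volume) {ℓ : ℝ} (hℓ : 0 ≤ ℓ)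
    {s x : ℝ} (hs : s * s = 1) (hv : S.v x ℓ = 0) (hdu : S.du x ℓ = 0) (hu : S.u x ℓ = s)
    (hdv : S.dv x ℓ = s) : eigenvalueMultiplicity q ℓ s x = 2 := by
  rw [S.eigenvalueMultiplicity_eq hq hℓ]
  have : S.eigenspace ℓ s x = ⊤ := by
    rw [eq_top_iff]
    rintro ⟨a, b⟩ -
    rw [mem_eigenspace, hv, hdu, hu, hdv]
    constructor
    · linear_combination (-a) * hs
    · linear_combination (-b) * hs
  rw [this, finrank_top]
  simp

theorem eigenvalueMultiplicity_eq_one (hq : LocallyIntegrable q volume) {ℓ : ℝ} (hℓ : 0 ≤ ℓ)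
    {s x : ℝ} (hs : s * s = 1) (hD : S.disc ℓ x = 2 * s)
    (hM : ¬(S.v x ℓ = 0 ∧ S.du x ℓ = 0 ∧ S.u x ℓ = S.dv x ℓ)) :
    eigenvalueMultiplicity q ℓ s x = 1 := by
  rw [S.eigenvalueMultiplicity_eq hq hℓ]
  have hw := S.wronskian hq x hℓ
  have hD' : S.u x ℓ + S.dv x ℓ = 2 * s := hD
  have hne : S.eigenspace ℓ s x ≠ ⊤ := fun htop => by
    have h1 : ((1 : ℝ), (0 : ℝ)) ∈ S.eigenspace ℓ s x := htop ▸ Submodule.mem_top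
    have h2 : ((0 : ℝ), (1 : ℝ)) ∈ S.eigenspace ℓ s x := htop ▸ Submodule.mem_top
    simp only [mem_eigenspace, one_mul, zero_mul, add_zero, zero_add] at h1 h2
    have hs0 : s ≠ 0 := fun h => by simp [h] at hs
    refine hM ⟨?_, ?_, ?_⟩
    · simpa [hs0] using h2.1.symm
    · simpa [hs0] using h1.2.symm
    · exact mul_left_cancel₀ hs0 (h1.1.symm.trans h2.2)
  have hlt : Module.finrank ℝ (S.eigenspace ℓ s x) < 2 := by
    have := Submodule.finrank_lt hne
    simpa using this
  have hpos : 0 < Module.finrank ℝ (S.eigenspace ℓ s x) := by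
    rw [Module.finrank_pos_iff, Submodule.nontrivial_iff_ne_bot, Submodule.ne_bot_iff]
    -- `m1` and `m2` are the negated columns of the adjugate of `M - s`. They lie in its kernel
    -- because `det (M - s) = 2 - s D = 0`, and both vanish only if `M = s`.
    have m1 : (S.v x ℓ, s - S.u x ℓ) ∈ S.eigenspace ℓ s x := by
      rw [mem_eigenspace]
      constructor
      · linear_combination (-S.v x ℓ) * hs
      · linear_combination (-2 * s) * hs + (-(s * s)) * hD' + s * hw + S.u x ℓ * hs
    have m2 : (s - S.dv x ℓ, S.du x ℓ) ∈ S.eigenspace ℓ s x := by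
      rw [mem_eigenspace]
      constructor
      · linear_combination (-2 * s) * hs + (-(s * s)) * hD' + s * hw + S.dv x ℓ * hs
      · linear_combination (-S.du x ℓ) * hs
    by_contra! hcon
    have z1 := hcon _ m1
    have z2 := hcon _ m2
    simp only [Prod.mk_eq_zero] at z1 z2
    exact hM ⟨z1.1, z2.2, by linarith [z1.2, z2.1]⟩
  lia

end HillSystem

/-! ### The discriminant far to the left -/

/-- A solution of the first order system `y' = g y + w`, `w' = k y - g y'` with `g ^ 2 < k`. -/
structure IsGrowingPair (ℓ k : ℝ) (g y dy w : ℝ → ℝ) : Prop where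
  continuousOn : ContinuousOn y (Set.Icc 0 ℓ)
  continuousOn_w : ContinuousOn w (Set.Icc 0 ℓ)
  hasDerivAt : ∀ x ∈ Set.Ioo 0 ℓ, HasDerivAt y (dy x) x
  hasDerivAt_w : ∀ x ∈ Set.Ioo 0 ℓ, HasDerivAt w (k * y x - g x * dy x) x
  dy_eq : ∀ x ∈ Set.Ioo 0 ℓ, dy x = g x * y x + w x
  sq_lt : ∀ x ∈ Set.Ioo 0 ℓ, g x ^ 2 < k

namespace IsGrowingPair

variable {ℓ k : ℝ} {g y dy w G : ℝ → ℝ}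

/-- The derivative of `y w` is `w² + (k - g²) y²`, the `g y w` terms cancelling. -/
theorem mul_nonneg (h : IsGrowingPair ℓ k g y dy w) (hℓ : 0 < ℓ) (h0 : 0 ≤ y 0 * w 0) :
    ∀ x ∈ Set.Icc 0 ℓ, 0 ≤ y x * w x := by
  have hmono : MonotoneOn (fun x => y x * w x) (Set.Icc 0 ℓ) := by
    refine monotoneOn_of_hasDerivWithinAt_nonneg (convex_Icc 0 ℓ)
      (h.continuousOn.mul h.continuousOn_w)
      (f' := fun x => dy x * w x + y x * (k * y x - g x * dy x)) ?_ ?_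
    · intro x hx
      rw [interior_Icc] at hx
      exact ((h.hasDerivAt x hx).mul (h.hasDerivAt_w x hx)).hasDerivWithinAt
    · intro x hx
      rw [interior_Icc] at hx
      have h1 := h.sq_lt x hx
      rw [h.dy_eq x hx]
      have : 0 ≤ w x ^ 2 + (k - g x ^ 2) * y x ^ 2 :=
        add_nonneg (sq_nonneg _) (_root_.mul_nonneg (by linarith) (sq_nonneg _))
      linarith
  exact fun x hx => h0.trans (hmono ⟨le_rfl, hℓ.le⟩ hx hx.1)

theorem hasDerivAt_exp_mul_sq (h : IsGrowingPair ℓ k g y dy w)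
    (hG' : ∀ x ∈ Set.Ioo 0 ℓ, HasDerivAt G (g x) x) {x : ℝ} (hx : x ∈ Set.Ioo 0 ℓ) :
    HasDerivAt (fun x => Real.exp (-2 * G x) * y x ^ 2)
      (2 * Real.exp (-2 * G x) * (y x * w x)) x := by
  refine (((hG' x hx).const_mul (-2)).exp.mul ((h.hasDerivAt x hx).pow 2)).congr_deriv ?_
  rw [h.dy_eq x hx]
  simp
  ring

theorem monotoneOn_exp_mul_sq (h : IsGrowingPair ℓ k g y dy w) (hℓ : 0 < ℓ) (h0 : 0 ≤ y 0 * w 0)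
    (hG : ContinuousOn G (Set.Icc 0 ℓ)) (hG' : ∀ x ∈ Set.Ioo 0 ℓ, HasDerivAt G (g x) x) :
    MonotoneOn (fun x => Real.exp (-2 * G x) * y x ^ 2) (Set.Icc 0 ℓ) := by
  refine monotoneOn_of_hasDerivWithinAt_nonneg (convex_Icc 0 ℓ)
    (((hG.const_mul (-2)).rexp).mul (h.continuousOn.pow 2))
    (f' := fun x => 2 * Real.exp (-2 * G x) * (y x * w x)) ?_ ?_
  · intro x hx
    rw [interior_Icc] at hx
    exact (h.hasDerivAt_exp_mul_sq hG' hx).hasDerivWithinAt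
  · intro x hx
    have := h.mul_nonneg hℓ h0 x (interior_subset hx)
    positivity

theorem monotoneOn_exp_mul_sq_w (h : IsGrowingPair ℓ k g y dy w) (hℓ : 0 < ℓ)
    (h0 : 0 ≤ y 0 * w 0) (hG : ContinuousOn G (Set.Icc 0 ℓ))
    (hG' : ∀ x ∈ Set.Ioo 0 ℓ, HasDerivAt G (g x) x) :
    MonotoneOn (fun x => Real.exp (2 * G x) * w x ^ 2) (Set.Icc 0 ℓ) := by
  refine monotoneOn_of_hasDerivWithinAt_nonneg (convex_Icc 0 ℓ)
    (((hG.const_mul 2).rexp).mul (h.continuousOn_w.pow 2))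
    (f' := fun x => 2 * Real.exp (2 * G x) * ((k - g x ^ 2) * (y x * w x))) ?_ ?_
  · intro x hx
    rw [interior_Icc] at hx
    refine HasDerivAt.hasDerivWithinAt ?_
    refine (((hG' x hx).const_mul 2).exp.mul ((h.hasDerivAt_w x hx).pow 2)).congr_deriv ?_
    rw [h.dy_eq x hx]
    simp
    ring
  · intro x hx
    have h1 := h.mul_nonneg hℓ h0 x (interior_subset hx)
    rw [interior_Icc] at hx
    have h2 := sub_pos.2 (h.sq_lt x hx)
    positivity

/-- `exp (-2 G) y²` has derivative `2 exp (-2 G) y w` and increases strictly from 1. So `y` has no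
zero, stays positive, and exceeds `exp G` at `ℓ`. -/
theorem exp_le (h : IsGrowingPair ℓ k g y dy w) (hℓ : 0 < ℓ) (hy0 : y 0 = 1) (hw0 : w 0 = 0)
    (hG : ContinuousOn G (Set.Icc 0 ℓ)) (hG' : ∀ x ∈ Set.Ioo 0 ℓ, HasDerivAt G (g x) x)
    (hG0 : G 0 = 0) : Real.exp (G ℓ) < y ℓ := by
  have h0 : 0 ≤ y 0 * w 0 := by simp [hw0]
  have hmono := h.monotoneOn_exp_mul_sq hℓ h0 hG hG'
  have hne : ∀ x ∈ Set.Icc 0 ℓ, y x ≠ 0 := fun x hx hyx => by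
    have := hmono ⟨le_rfl, hℓ.le⟩ hx hx.1
    simp [hG0, hy0, hyx] at this
    linarith
  have hstrict : StrictMonoOn (fun x => y x * w x) (Set.Icc 0 ℓ) := by
    refine strictMonoOn_of_hasDerivWithinAt_pos (convex_Icc 0 ℓ)
      (h.continuousOn.mul h.continuousOn_w)
      (f' := fun x => dy x * w x + y x * (k * y x - g x * dy x)) ?_ ?_
    · intro x hx
      rw [interior_Icc] at hx
      exact ((h.hasDerivAt x hx).mul (h.hasDerivAt_w x hx)).hasDerivWithinAt
    · intro x hx
      have hyx := hne x (interior_subset hx)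
      rw [interior_Icc] at hx
      have h1 := sub_pos.2 (h.sq_lt x hx)
      rw [h.dy_eq x hx]
      have : 0 < w x ^ 2 + (k - g x ^ 2) * y x ^ 2 := by positivity
      linarith
  have hsq : StrictMonoOn (fun x => Real.exp (-2 * G x) * y x ^ 2) (Set.Icc 0 ℓ) := by
    refine strictMonoOn_of_hasDerivWithinAt_pos (convex_Icc 0 ℓ)
      (((hG.const_mul (-2)).rexp).mul (h.continuousOn.pow 2))
      (f' := fun x => 2 * Real.exp (-2 * G x) * (y x * w x)) ?_ ?_
    · intro x hx
      rw [interior_Icc] at hx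
      exact (h.hasDerivAt_exp_mul_sq hG' hx).hasDerivWithinAt
    · intro x hx
      rw [interior_Icc] at hx
      have := hstrict ⟨le_rfl, hℓ.le⟩ ⟨hx.1.le, hx.2.le⟩ hx.1
      simp only [hw0, mul_zero] at this
      positivity
  have hpos : 0 < y ℓ := by
    refine pos_of_continuousOn_of_ne_zero (y := 0) (z := ℓ) ?_ ?_ (by rw [hy0]; exact one_pos)
    · rw [Set.uIcc_of_le hℓ.le]
      exact h.continuousOn
    · rwa [Set.uIcc_of_le hℓ.le]
  have hlt := hsq ⟨le_rfl, hℓ.le⟩ ⟨hℓ.le, le_rfl⟩ hℓ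
  simp only [hG0, hy0, mul_zero, Real.exp_zero, one_pow, mul_one] at hlt
  refine lt_of_pow_lt_pow_left₀ 2 hpos.le ?_
  rw [← Real.exp_nat_mul]
  have he : Real.exp (-2 * G ℓ) * Real.exp (2 * G ℓ) = 1 := by
    rw [← Real.exp_add]; simp
  have := Real.exp_pos (2 * G ℓ)
  push_cast
  nlinarith

theorem le_w (h : IsGrowingPair ℓ k g y dy w) (hℓ : 0 < ℓ) (hy0 : y 0 = 0) (hw0 : w 0 = 1)
    (hG : ContinuousOn G (Set.Icc 0 ℓ)) (hG' : ∀ x ∈ Set.Ioo 0 ℓ, HasDerivAt G (g x) x)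
    (hG0 : G 0 = 0) : Real.exp (-G ℓ) ≤ w ℓ := by
  have h0 : 0 ≤ y 0 * w 0 := by simp [hy0]
  have hmono := h.monotoneOn_exp_mul_sq_w hℓ h0 hG hG'
  have hne : ∀ x ∈ Set.Icc 0 ℓ, w x ≠ 0 := fun x hx hwx => by
    have := hmono ⟨le_rfl, hℓ.le⟩ hx hx.1
    simp [hG0, hw0, hwx] at this
    linarith
  have hpos : 0 < w ℓ := by
    refine pos_of_continuousOn_of_ne_zero (y := 0) (z := ℓ) ?_ ?_ (by rw [hw0]; exact one_pos)
    · rw [Set.uIcc_of_le hℓ.le]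
      exact h.continuousOn_w
    · rwa [Set.uIcc_of_le hℓ.le]
  have hle := hmono ⟨le_rfl, hℓ.le⟩ ⟨hℓ.le, le_rfl⟩ hℓ.le
  simp only [hG0, hw0, mul_zero, Real.exp_zero, one_pow, mul_one] at hle
  refine le_of_sq_le_sq ?_ hpos.le
  rw [← Real.exp_nat_mul]
  have he : Real.exp (2 * G ℓ) * Real.exp (2 * -G ℓ) = 1 := by
    rw [← Real.exp_add]; simp
  have := Real.exp_pos (2 * -G ℓ)
  push_cast
  nlinarith

end IsGrowingPair

namespace HillSystem

variable {q : ℝ → ℝ} (S : HillSystem ℝ q)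

/-- Subtracting the mean `c` of `q` makes the primitive `g` vanish at both ends of the period, so `w
= y' - g y` agrees with `y'` there. With `k = c - x` large, `u ℓ > exp (G ℓ)` and `v' ℓ ≥ exp (-G
ℓ)`, and the sum of the two exponentials is at least 2. -/
theorem exists_two_lt_disc (hq : LocallyIntegrable q volume) {ℓ : ℝ} (hℓ : 0 < ℓ) :
    ∃ x₀, ∀ x ≤ x₀, 2 < S.disc ℓ x := by
  set c : ℝ := (∫ t in (0 : ℝ)..ℓ, q t) / ℓ with hc
  set g : ℝ → ℝ := fun x => ∫ t in (0 : ℝ)..x, (q t - c) with hg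
  have h_int (a b : ℝ) : IntervalIntegrable (fun t => q t - c) volume a b :=
    (hq.intervalIntegrable_volume a b).sub intervalIntegrable_const
  have hgc : Continuous g := intervalIntegral.continuous_primitive h_int 0
  have hgp : IsPrimitive g fun t => q t - c := ⟨fun x _ => h_int 0 x, fun x _ => by simp [hg]⟩
  have hg0 : g 0 = 0 := by simp [hg]
  have hgℓ : g ℓ = 0 := by
    simp only [hg]
    rw [intervalIntegral.integral_sub (hq.intervalIntegrable_volume 0 ℓ) intervalIntegrable_const]
    simp only [intervalIntegral.integral_const, sub_zero, smul_eq_mul, hc]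
    field_simp
    ring
  obtain ⟨K, hK⟩ := (isCompact_Icc (a := (0 : ℝ)) (b := ℓ)).exists_bound_of_continuousOn
    hgc.continuousOn
  set G : ℝ → ℝ := fun x => ∫ t in (0 : ℝ)..x, g t with hG
  have hGd (x : ℝ) : HasDerivAt G (g x) x := hgc.integral_hasStrictDerivAt 0 x |>.hasDerivAt
  have hGc : ContinuousOn G (Set.Icc 0 ℓ) := fun x _ => (hGd x).continuousAt.continuousWithinAt
  have hG0 : G 0 = 0 := by simp [hG]
  -- This bound gives `k = c - x ≥ K² + 1 > g²` on the period.
  refine ⟨c - K ^ 2 - 1, fun x hx => ?_⟩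
  have pair {y dy : ℝ → ℝ} (h : IsHillSolution q x y dy) :
      IsGrowingPair ℓ (c - x) g y dy fun t => dy t - g t * y t := by
    have hw : IsPrimitive (fun t => dy t - g t * y t) fun t => (c - x) * y t - g t * dy t := by
      refine ((h.isPrimitive_deriv hq).sub (hgp.mul h.isPrimitive)).congr_density fun t _ => ?_
      simp only [RCLike.ofReal_real_eq_id, id_eq]
      ring
    have hwc : ContinuousOn (fun t => (c - x) * y t - g t * dy t) (Set.Ici 0) :=
      (h.continuousOn.const_mul _).sub (hgc.continuousOn.mul h.continuousOn_deriv)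
    refine ⟨h.continuousOn.mono Set.Icc_subset_Ici_self,
      hw.continuousOn.mono Set.Icc_subset_Ici_self,
      fun t ht => h.isPrimitive.hasDerivAt h.continuousOn_deriv ht.1,
      fun t ht => hw.hasDerivAt hwc ht.1, fun t _ => by ring, fun t ht => ?_⟩
    have h1 := hK t ⟨ht.1.le, ht.2.le⟩
    rw [Real.norm_eq_abs] at h1
    have h2 : g t ^ 2 ≤ K ^ 2 := sq_le_sq' (by linarith [abs_le.1 h1]) (abs_le.1 h1).2
    linarith
  have h1 := (pair (S.solution_u x)).exp_le hℓ (S.u_zero x) (by simp [S.du_zero, hg0]) hGc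
    (fun t _ => hGd t) hG0
  have h2 := (pair (S.solution_v x)).le_w hℓ (S.v_zero x) (by simp [S.dv_zero, hg0]) hGc
    (fun t _ => hGd t) hG0
  simp only [hgℓ, zero_mul, sub_zero] at h2
  rw [disc]
  have h3 := Real.add_one_le_exp (G ℓ)
  have h4 := Real.add_one_le_exp (-G ℓ)
  linarith

/-- The dichotomy is whether the monodromy matrix is scalar: if so the eigenvalue is double, and if
not it is simple and cannot be a critical point of `D`. -/
theorem isDiscriminant (hq : LocallyIntegrable q volume) {ℓ : ℝ} (hℓ : 0 < ℓ) :
    IsDiscriminant (S.disc ℓ) (fun x => S.discSlope ℓ (x, x))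
      (eigenvalueMultiplicity q ℓ 1) (eigenvalueMultiplicity q ℓ (-1)) := by
  have cases {s : ℝ} (hs : s * s = 1) (x : ℝ) (hx : S.disc ℓ x = 2 * s) :
      (eigenvalueMultiplicity q ℓ s x = 1 ∧ S.discSlope ℓ (x, x) ≠ 0) ∨
      (eigenvalueMultiplicity q ℓ s x = 2 ∧ ∀ᶠ y in 𝓝[≠] x, S.disc ℓ y ^ 2 < 4) := by
    by_cases hM : S.v x ℓ = 0 ∧ S.du x ℓ = 0 ∧ S.u x ℓ = S.dv x ℓ
    · right
      have hx' : S.u x ℓ + S.dv x ℓ = 2 * s := hx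
      exact ⟨S.eigenvalueMultiplicity_eq_two hq hℓ.le hs hM.1 hM.2.1 (by linarith [hM.2.2])
        (by linarith [hM.2.2]), S.eventually_disc_sq_lt hq hℓ hM.1 hM.2.1 hM.2.2⟩
    · left
      refine ⟨S.eigenvalueMultiplicity_eq_one hq hℓ.le hs hx hM, fun h0 => hM ?_⟩
      exact S.monodromy_of_discSlope_eq_zero hq hℓ h0 (by rw [hx]; nlinarith)
  refine ⟨S.hasDerivAt_disc hq hℓ.le, (S.continuous_discSlope ℓ).comp (by fun_prop),
    fun x hx => S.eigenvalueMultiplicity_eq_zero hq hℓ.le (by norm_num) (by simpa using hx),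
    fun x hx => S.eigenvalueMultiplicity_eq_zero hq hℓ.le (by norm_num) (by simpa using hx),
    fun x hx => cases (by norm_num) x (by simpa using hx),
    fun x hx => cases (by norm_num) x (by simpa using hx), fun x hx h0 => ?_,
    S.exists_two_lt_disc hq hℓ⟩
  obtain ⟨h1, h2, h3⟩ := S.monodromy_of_discSlope_eq_zero hq hℓ h0 hx.le
  have := S.disc_sq_sub_four hq hℓ.le x
  rw [h1, h2, h3] at this
  linarith

theorem disc_sq_lt_four (hq : LocallyIntegrable q volume) {ℓ lam : ℝ} (hℓ : 0 < ℓ)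
    (h : InStabilityInterval q ℓ lam) : S.disc ℓ lam ^ 2 < 4 := by
  obtain ⟨per, semi, hp, hm, m, hmem⟩ := h
  exact (S.isDiscriminant hq hℓ).sq_lt_four_of_mem hp hm hmem

end HillSystem

/-! ### The Titchmarsh–Weyl coefficient of a periodic equation -/

open ComplexConjugate in
/-- Green's identity. -/
theorem IsHillSolution.green {q : ℝ → ℝ} (hq : LocallyIntegrable q volume) {z : ℂ}
    {y dy : ℝ → ℂ} (h : IsHillSolution q z y dy) {x : ℝ} (hx : 0 ≤ x) :
    (conj (y x) * dy x).im = (conj (y 0) * dy 0).im - z.im * ∫ t in (0 : ℝ)..x, ‖y t‖ ^ 2 := by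
  have hp : IsPrimitive (fun x => (conj (y x) * dy x).im) fun x => -z.im * ‖y x‖ ^ 2 := by
    refine (h.isPrimitive.conj.mul (h.isPrimitive_deriv hq)).im.congr_density fun x _ => ?_
    rw [← Complex.normSq_eq_norm_sq, Complex.normSq_apply]
    simp
    ring
  rw [hp.eq x hx, intervalIntegral.integral_const_mul]
  ring

namespace IsHillSolution

open ComplexConjugate

variable {q : ℝ → ℝ} {ℓ : ℝ} {z τ : ℂ} {y dy : ℝ → ℂ}

theorem floquet_nat (hq : LocallyIntegrable q volume) (hℓ : 0 ≤ ℓ) (hper : Function.Periodic q ℓ)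
    (h : IsHillSolution q z y dy) (h1 : y ℓ = τ * y 0) (h2 : dy ℓ = τ * dy 0) (n : ℕ) :
    y (n * ℓ) = τ ^ n * y 0 ∧ dy (n * ℓ) = τ ^ n * dy 0 := by
  obtain ⟨S⟩ := nonempty_hillSystem ℂ hq
  have step {x : ℝ} (hx : 0 ≤ x) : y (x + ℓ) = τ * y x ∧ dy (x + ℓ) = τ * dy x := by
    obtain ⟨a, b⟩ := S.translate hq hℓ hper h hx
    obtain ⟨c, d⟩ := S.eq_comb hq h hx
    rw [a, b, c, d, h1, h2]
    constructor <;> ring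
  induction n with
  | zero => simp
  | succ n ih =>
    obtain ⟨a, b⟩ := step (x := n * ℓ) (by positivity)
    push_cast
    rw [add_mul, one_mul, a, b, ih.1, ih.2, pow_succ']
    constructor <;> ring

theorem floquet_integral (hq : LocallyIntegrable q volume) (hℓ : 0 ≤ ℓ)
    (hper : Function.Periodic q ℓ) (h : IsHillSolution q z y dy) (h1 : y ℓ = τ * y 0)
    (h2 : dy ℓ = τ * dy 0) (n : ℕ) :
    z.im * ∫ t in (0 : ℝ)..n * ℓ, ‖y t‖ ^ 2 =
      (1 - (‖τ‖ ^ 2) ^ n) * (conj (y 0) * dy 0).im := by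
  have hg := h.green hq (x := n * ℓ) (by positivity)
  obtain ⟨a, b⟩ := h.floquet_nat hq hℓ hper h1 h2 n
  rw [a, b] at hg
  have : conj (τ ^ n * y 0) * (τ ^ n * dy 0) =
      (((‖τ‖ ^ 2) ^ n : ℝ) : ℂ) * (conj (y 0) * dy 0) := by
    rw [map_mul, map_pow]
    calc _ = (conj τ * τ) ^ n * (conj (y 0) * dy 0) := by ring
      _ = _ := by rw [Complex.conj_mul']; push_cast; ring
  rw [this, Complex.im_ofReal_mul] at hg
  linarith

theorem floquet_sign (hq : LocallyIntegrable q volume) (hℓ : 0 < ℓ) (hper : Function.Periodic q ℓ)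
    (hz : 0 < z.im) (h : IsHillSolution q z y dy) (h1 : y ℓ = τ * y 0) (h2 : dy ℓ = τ * dy 0)
    (h0 : ¬(y 0 = 0 ∧ dy 0 = 0)) : 0 < (1 - ‖τ‖ ^ 2) * (conj (y 0) * dy 0).im := by
  have := h.floquet_integral hq hℓ.le hper h1 h2 1
  simp only [Nat.cast_one, one_mul, pow_one] at this
  rw [← this]
  exact mul_pos hz (h.integral_norm_sq_pos hℓ h0)

theorem aestronglyMeasurable (h : IsHillSolution q z y dy) :
    AEStronglyMeasurable y (volume.restrict (Set.Ioi 0)) :=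
  (h.continuousOn.mono Set.Ioi_subset_Ici_self).aestronglyMeasurable measurableSet_Ioi

theorem memLp_of_floquet (hq : LocallyIntegrable q volume) (hℓ : 0 < ℓ)
    (hper : Function.Periodic q ℓ) (hz : 0 < z.im) (hτ : ‖τ‖ < 1) (h : IsHillSolution q z y dy)
    (h1 : y ℓ = τ * y 0) (h2 : dy ℓ = τ * dy 0) : MemLp y 2 (volume.restrict (Set.Ioi 0)) := by
  rw [memLp_two_iff_integrable_sq_norm h.aestronglyMeasurable]
  refine integrableOn_Ioi_of_intervalIntegral_norm_bounded
    (|(conj (y 0) * dy 0).im| / z.im) 0 (l := atTop) (b := fun n : ℕ => n * ℓ) (fun n => ?_)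
    (tendsto_natCast_atTop_atTop.atTop_mul_const hℓ) (Eventually.of_forall fun n => ?_)
  · refine (ContinuousOn.integrableOn_Icc ?_).mono_set Set.Ioc_subset_Icc_self
    exact ((h.continuousOn.mono Set.Icc_subset_Ici_self).norm).pow 2
  · simp only [norm_pow, norm_norm]
    rw [le_div_iff₀ hz, mul_comm, h.floquet_integral hq hℓ.le hper h1 h2 n]
    refine (le_abs_self _).trans ?_
    rw [abs_mul]
    refine mul_le_of_le_one_left (abs_nonneg _) ?_
    have h3 : ‖τ‖ ^ 2 ≤ 1 := pow_le_one₀ (norm_nonneg _) hτ.le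
    have h4 : (‖τ‖ ^ 2) ^ n ≤ 1 := pow_le_one₀ (by positivity) h3
    rw [abs_of_nonneg (by linarith)]
    have : 0 ≤ (‖τ‖ ^ 2) ^ n := by positivity
    linarith

/-- For `|τ| > 1` the boundary term at 0 is negative, and Green's identity over `n` periods makes
the integral of `|y|²` grow like `|τ|^(2n)`. -/
theorem not_memLp_of_floquet (hq : LocallyIntegrable q volume) (hℓ : 0 < ℓ)
    (hper : Function.Periodic q ℓ) (hz : 0 < z.im) (hτ : 1 < ‖τ‖) (h : IsHillSolution q z y dy)
    (h1 : y ℓ = τ * y 0) (h2 : dy ℓ = τ * dy 0) (h0 : ¬(y 0 = 0 ∧ dy 0 = 0)) :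
    ¬MemLp y 2 (volume.restrict (Set.Ioi 0)) := by
  rw [memLp_two_iff_integrable_sq_norm h.aestronglyMeasurable]
  intro h_int
  have hsq : 1 < ‖τ‖ ^ 2 := one_lt_pow₀ hτ two_ne_zero
  have hsign := h.floquet_sign hq hℓ hper hz h1 h2 h0
  set W := (conj (y 0) * dy 0).im
  have hW : W < 0 := by nlinarith
  have hle (n : ℕ) : ∫ t in (0 : ℝ)..n * ℓ, ‖y t‖ ^ 2 ≤ ∫ t in Set.Ioi 0, ‖y t‖ ^ 2 := by
    rw [intervalIntegral.integral_of_le (by positivity)]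
    exact setIntegral_mono_set h_int (Eventually.of_forall fun t => by positivity)
      (LE.le.eventuallyLE Set.Ioc_subset_Ioi_self)
  obtain ⟨n, hn⟩ := pow_unbounded_of_one_lt
    (1 + z.im * (∫ t in Set.Ioi 0, ‖y t‖ ^ 2) / (-W)) hsq
  have h3 := h.floquet_integral hq hℓ.le hper h1 h2 n
  have h4 := mul_le_mul_of_nonneg_left (hle n) hz.le
  rw [h3] at h4
  have h5 : z.im * (∫ t in Set.Ioi 0, ‖y t‖ ^ 2) / (-W) < (‖τ‖ ^ 2) ^ n - 1 := by linarith
  rw [div_lt_iff₀ (by linarith)] at h5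
  linarith

end IsHillSolution

namespace HillSystem

open ComplexConjugate

variable {q : ℝ → ℝ} (S : HillSystem ℂ q) {ℓ : ℝ} {z τ : ℂ}

/-- A zero of `v` at `ℓ` would make `z` a nonreal eigenvalue of the self-adjoint Dirichlet problem;
Green's identity excludes it. -/
theorem v_ne_zero_of_im_pos (hq : LocallyIntegrable q volume) (hℓ : 0 < ℓ) (hz : 0 < z.im) :
    S.v z ℓ ≠ 0 := fun h0 => by
  have h := (S.solution_v z).green hq hℓ.le
  have hpos := (S.solution_v z).integral_norm_sq_pos hℓ (by simp [S.dv_zero])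
  rw [h0, S.v_zero] at h
  simp only [map_zero, zero_mul, Complex.zero_im, zero_sub] at h
  nlinarith

/-- The solution whose initial data are an eigenvector of the monodromy matrix for `τ`. -/
theorem floquet_solution (hq : LocallyIntegrable q volume) (hℓ : 0 ≤ ℓ)
    (hτ : τ ^ 2 - S.disc ℓ z * τ + 1 = 0) :
    let y := fun x => S.v z ℓ * S.u z x + (τ - S.u z ℓ) * S.v z x
    let dy := fun x => S.v z ℓ * S.du z x + (τ - S.u z ℓ) * S.dv z x
    IsHillSolution q z y dy ∧ y 0 = S.v z ℓ ∧ dy 0 = τ - S.u z ℓ ∧ y ℓ = τ * y 0 ∧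
      dy ℓ = τ * dy 0 := by
  intro y dy
  have hw := S.wronskian hq z hℓ
  have hy0 : y 0 = S.v z ℓ := by simp [y, S.u_zero, S.v_zero]
  have hdy0 : dy 0 = τ - S.u z ℓ := by simp [dy, S.du_zero, S.dv_zero]
  refine ⟨(S.solution_u z).linear_comb hq (S.solution_v z) _ _, hy0, hdy0, ?_, ?_⟩
  · rw [hy0]
    simp only [y]
    ring
  · rw [hdy0]
    simp only [dy]
    rw [disc] at hτ
    linear_combination (-1 : ℂ) * hw - hτ

/-- For `|τ| = 1` the boundary terms in Green's identity over one period cancel, although the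
integral is positive. -/
theorem norm_root_ne_one (hq : LocallyIntegrable q volume) (hℓ : 0 < ℓ) (hper : Function.Periodic q ℓ)
    (hz : 0 < z.im) (hτ : τ ^ 2 - S.disc ℓ z * τ + 1 = 0) : ‖τ‖ ≠ 1 := fun h1 => by
  obtain ⟨h, h0, _, h3, h4⟩ := S.floquet_solution hq hℓ.le hτ
  have := h.floquet_sign hq hℓ hper hz h3 h4
    (fun hc => S.v_ne_zero_of_im_pos hq hℓ hz (h0 ▸ hc.1))
  simp [h1] at this

/-- The Weyl coefficient in terms of the entries of the monodromy matrix and of its eigenvalue. -/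
noncomputable def weylFormula (ℓ α : ℝ) (z τ : ℂ) : ℂ :=
  (Real.cos α * (τ - S.u z ℓ) - Real.sin α * S.v z ℓ) /
    (Real.cos α * S.v z ℓ + Real.sin α * (τ - S.u z ℓ))

theorem floquet_im_pos (hq : LocallyIntegrable q volume) (hℓ : 0 < ℓ)
    (hper : Function.Periodic q ℓ) (hz : 0 < z.im) (hτ : τ ^ 2 - S.disc ℓ z * τ + 1 = 0)
    (hτ1 : ‖τ‖ < 1) : 0 < (conj (S.v z ℓ) * (τ - S.u z ℓ)).im := by
  obtain ⟨h, h0, h0', h3, h4⟩ := S.floquet_solution hq hℓ.le hτ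
  have := h.floquet_sign hq hℓ hper hz h3 h4
    (fun hc => S.v_ne_zero_of_im_pos hq hℓ hz (h0 ▸ hc.1))
  beta_reduce at h0 h0' this
  rw [h0, h0'] at this
  have h5 : ‖τ‖ ^ 2 < 1 := pow_lt_one₀ (norm_nonneg _) hτ1 two_ne_zero
  exact pos_of_mul_pos_right this (by linarith)

/-- A vanishing real combination of `v` and `τ - u` with coefficients not both 0 would make `conj v
* (τ - u)` real, against `floquet_im_pos`. -/
theorem weylFormula_den_ne_zero (hq : LocallyIntegrable q volume) (hℓ : 0 < ℓ)
    (hper : Function.Periodic q ℓ) (α : ℝ) (hz : 0 < z.im)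
    (hτ : τ ^ 2 - S.disc ℓ z * τ + 1 = 0) (hτ1 : ‖τ‖ < 1) :
    Real.cos α * S.v z ℓ + Real.sin α * (τ - S.u z ℓ) ≠ 0 := fun h0 => by
  have him := S.floquet_im_pos hq hℓ hper hz hτ hτ1
  set a := S.v z ℓ
  set b := τ - S.u z ℓ
  have h1 : Real.cos α * (conj a * b).im = 0 := by
    have : (conj (Real.cos α * a + Real.sin α * b) * b).im = 0 := by rw [h0]; simp
    have h2 : conj (Real.cos α * a + Real.sin α * b) * b =
        Real.cos α * (conj a * b) + Real.sin α * (conj b * b) := by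
      simp only [map_add, map_mul, Complex.conj_ofReal]; ring
    rw [h2, Complex.add_im, Complex.im_ofReal_mul, Complex.im_ofReal_mul, Complex.conj_mul'] at this
    have h3 : ((‖b‖ : ℂ) ^ 2).im = 0 := by rw [← Complex.ofReal_pow, Complex.ofReal_im]
    rw [h3] at this
    linarith
  have h2 : Real.sin α * (conj a * b).im = 0 := by
    have : (conj a * (Real.cos α * a + Real.sin α * b)).im = 0 := by rw [h0]; simp
    have h2 : conj a * (Real.cos α * a + Real.sin α * b) =
        Real.cos α * (conj a * a) + Real.sin α * (conj a * b) := by ring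
    rw [h2, Complex.add_im, Complex.im_ofReal_mul, Complex.im_ofReal_mul, Complex.conj_mul'] at this
    have h3 : ((‖a‖ : ℂ) ^ 2).im = 0 := by rw [← Complex.ofReal_pow, Complex.ofReal_im]
    rw [h3] at this
    linarith
  have hc := (mul_eq_zero.1 h1).resolve_right him.ne'
  have hs := (mul_eq_zero.1 h2).resolve_right him.ne'
  have := Real.sin_sq_add_cos_sq α
  rw [hc, hs] at this
  norm_num at this

theorem isWeylCoefficient_weylFormula (hq : LocallyIntegrable q volume) (hℓ : 0 < ℓ)
    (hper : Function.Periodic q ℓ) (α : ℝ) (hz : 0 < z.im)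
    (hτ : τ ^ 2 - S.disc ℓ z * τ + 1 = 0) (hτ1 : ‖τ‖ < 1) :
    IsWeylCoefficient q α z (S.weylFormula ℓ α z τ) := by
  have hden := S.weylFormula_den_ne_zero hq hℓ hper α hz hτ hτ1
  obtain ⟨h, h0, h0', h3, h4⟩ := S.floquet_solution hq hℓ.le hτ
  have hL := h.memLp_of_floquet hq hℓ hper hz hτ1 h3 h4
  have hsc : (Real.sin α : ℂ) ^ 2 + (Real.cos α : ℂ) ^ 2 = 1 := by
    exact_mod_cast Real.sin_sq_add_cos_sq α
  refine ⟨_, _, _, _,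
    (S.solution_u z).linear_comb hq (S.solution_v z) (Real.cos α) (Real.sin α),
    (S.solution_u z).linear_comb hq (S.solution_v z) (-Real.sin α) (Real.cos α), ?_, ?_, ?_, ?_, ?_⟩
  · simp [S.u_zero, S.v_zero]
  · simp [S.du_zero, S.dv_zero]
  · simp [S.u_zero, S.v_zero]
  · simp [S.du_zero, S.dv_zero]
  · refine (hL.const_mul (Real.cos α * S.v z ℓ + Real.sin α * (τ - S.u z ℓ))⁻¹).congr_norm ?_ ?_
    · refine ContinuousOn.aestronglyMeasurable ?_ measurableSet_Ioi
      have hu : Continuous (S.u z) := S.continuous_u.comp (by fun_prop : Continuous fun t => (z, t))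
      have hv : Continuous (S.v z) := S.continuous_v.comp (by fun_prop : Continuous fun t => (z, t))
      fun_prop
    · refine Eventually.of_forall fun x => congrArg norm ?_
      simp only [weylFormula]
      field_simp
      linear_combination (S.v z ℓ * S.u z x + (τ - S.u z ℓ) * S.v z x) * (-hsc)

/-- If `θ + m φ` were independent of the decaying Floquet solution, the growing one would be a
combination of two square integrable functions. Hence the Weyl coefficient is unique, and the choice
made in `weylM` is determined. -/
theorem eq_weylFormula (hq : LocallyIntegrable q volume) (hℓ : 0 < ℓ)
    (hper : Function.Periodic q ℓ) {α : ℝ} (hz : 0 < z.im)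
    (hτ : τ ^ 2 - S.disc ℓ z * τ + 1 = 0) (hτ1 : ‖τ‖ < 1) {m : ℂ}
    (hm : IsWeylCoefficient q α z m) : m = S.weylFormula ℓ α z τ := by
  have hden := S.weylFormula_den_ne_zero hq hℓ hper α hz hτ hτ1
  have hv := S.v_ne_zero_of_im_pos hq hℓ hz
  obtain ⟨θ, dθ, φ, dφ, hθ, hφ, t0, dt0, p0, dp0, hL⟩ := hm
  have hτ0 : τ ≠ 0 := fun h => by simp [h] at hτ
  have hτ' : τ⁻¹ ^ 2 - S.disc ℓ z * τ⁻¹ + 1 = 0 := by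
    field_simp
    linear_combination hτ
  have hτ1' : 1 < ‖τ⁻¹‖ := by
    rw [norm_inv]
    exact (one_lt_inv₀ (norm_pos_iff.2 hτ0)).2 hτ1
  obtain ⟨h, h0, h0', h3, h4⟩ := S.floquet_solution hq hℓ.le hτ
  have hLτ := h.memLp_of_floquet hq hℓ hper hz hτ1 h3 h4
  obtain ⟨g, g0, g0', g3, g4⟩ := S.floquet_solution hq hℓ.le hτ'
  have hnot := g.not_memLp_of_floquet hq hℓ hper hz hτ1' g3 g4 (fun hc => hv (g0 ▸ hc.1))
  have hsol := hθ.linear_comb hq hφ 1 m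
  set a : ℂ := Real.cos α - m * Real.sin α with ha
  set b : ℂ := Real.sin α + m * Real.cos α with hb
  have hy {x : ℝ} (hx : 0 ≤ x) : θ x + m * φ x = a * S.u z x + b * S.v z x := by
    have := (S.eq_comb hq hsol hx).1
    rw [t0, dt0, p0, dp0] at this
    rw [one_mul] at this
    rw [this, ha, hb]
    ring
  -- Up to sign, `δ` is the determinant of the initial data of `θ + m φ` and of the decaying
  -- solution; `δ = 0` is the equation for `m`.
  set δ := a * (τ - S.u z ℓ) - b * S.v z ℓ with hδ
  have hδ0 : δ = 0 := by
    by_contra hne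
    apply hnot
    have hcomb := ((hL.const_mul (S.v z ℓ * (τ - τ⁻¹))).add
      (hLτ.const_mul (a * (τ⁻¹ - S.u z ℓ) - b * S.v z ℓ))).const_mul δ⁻¹
    refine hcomb.ae_eq ?_
    filter_upwards [ae_restrict_mem measurableSet_Ioi] with x hx
    simp only [Pi.add_apply]
    rw [hy (le_of_lt hx), inv_mul_eq_iff_eq_mul₀ hne, hδ]
    ring
  rw [weylFormula, eq_div_iff hden]
  rw [hδ, ha, hb] at hδ0
  linear_combination -hδ0

theorem weylM_eq (hq : LocallyIntegrable q volume) (hℓ : 0 < ℓ) (hper : Function.Periodic q ℓ)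
    (α : ℝ) (hz : 0 < z.im) (hτ : τ ^ 2 - S.disc ℓ z * τ + 1 = 0) (hτ1 : ‖τ‖ < 1) :
    weylM q α z = S.weylFormula ℓ α z τ :=
  S.eq_weylFormula hq hℓ hper hz hτ hτ1 (Classical.epsilon_spec
    ⟨_, S.isWeylCoefficient_weylFormula hq hℓ hper α hz hτ hτ1⟩)

/-- The imaginary part of a quotient of real linear combinations. -/
theorem weylFormula_im (α : ℝ) (z τ : ℂ) (ℓ : ℝ) : (S.weylFormula ℓ α z τ).im =
    (conj (S.v z ℓ) * (τ - S.u z ℓ)).im /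
      Complex.normSq (Real.cos α * S.v z ℓ + Real.sin α * (τ - S.u z ℓ)) := by
  rw [weylFormula, Complex.div_im, ← sub_div]
  congr 1
  have := Real.sin_sq_add_cos_sq α
  generalize S.v z ℓ = a
  generalize τ - S.u z ℓ = b
  simp only [Complex.sub_re, Complex.sub_im, Complex.add_re, Complex.add_im, Complex.mul_re,
    Complex.mul_im, Complex.ofReal_re, Complex.ofReal_im, Complex.conj_re, Complex.conj_im]
  linear_combination (a.re * b.im - a.im * b.re) * this

end HillSystem

/-! ### Boundary values of the Titchmarsh–Weyl coefficient -/

namespace HillSystem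

open ComplexConjugate

section Comparison

variable {q : ℝ → ℝ} (S : HillSystem ℂ q) (T : HillSystem ℝ q)

theorem ofReal_eq (hq : LocallyIntegrable q volume) (x : ℝ) {t : ℝ} (ht : 0 ≤ t) :
    S.u x t = T.u x t ∧ S.du x t = T.du x t ∧ S.v x t = T.v x t ∧ S.dv x t = T.dv x t := by
  have h1 := (S.solution_u x).unique hq ((T.solution_u x).ofReal hq (𝕜 := ℂ))
    (by simp [S.u_zero, T.u_zero]) (by simp [S.du_zero, T.du_zero]) ht
  have h2 := (S.solution_v x).unique hq ((T.solution_v x).ofReal hq (𝕜 := ℂ))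
    (by simp [S.v_zero, T.v_zero]) (by simp [S.dv_zero, T.dv_zero]) ht
  exact ⟨h1.1, h1.2, h2.1, h2.2⟩

theorem disc_ofReal (hq : LocallyIntegrable q volume) (x : ℝ) {ℓ : ℝ} (hℓ : 0 ≤ ℓ) :
    S.disc ℓ x = T.disc ℓ x := by
  obtain ⟨h1, _, _, h2⟩ := S.ofReal_eq T hq x hℓ
  rw [disc, disc, h1, h2, Complex.ofReal_add]

end Comparison

section UpperHalfPlane

variable {q : ℝ → ℝ} (S : HillSystem ℂ q) {ℓ : ℝ}

theorem continuousOn_weylFormula {τ : ℂ → ℂ} {s : Set ℂ} (α : ℝ) (hτ : ContinuousOn τ s)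
    (hden : ∀ z ∈ s, Real.cos α * S.v z ℓ + Real.sin α * (τ z - S.u z ℓ) ≠ 0) :
    ContinuousOn (fun z => S.weylFormula ℓ α z (τ z)) s := by
  have hu := (S.continuous_u_left ℓ).continuousOn (s := s)
  have hv := (S.continuous_v_left ℓ).continuousOn (s := s)
  unfold weylFormula
  exact (((hτ.sub hu).const_mul _).sub (hv.const_mul _)).div
    ((hv.const_mul _).add ((hτ.sub hu).const_mul _)) hden

/-- The eigenvalue of the monodromy matrix of modulus less than `1`. -/
theorem exists_innerRoot (hq : LocallyIntegrable q volume) (hℓ : 0 < ℓ)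
    (hper : Function.Periodic q ℓ) : ∃ τ : ℂ → ℂ, ContinuousOn τ {z | 0 < z.im} ∧
      ∀ z : ℂ, 0 < z.im → τ z ^ 2 - S.disc ℓ z * τ z + 1 = 0 ∧ ‖τ z‖ < 1 := by
  have hex : ∀ z : ℂ, 0 < z.im → ∃ t : ℂ, t ^ 2 - S.disc ℓ z * t + 1 = 0 ∧ ‖t‖ < 1 := by
    intro z hz
    obtain ⟨s, hs⟩ := IsAlgClosed.exists_pow_nat_eq (S.disc ℓ z ^ 2 - 4) (n := 2) two_pos
    have hroot : ((S.disc ℓ z + s) / 2) ^ 2 - S.disc ℓ z * ((S.disc ℓ z + s) / 2) + 1 = 0 := by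
      linear_combination hs / 4
    set t := (S.disc ℓ z + s) / 2
    have ht0 : t ≠ 0 := fun h => by simp [h] at hroot
    rcases lt_or_gt_of_ne (S.norm_root_ne_one hq hℓ hper hz hroot) with h | h
    · exact ⟨t, hroot, h⟩
    · refine ⟨t⁻¹, ?_, ?_⟩
      · field_simp
        linear_combination hroot
      · rw [norm_inv]
        exact inv_lt_one_of_one_lt₀ h
  choose! τ hτ using hex
  refine ⟨τ, fun z hz => ?_, hτ⟩
  obtain ⟨hr, hn⟩ := hτ z hz
  have hz0 : τ z ≠ 0 := fun h => by simp [h] at hr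
  have hc : 0 < ‖(τ z)⁻¹‖ - 1 := by
    rw [norm_inv, sub_pos]
    exact (one_lt_inv₀ (norm_pos_iff.2 hz0)).2 hn
  rw [ContinuousWithinAt, tendsto_iff_norm_sub_tendsto_zero]
  have hlim : Tendsto (fun w => ‖S.disc ℓ w - S.disc ℓ z‖ / (‖(τ z)⁻¹‖ - 1))
      (𝓝[{z | 0 < z.im}] z) (𝓝 0) := by
    have h1 : Continuous fun w => ‖S.disc ℓ w - S.disc ℓ z‖ / (‖(τ z)⁻¹‖ - 1) :=
      (((S.continuous_disc ℓ).sub continuous_const).norm).div_const _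
    have h2 := h1.tendsto z
    simp only [sub_self, norm_zero, zero_div] at h2
    exact h2.mono_left nhdsWithin_le_nhds
  refine squeeze_zero' (Eventually.of_forall fun _ => norm_nonneg _) ?_ hlim
  filter_upwards [self_mem_nhdsWithin] with w hw
  obtain ⟨hr', hn'⟩ := hτ w hw
  rw [le_div_iff₀ hc]
  -- As `|τ w| < 1 < |(τ z)⁻¹|`, the second factor is at least `|(τ z)⁻¹| - 1`, so `|τ w - τ z|` is
  -- controlled by the change of the discriminant.
  have hprod : (τ w - τ z) * (τ w - (τ z)⁻¹) = (S.disc ℓ w - S.disc ℓ z) * τ w := by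
    have h3 : τ z * (τ z)⁻¹ = 1 := mul_inv_cancel₀ hz0
    have h4 : τ z + (τ z)⁻¹ = S.disc ℓ z := by
      field_simp
      linear_combination hr
    linear_combination hr' + h3 - τ w * h4
  calc ‖τ w - τ z‖ * (‖(τ z)⁻¹‖ - 1) ≤ ‖τ w - τ z‖ * ‖τ w - (τ z)⁻¹‖ := by
        gcongr
        have := norm_sub_norm_le (τ z)⁻¹ (τ w)
        rw [norm_sub_rev] at this
        linarith
    _ = ‖S.disc ℓ w - S.disc ℓ z‖ * ‖τ w‖ := by rw [← norm_mul, hprod, norm_mul]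
    _ ≤ ‖S.disc ℓ w - S.disc ℓ z‖ := mul_le_of_le_one_right (norm_nonneg _) hn'.le

theorem continuousOn_weylM (hq : LocallyIntegrable q volume) (hℓ : 0 < ℓ)
    (hper : Function.Periodic q ℓ) (α : ℝ) : ContinuousOn (weylM q α) {z | 0 < z.im} := by
  obtain ⟨S⟩ := nonempty_hillSystem ℂ hq
  obtain ⟨τ, hτc, hτ⟩ := S.exists_innerRoot hq hℓ hper
  refine (S.continuousOn_weylFormula (ℓ := ℓ) α hτc fun z hz => ?_).congr fun z hz => ?_
  · exact S.weylFormula_den_ne_zero hq hℓ hper α hz (hτ z hz).1 (hτ z hz).2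
  · exact S.weylM_eq hq hℓ hper α hz (hτ z hz).1 (hτ z hz).2

theorem weylM_im_pos (hq : LocallyIntegrable q volume) (hℓ : 0 < ℓ)
    (hper : Function.Periodic q ℓ) (α : ℝ) {z : ℂ} (hz : 0 < z.im) : 0 < (weylM q α z).im := by
  obtain ⟨S⟩ := nonempty_hillSystem ℂ hq
  obtain ⟨τ, -, hτ⟩ := S.exists_innerRoot hq hℓ hper
  rw [S.weylM_eq hq hℓ hper α hz (hτ z hz).1 (hτ z hz).2, weylFormula_im]
  exact div_pos (S.floquet_im_pos hq hℓ hper hz (hτ z hz).1 (hτ z hz).2)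
    (Complex.normSq_pos.2 (S.weylFormula_den_ne_zero hq hℓ hper α hz (hτ z hz).1 (hτ z hz).2))

end UpperHalfPlane

/-- Inside the stability set, the Weyl coefficient extends continuously to the real axis. -/
theorem exists_boundary_extension {q : ℝ → ℝ} (T : HillSystem ℝ q)
    (hq : LocallyIntegrable q volume) {ℓ : ℝ} (hℓ : 0 < ℓ) (hper : Function.Periodic q ℓ) (α : ℝ)
    {lam : ℝ} (hD : T.disc ℓ lam ^ 2 < 4) :
    ∃ δ > 0, ∃ F : ℂ → ℂ, ContinuousOn F (Metric.ball (lam : ℂ) δ ∩ {z | 0 ≤ z.im}) ∧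
      (∀ z ∈ Metric.ball (lam : ℂ) δ, 0 < z.im → weylM q α z = F z) ∧
      |(F lam).im| = Real.sqrt (4 - T.disc ℓ lam ^ 2) / 2 /
        |T.v lam ℓ * Real.cos α ^ 2 + (T.dv lam ℓ - T.u lam ℓ) * Real.sin α * Real.cos α
          - T.du lam ℓ * Real.sin α ^ 2| ∧ (F lam).im ≠ 0 := by
  obtain ⟨S⟩ := nonempty_hillSystem ℂ hq
  set E : ℂ → ℂ := fun z => 4 - S.disc ℓ z ^ 2 with hE
  have hEc : Continuous E := continuous_const.sub ((S.continuous_disc ℓ).pow 2)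
  have hEreal (t : ℝ) : E t = ((4 - T.disc ℓ t ^ 2 : ℝ) : ℂ) := by
    simp [hE, S.disc_ofReal T hq t hℓ.le]
  obtain ⟨δ, hδ, hball⟩ := Metric.eventually_nhds_iff_ball.1
    (hEc.continuousAt.eventually_mem (Complex.isOpen_slitPlane.mem_nhds (by
      rw [hEreal, Complex.ofReal_mem_slitPlane]; linarith) : Complex.slitPlane ∈ 𝓝 (E (lam : ℂ))))
  set r : ℂ → ℂ := fun z => E z ^ (2⁻¹ : ℂ) with hr
  have hr2 (z : ℂ) : r z ^ 2 = E z := Complex.cpow_ofNat_inv_pow _ 2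
  have hrreal {t : ℝ} (ht : T.disc ℓ t ^ 2 < 4) :
      r t = ((Real.sqrt (4 - T.disc ℓ t ^ 2) : ℝ) : ℂ) := by
    simp only [hr]
    rw [hEreal, Real.sqrt_eq_rpow, Complex.ofReal_cpow (by linarith)]
    norm_num
  set B := Metric.ball (lam : ℂ) δ
  have hrc : ContinuousOn r B := hEc.continuousOn.cpow_const hball
  -- Both roots are continuous near `lam`, because `4 - D²` stays in the slit plane where the
  -- principal root is continuous.
  set τ : ℝ → ℂ → ℂ := fun σ z => (S.disc ℓ z + σ * Complex.I * r z) / 2 with hτ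
  have hτc (σ : ℝ) : ContinuousOn (τ σ) B :=
    ((S.continuous_disc ℓ).continuousOn.add (hrc.const_mul _)).div_const 2
  have hroot {σ : ℝ} (hσ : σ ^ 2 = 1) (z : ℂ) : τ σ z ^ 2 - S.disc ℓ z * τ σ z + 1 = 0 := by
    have h1 := hr2 z
    have h2 : (σ : ℂ) ^ 2 = 1 := by exact_mod_cast hσ
    have h3 := Complex.I_sq
    simp only [hτ, hE] at h1 ⊢
    linear_combination (-1 / 4 : ℂ) * h1 + (Complex.I ^ 2 * r z ^ 2 / 4) * h2 + (r z ^ 2 / 4) * h3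
  have hprod (z : ℂ) : τ 1 z * τ (-1) z = 1 := by
    have h1 := hr2 z
    have h3 := Complex.I_sq
    simp only [hτ, hE] at h1 ⊢
    push_cast
    linear_combination (1 / 4 : ℂ) * h1 - (r z ^ 2 / 4) * h3
  have hconn : IsPreconnected (B ∩ {z : ℂ | 0 < z.im}) :=
    ((convex_ball _ _).inter (convex_halfSpace_im_gt 0)).isPreconnected
  -- The half disc is connected and no root there has modulus 1, so one sign gives the inner root
  -- throughout. Which one is left open; the sign of the boundary value is settled later by
  -- positivity of `Im m`.
  obtain ⟨σ, hσ, hin⟩ : ∃ σ : ℝ, σ ^ 2 = 1 ∧ ∀ z ∈ B ∩ {z : ℂ | 0 < z.im}, ‖τ σ z‖ < 1 := by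
    by_contra! hcon
    obtain ⟨z₁, hz₁, h₁⟩ := hcon 1 (by norm_num)
    obtain ⟨z₂, hz₂, h₂⟩ := hcon (-1) (by norm_num)
    have h₃ : ‖τ 1 z₂‖ ≤ 1 := by
      have := congrArg norm (hprod z₂)
      rw [norm_mul, norm_one] at this
      nlinarith [norm_nonneg (τ 1 z₂)]
    obtain ⟨w, hw, hw1⟩ := hconn.intermediate_value hz₂ hz₁
      ((hτc 1).norm.mono Set.inter_subset_left) ⟨h₃, h₁⟩
    exact S.norm_root_ne_one hq hℓ hper hw.2 (hroot (by norm_num) w) hw1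
  have hv {t : ℝ} (ht : T.disc ℓ t ^ 2 < 4) : T.v t ℓ ≠ 0 := T.v_ne_zero hq hℓ.le ht
  have hτu {t : ℝ} (ht : T.disc ℓ t ^ 2 < 4) : τ σ t - S.u t ℓ =
      (((T.dv t ℓ - T.u t ℓ) / 2 : ℝ) : ℂ) +
        ((σ * Real.sqrt (4 - T.disc ℓ t ^ 2) / 2 : ℝ) : ℂ) * Complex.I := by
    simp only [hτ, hrreal ht, S.disc_ofReal T hq t hℓ.le, (S.ofReal_eq T hq t hℓ.le).1]
    simp only [disc]
    push_cast
    ring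
  have hsq {t : ℝ} (ht : T.disc ℓ t ^ 2 < 4) : 0 < Real.sqrt (4 - T.disc ℓ t ^ 2) :=
    Real.sqrt_pos.2 (by linarith)
  have hσ0 : σ ≠ 0 := fun h => by simp [h] at hσ
  -- On the real axis the squared modulus of the denominator has the factor `v ℓ`, which cancels
  -- against the numerator of `weylFormula_im`.
  have hnorm {t : ℝ} (ht : T.disc ℓ t ^ 2 < 4) :
      Complex.normSq (Real.cos α * S.v t ℓ + Real.sin α * (τ σ t - S.u t ℓ)) =
      T.v t ℓ * (T.v t ℓ * Real.cos α ^ 2 + (T.dv t ℓ - T.u t ℓ) * Real.sin α * Real.cos α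
          - T.du t ℓ * Real.sin α ^ 2) := by
    rw [hτu ht, (S.ofReal_eq T hq t hℓ.le).2.2.1, Complex.normSq_apply]
    have h1 := Real.sq_sqrt (by linarith : 0 ≤ 4 - T.disc ℓ t ^ 2)
    have h2 := T.disc_sq_sub_four hq hℓ.le t
    set R := Real.sqrt (4 - T.disc ℓ t ^ 2)
    simp only [Complex.add_re, Complex.add_im, Complex.mul_re, Complex.mul_im, Complex.ofReal_re,
      Complex.ofReal_im, Complex.I_re, Complex.I_im]
    linear_combination (Real.sin α ^ 2 * R ^ 2 / 4) * hσ + (Real.sin α ^ 2 / 4) * h1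
      - (Real.sin α ^ 2 / 4) * h2
  have hden {t : ℝ} (ht : T.disc ℓ t ^ 2 < 4) :
      Real.cos α * S.v t ℓ + Real.sin α * (τ σ t - S.u t ℓ) ≠ 0 := by
    rw [hτu ht, (S.ofReal_eq T hq t hℓ.le).2.2.1]
    intro h0
    have him := congrArg Complex.im h0
    have hre := congrArg Complex.re h0
    simp only [Complex.add_re, Complex.add_im, Complex.mul_re, Complex.mul_im, Complex.ofReal_re,
      Complex.ofReal_im, Complex.I_re, Complex.I_im, Complex.zero_re, Complex.zero_im] at him hre
    have h1 : Real.sin α * (σ * Real.sqrt (4 - T.disc ℓ t ^ 2)) = 0 := by linarith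
    have hs : Real.sin α = 0 :=
      (mul_eq_zero.1 h1).resolve_right (mul_ne_zero hσ0 (hsq ht).ne')
    rw [hs] at hre
    have hc : Real.cos α = 0 := (mul_eq_zero.1 (by linarith : Real.cos α * T.v t ℓ = 0)).resolve_right
      (hv ht)
    have := Real.sin_sq_add_cos_sq α
    rw [hs, hc] at this
    norm_num at this
  have himF : (S.weylFormula ℓ α lam (τ σ lam)).im =
      T.v lam ℓ * (σ * Real.sqrt (4 - T.disc ℓ lam ^ 2) / 2) /
      Complex.normSq (Real.cos α * S.v lam ℓ + Real.sin α * (τ σ lam - S.u lam ℓ)) := by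
    rw [weylFormula_im]
    congr 1
    rw [hτu hD, (S.ofReal_eq T hq lam hℓ.le).2.2.1, Complex.conj_ofReal, Complex.im_ofReal_mul]
    simp
  refine ⟨δ, hδ, fun z => S.weylFormula ℓ α z (τ σ z), ?_, fun z hz hzi => ?_, ?_, ?_⟩
  · refine S.continuousOn_weylFormula α ((hτc σ).mono Set.inter_subset_left) fun z hz => ?_
    rcases (show 0 ≤ z.im from hz.2).eq_or_lt with h0 | h0
    · obtain ⟨t, rfl⟩ : ∃ t : ℝ, (t : ℂ) = z := ⟨z.re, Complex.ext rfl h0⟩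
      have := hball _ hz.1
      rw [hEreal, Complex.ofReal_mem_slitPlane] at this
      exact hden (by linarith)
    · exact S.weylFormula_den_ne_zero hq hℓ hper α h0 (hroot hσ z) (hin z ⟨hz.1, h0⟩)
  · exact S.weylM_eq hq hℓ hper α hzi (hroot hσ z) (hin z ⟨hz, hzi⟩)
  · beta_reduce
    rw [himF, hnorm hD, mul_div_mul_left _ _ (hv hD), abs_div, abs_div, abs_mul,
      abs_of_pos (hsq hD), abs_of_pos (two_pos : (0 : ℝ) < 2)]
    have : |σ| = 1 := by
      rw [← pow_eq_one_iff_of_nonneg (abs_nonneg σ) two_ne_zero, sq_abs, hσ]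
    rw [this, one_mul]
  · beta_reduce
    rw [himF]
    exact div_ne_zero (mul_ne_zero (hv hD) (div_ne_zero (mul_ne_zero hσ0 (hsq hD).ne') two_ne_zero))
      (Complex.normSq_pos.2 (hden hD)).ne'

end HillSystem

/-! ### Oscillation in the stability set -/

/-- The second differences are `(D - 2) c (n + 1)`, so a positive sequence would be concave, hence
nondecreasing. Its increments would then drop by at least `(2 - D) c 0` at each step and become
negative. -/
theorem exists_nonpos_of_recurrence {c : ℕ → ℝ} {D : ℝ} (hD : D < 2)
    (hc : ∀ n, c (n + 2) = D * c (n + 1) - c n) : ∃ n, c n ≤ 0 := by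
  by_contra! hpos
  have hstep (n : ℕ) : c (n + 2) - c (n + 1) ≤ c (n + 1) - c n := by
    have := mul_pos (sub_pos.2 hD) (hpos (n + 1))
    rw [hc n]
    linarith
  have hanti : Antitone fun n => c (n + 1) - c n := antitone_nat_of_succ_le hstep
  have hinc (N : ℕ) : 0 ≤ c (N + 1) - c N := by
    by_contra! hN
    have hlin (k : ℕ) : c (N + k) ≤ c N + k * (c (N + 1) - c N) := by
      induction k with
      | zero => simp
      | succ k ih =>
        have := hanti (by lia : N ≤ N + k)
        simp only at this
        push_cast
        rw [← add_assoc]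
        linarith
    obtain ⟨k, hk⟩ := exists_nat_gt (c N / (c N - c (N + 1)))
    rw [div_lt_iff₀ (by linarith)] at hk
    have := hlin k
    have := hpos (N + k)
    linarith
  have hmono : Monotone c := monotone_nat_of_le_succ fun n => by linarith [hinc n]
  have hdec (n : ℕ) : c (n + 1) - c n ≤ c 1 - c 0 - n * ((2 - D) * c 0) := by
    induction n with
    | zero => simp
    | succ n ih =>
      have h1 := mul_le_mul_of_nonneg_left (hmono (Nat.zero_le (n + 1))) (sub_pos.2 hD).le
      push_cast
      rw [add_assoc, one_add_one_eq_two, hc n]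
      linarith
  obtain ⟨n, hn⟩ := exists_nat_gt ((c 1 - c 0) / ((2 - D) * c 0))
  rw [div_lt_iff₀ (mul_pos (sub_pos.2 hD) (hpos 0))] at hn
  linarith [hdec n, hinc n]

namespace HillSystem

/-- By Cayley–Hamilton the values of `u` at points spaced by `ℓ` satisfy `c (n + 2) = D c (n + 1) -
c n`. With `D < 2` they cannot keep one sign. -/
theorem not_isNonoscillatory {q : ℝ → ℝ} (T : HillSystem ℝ q) (hq : LocallyIntegrable q volume)
    {ℓ : ℝ} (hℓ : 0 < ℓ) (hper : Function.Periodic q ℓ) {x : ℝ} (hD : T.disc ℓ x ^ 2 < 4) :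
    ¬IsNonoscillatory q x := by
  intro hnon
  obtain ⟨X, hX⟩ := hnon _ _ (T.solution_u x) ⟨0, le_rfl, by simp [T.u_zero]⟩
  set a := max X 0
  have ha : 0 ≤ a := le_max_right _ _
  have hD2 : T.disc ℓ x < 2 := by nlinarith
  have hrec (n : ℕ) : T.u x (a + (n + 2 : ℕ) * ℓ) =
      T.disc ℓ x * T.u x (a + (n + 1 : ℕ) * ℓ) - T.u x (a + n * ℓ) := by
    have hn : 0 ≤ a + n * ℓ := by positivity
    have h1 := (T.translate hq hℓ.le hper (T.solution_u x) hn).1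
    have h2 := (T.translate hq hℓ.le hper ((T.solution_u x).comp_add_right hq hℓ.le hper) hn).1
    have h3 := T.translate hq hℓ.le hper (T.solution_u x) hℓ.le
    have hw := T.wronskian hq x hℓ.le
    rw [h3.1, h3.2] at h2
    have e1 : a + (n + 1 : ℕ) * ℓ = a + n * ℓ + ℓ := by push_cast; ring
    have e2 : a + (n + 2 : ℕ) * ℓ = a + n * ℓ + ℓ + ℓ := by push_cast; ring
    rw [e1, e2, h1, h2, disc]
    linear_combination (-T.u x (a + n * ℓ)) * hw
  have hne (n : ℕ) : ∀ t ∈ Set.uIcc a (a + n * ℓ), T.u x t ≠ 0 := fun t ht => by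
    rw [Set.uIcc_of_le (by linarith [show 0 ≤ n * ℓ by positivity])] at ht
    exact hX t (ha.trans ht.1) ((le_max_left X 0).trans ht.1)
  have hcont (n : ℕ) : ContinuousOn (T.u x) (Set.uIcc a (a + n * ℓ)) :=
    (T.continuous_u.comp (by fun_prop : Continuous fun t => (x, t))).continuousOn
  rcases lt_or_gt_of_ne (hne 0 a Set.left_mem_uIcc) with hs | hs
  · obtain ⟨n, hn⟩ := exists_nonpos_of_recurrence (c := fun n : ℕ => -T.u x (a + n * ℓ)) hD2
      fun n => by rw [hrec n]; ring
    have := neg_of_continuousOn_of_ne_zero (hcont n) (hne n) hs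
    linarith
  · obtain ⟨n, hn⟩ := exists_nonpos_of_recurrence (c := fun n : ℕ => T.u x (a + n * ℓ)) hD2 hrec
    have := pos_of_continuousOn_of_ne_zero (hcont n) (hne n) hs
    linarith

/-- The condition `D² < 4` is open, so it holds slightly to the left of `lam`; this also excludes `Λ
= lam`. -/
theorem cutoff_lt {q : ℝ → ℝ} (T : HillSystem ℝ q) (hq : LocallyIntegrable q volume)
    {ℓ : ℝ} (hℓ : 0 < ℓ) (hper : Function.Periodic q ℓ) {lam Λ : ℝ}
    (hD : T.disc ℓ lam ^ 2 < 4) (hΛ : IsCutoff q Λ) : Λ < lam := by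
  obtain ⟨δ, hδ, hb⟩ := Metric.eventually_nhds_iff_ball.1
    (((T.continuous_disc ℓ).pow 2).continuousAt.eventually_lt continuousAt_const hD)
  rw [Real.ball_eq_Ioo] at hb
  by_contra! hle
  exact T.not_isNonoscillatory hq hℓ hper (hb (lam - δ / 2) ⟨by linarith, by linarith⟩)
    (hΛ.1 _ (by linarith))

end HillSystem

/-! ### The spectral density -/

theorem tendsto_weylM_of_extension {q : ℝ → ℝ} {α lam δ : ℝ} {F : ℂ → ℂ} (hδ : 0 < δ)
    (hF : ContinuousOn F (Metric.ball (lam : ℂ) δ ∩ {z | 0 ≤ z.im}))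
    (hFm : ∀ z ∈ Metric.ball (lam : ℂ) δ, 0 < z.im → weylM q α z = F z) :
    Tendsto (fun ε : ℝ => (weylM q α (lam + ε * Complex.I)).im) (𝓝[>] 0) (𝓝 (F lam).im) := by
  have hline : Tendsto (fun ε : ℝ => (lam : ℂ) + ε * Complex.I) (𝓝[>] 0)
      (𝓝[Metric.ball (lam : ℂ) δ ∩ {z | 0 ≤ z.im}] (lam : ℂ)) := by
    refine tendsto_nhdsWithin_iff.2 ⟨?_, ?_⟩
    · have : Continuous fun ε : ℝ => (lam : ℂ) + ε * Complex.I := by fun_prop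
      have h := this.tendsto 0
      simp only [Complex.ofReal_zero, zero_mul, add_zero] at h
      exact h.mono_left nhdsWithin_le_nhds
    · filter_upwards [Ioo_mem_nhdsGT hδ] with ε hε
      refine ⟨?_, ?_⟩
      · simp [abs_of_pos hε.1, hε.2]
      · simp [hε.1.le]
  have h0 := (hF lam ⟨Metric.mem_ball_self hδ, by simp⟩).tendsto.comp hline
  refine ((Complex.continuous_im.tendsto _).comp h0).congr' ?_
  filter_upwards [Ioo_mem_nhdsGT hδ] with ε hε
  simp only [Function.comp_apply]
  rw [hFm]
  · simp [abs_of_pos hε.1, hε.2]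
  · simp [hε.1]

/-- Increments of `ρ` near `lam` are limits of integrals of `Im m` over segments where `m` extends
continuously to the real axis. The limit passes under the integral, and the fundamental theorem of
calculus applies. -/
theorem hasDerivAt_spectralFunction {q : ℝ → ℝ} (hq : LocallyIntegrable q volume) {ℓ : ℝ}
    (hℓ : 0 < ℓ) (hper : Function.Periodic q ℓ) {α lam Λ δ : ℝ} {F : ℂ → ℂ} {ρ : ℝ → ℝ}
    (hδ : 0 < δ) (hF : ContinuousOn F (Metric.ball (lam : ℂ) δ ∩ {z | 0 ≤ z.im}))
    (hFm : ∀ z ∈ Metric.ball (lam : ℂ) δ, 0 < z.im → weylM q α z = F z) (hΛ : Λ < lam)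
    (hρ : IsSpectralFunction q α Λ ρ) : HasDerivAt ρ (1 / Real.pi * (F lam).im) lam := by
  obtain ⟨η, hη, hηδ, hηΛ⟩ : ∃ η > 0, 2 * η < δ ∧ η < lam - Λ :=
    ⟨min (δ / 3) ((lam - Λ) / 2), lt_min (by linarith) (by linarith),
      by linarith [min_le_left (δ / 3) ((lam - Λ) / 2)],
      by linarith [min_le_right (δ / 3) ((lam - Λ) / 2)]⟩
  -- Clamping to a rectangle, which `2 * η < δ` keeps inside the ball, makes the integrand
  -- continuous for all `(ε, t)`, the value `ε = 0` included.
  set p : ℝ × ℝ → ℂ := fun a =>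
    ((max (lam - η) (min (lam + η) a.2) : ℝ) : ℂ) + ((max 0 (min η a.1) : ℝ) : ℂ) * Complex.I
    with hp
  have hpc : Continuous p := by fun_prop
  have hpm (a : ℝ × ℝ) : p a ∈ Metric.ball (lam : ℂ) δ ∩ {z | 0 ≤ z.im} := by
    have h1 : |max (lam - η) (min (lam + η) a.2) - lam| ≤ η := by
      rw [abs_le]
      constructor
      · linarith [le_max_left (lam - η) (min (lam + η) a.2)]
      · linarith [max_le (by linarith : lam - η ≤ lam + η) (min_le_left (lam + η) a.2)]
    have h2 : |max 0 (min η a.1)| ≤ η := by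
      rw [abs_of_nonneg (le_max_left _ _)]
      exact max_le hη.le (min_le_left _ _)
    refine ⟨?_, ?_⟩
    · rw [Metric.mem_ball, dist_eq_norm]
      have : p a - lam = ((max (lam - η) (min (lam + η) a.2) - lam : ℝ) : ℂ) +
          ((max 0 (min η a.1) : ℝ) : ℂ) * Complex.I := by
        simp only [hp]
        push_cast
        ring
      rw [this]
      refine (norm_add_le _ _).trans_lt ?_
      rw [norm_mul, Complex.norm_I, mul_one, Complex.norm_real, Complex.norm_real,
        Real.norm_eq_abs, Real.norm_eq_abs]
      linarith
    · simp [hp]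
  have hpe {t ε : ℝ} (ht : t ∈ Set.Icc (lam - η) (lam + η)) (hε : ε ∈ Set.Icc 0 η) :
      p (ε, t) = t + ε * Complex.I := by
    simp only [hp]
    rw [min_eq_right ht.2, max_eq_right ht.1, min_eq_right hε.2, max_eq_right hε.1]
  set g : ℝ → ℝ → ℝ := fun ε t => (F (p (ε, t))).im with hg
  have hgc : Continuous (Function.uncurry g) :=
    Complex.continuous_im.comp (hF.comp_continuous hpc hpm)
  have hg0 : Continuous (g 0) := hgc.comp (by fun_prop : Continuous fun t : ℝ => ((0 : ℝ), t))
  have hval : g 0 lam = (F lam).im := by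
    simp only [hg]
    rw [hpe ⟨by linarith, by linarith⟩ ⟨le_rfl, hη.le⟩]
    simp
  have hmc {ε : ℝ} (hε : 0 < ε) :
      Continuous fun t : ℝ => (weylM q α (t + ε * Complex.I)).im :=
    Complex.continuous_im.comp ((HillSystem.continuousOn_weylM hq hℓ hper α).comp_continuous
      (by fun_prop) fun t => by simpa using hε)
  have hkey : ∀ μ ∈ Set.Ioo (lam - η) (lam + η),
      ρ lam + 1 / Real.pi * ∫ t in lam..μ, g 0 t = ρ μ := by
    intro μ hμ
    have hlim := (hρ μ (by linarith [hμ.1])).sub (hρ lam hΛ.le)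
    have hlim' : Tendsto (fun ε => 1 / Real.pi * ∫ t in lam..μ, g ε t) (𝓝[>] 0)
        (𝓝 (1 / Real.pi * ∫ t in lam..μ, g 0 t)) :=
      ((continuous_const.mul
        (intervalIntegral.continuous_parametric_intervalIntegral_of_continuous' hgc lam μ)).tendsto
          0).mono_left nhdsWithin_le_nhds
    have heq : (fun ε : ℝ => 1 / Real.pi * (∫ t in Λ..μ, (weylM q α (t + ε * Complex.I)).im)
        - 1 / Real.pi * ∫ t in Λ..lam, (weylM q α (t + ε * Complex.I)).im) =ᶠ[𝓝[>] 0]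
        fun ε => 1 / Real.pi * ∫ t in lam..μ, g ε t := by
      filter_upwards [Ioo_mem_nhdsGT hη] with ε hε
      rw [← mul_sub, intervalIntegral.integral_interval_sub_left
        ((hmc hε.1).intervalIntegrable _ _) ((hmc hε.1).intervalIntegrable _ _)]
      congr 1
      refine intervalIntegral.integral_congr fun t ht => ?_
      have ht' : t ∈ Set.Icc (lam - η) (lam + η) := by
        have : Set.uIcc lam μ ⊆ Set.Icc (lam - η) (lam + η) :=
          Set.uIcc_subset_Icc ⟨by linarith, by linarith⟩ ⟨hμ.1.le, hμ.2.le⟩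
        exact this ht
      simp only [hg]
      rw [hpe ht' ⟨hε.1.le, hε.2.le⟩, hFm]
      · rw [← hpe ht' ⟨hε.1.le, hε.2.le⟩]
        exact (hpm _).1
      · simpa using hε.1
    have := tendsto_nhds_unique (hlim.congr' heq) hlim'
    linarith
  have hder : HasDerivAt (fun μ => ρ lam + 1 / Real.pi * ∫ t in lam..μ, g 0 t)
      (1 / Real.pi * (F lam).im) lam := by
    rw [← hval]
    exact ((hg0.integral_hasStrictDerivAt lam lam).hasDerivAt.const_mul _).const_add _
  refine hder.congr_of_eventuallyEq ?_
  filter_upwards [Ioo_mem_nhds (by linarith : lam - η < lam) (by linarith : lam < lam + η)] with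
    μ hμ using (hkey μ hμ).symm

/-- The spectral density in the stability set, in terms of the monodromy matrix. -/
theorem HillSystem.spectralDensity_eq {q : ℝ → ℝ} (T : HillSystem ℝ q)
    (hq : LocallyIntegrable q volume) {ℓ : ℝ} (hℓ : 0 < ℓ) (hper : Function.Periodic q ℓ) (α : ℝ)
    {lam : ℝ} (hD : T.disc ℓ lam ^ 2 < 4) :
    Tendsto (fun ε : ℝ => 1 / Real.pi * (weylM q α (lam + ε * Complex.I)).im)
      (𝓝[>] 0) (𝓝 (spectralDensity q α lam)) ∧ 0 < spectralDensity q α lam ∧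
    (∀ (Λ : ℝ) (ρ : ℝ → ℝ), IsCutoff q Λ → IsSpectralFunction q α Λ ρ →
      HasDerivAt ρ (spectralDensity q α lam) lam) ∧
    spectralDensity q α lam = 1 / Real.pi * (Real.sqrt (4 - T.disc ℓ lam ^ 2) / 2 /
      |T.v lam ℓ * Real.cos α ^ 2 + (T.dv lam ℓ - T.u lam ℓ) * Real.sin α * Real.cos α
        - T.du lam ℓ * Real.sin α ^ 2|) := by
  obtain ⟨δ, hδ, F, hF, hFm, hFv, hF0⟩ := T.exists_boundary_extension hq hℓ hper α hD
  have hlim := tendsto_weylM_of_extension hδ hF hFm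
  -- A limit of positive numbers that is not 0; this removes the sign ambiguity in the choice of
  -- root.
  have hpos : 0 < (F lam).im := by
    refine lt_of_le_of_ne (ge_of_tendsto hlim ?_) hF0.symm
    filter_upwards [self_mem_nhdsWithin] with ε (hε : 0 < ε)
    exact (HillSystem.weylM_im_pos hq hℓ hper α (by simpa using hε)).le
  have hlim' := hlim.const_mul (1 / Real.pi)
  have hf : spectralDensity q α lam = 1 / Real.pi * (F lam).im := hlim'.limUnder_eq
  rw [hf]
  refine ⟨hlim', by have := Real.pi_pos; positivity, fun Λ ρ hΛ hρ => ?_, ?_⟩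
  · exact hasDerivAt_spectralFunction hq hℓ hper hδ hF hFm (T.cutoff_lt hq hℓ hper hD hΛ) hρ
  · rw [← hFv, abs_of_pos hpos]

/-! ### Appell's system -/

namespace IsAppellSolution

variable {q : ℝ → ℝ} {lam : ℝ} {P Q R : ℝ → ℝ}

theorem isPrimitive (hq : LocallyIntegrable q volume) (h : IsAppellSolution q lam P Q R) :
    IsPrimitive P (fun t => (lam - q t) * Q t) ∧
    IsPrimitive Q (fun t => -2 * P t + 2 * (lam - q t) * R t) ∧
    IsPrimitive R (fun t => -Q t) := by
  have hqi (x : ℝ) : IntervalIntegrable (fun t => lam - q t) volume 0 x :=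
    intervalIntegrable_const.sub (hq.intervalIntegrable_volume 0 x)
  have hc {f : ℝ → ℝ} (hf : ContinuousOn f (Set.Ici 0)) {x : ℝ} (hx : 0 ≤ x) :
      ContinuousOn f (Set.uIcc 0 x) := by
    rw [Set.uIcc_of_le hx]
    exact hf.mono Set.Icc_subset_Ici_self
  refine ⟨⟨fun x hx => (hqi x).mul_continuousOn (hc h.continuousOn_Q hx), h.eq_P⟩,
    ⟨fun x hx => ?_, h.eq_Q⟩, .of_continuousOn h.continuousOn_Q.neg h.eq_R⟩
  exact ((hc h.continuousOn_P hx).intervalIntegrable.const_mul (-2)).add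
    (((hqi x).const_mul 2).mul_continuousOn (hc h.continuousOn_R hx))

/-- The symmetric bilinear form with coefficients `P`, `Q / 2`, `R` is constant along solutions of
Hill's equation. -/
theorem bilinear_eq (hq : LocallyIntegrable q volume) (h : IsAppellSolution q lam P Q R)
    {y dy w dw : ℝ → ℝ} (hy : IsHillSolution q lam y dy) (hw : IsHillSolution q lam w dw) {x : ℝ}
    (hx : 0 ≤ x) :
    2 * P x * (y x * w x) + Q x * (y x * dw x + dy x * w x) + 2 * R x * (dy x * dw x) =
      2 * P 0 * (y 0 * w 0) + Q 0 * (y 0 * dw 0 + dy 0 * w 0) + 2 * R 0 * (dy 0 * dw 0) := by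
  obtain ⟨hP, hQ, hR⟩ := h.isPrimitive hq
  have hy' := hy.isPrimitive_deriv hq
  have hw' := hw.isPrimitive_deriv hq
  have hy := hy.isPrimitive
  have hw := hw.isPrimitive
  have := (((hP.const_mul 2).mul (hy.mul hw)).add (hQ.mul ((hy.mul hw').add (hy'.mul hw)))).add
    ((hR.const_mul 2).mul (hy'.mul hw'))
  refine this.eq_of_density_eq_zero (fun t _ => ?_) hx
  simp only [RCLike.ofReal_real_eq_id, id_eq]
  ring

/-- The form takes constant values on the pairs `(u, u)`, `(u, v)`, `(v, v)`, which are read off at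
0. Since the Wronskian is 1, these three equations can be solved for `P`, `Q`, `R`. -/
theorem hasAppellCoordinates (hq : LocallyIntegrable q volume) (h : IsAppellSolution q lam P Q R)
    {u du v dv : ℝ → ℝ} (hu : IsHillSolution q lam u du) (hv : IsHillSolution q lam v dv)
    (hu0 : u 0 = 1) (hdu0 : du 0 = 0) (hv0 : v 0 = 0) (hdv0 : dv 0 = 1) :
    HasAppellCoordinates u du v dv P Q R (R 0) (-Q 0) (P 0) := by
  intro x hx
  have h1 := h.bilinear_eq hq hu hu hx
  have h2 := h.bilinear_eq hq hu hv hx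
  have h3 := h.bilinear_eq hq hv hv hx
  have hw := hu.wronskian_eq hq hv hx
  simp only [hu0, hdu0, hv0, hdv0, mul_zero, mul_one, add_zero, zero_add, sub_zero] at h1 h2 h3 hw
  have hw2 : (u x * dv x - v x * du x) ^ 2 = 1 := by rw [hw, one_pow]
  refine ⟨?_, ?_, ?_⟩
  · linear_combination (dv x ^ 2 / 2) * h1 - (du x * dv x) * h2 + (du x ^ 2 / 2) * h3 - P x * hw2
  · linear_combination (-(v x * dv x)) * h1 + (u x * dv x + v x * du x) * h2
      - (u x * du x) * h3 - Q x * hw2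
  · linear_combination (v x ^ 2 / 2) * h1 - (u x * v x) * h2 + (u x ^ 2 / 2) * h3 - R x * hw2

end IsAppellSolution

theorem HasAppellCoordinates.eq_initial {u du v dv P Q R : ℝ → ℝ} {a b c : ℝ}
    (h : HasAppellCoordinates u du v dv P Q R a b c) (hu0 : u 0 = 1) (hdu0 : du 0 = 0)
    (hv0 : v 0 = 0) (hdv0 : dv 0 = 1) : P 0 = c ∧ Q 0 = -b ∧ R 0 = a := by
  obtain ⟨h1, h2, h3⟩ := h 0 le_rfl
  rw [hu0, hdu0, hv0, hdv0] at *
  refine ⟨?_, ?_, ?_⟩ <;> linarith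

namespace HillSystem

variable {q : ℝ → ℝ} (T : HillSystem ℝ q) {ℓ lam : ℝ}

theorem exists_isNormalizedPeriodicAppell (hq : LocallyIntegrable q volume) (hℓ : 0 ≤ ℓ)
    (hper : Function.Periodic q ℓ) (hD : T.disc ℓ lam ^ 2 < 4) :
    ∃ P Q R : ℝ → ℝ, IsNormalizedPeriodicAppell q ℓ lam P Q R := by
  -- The form with coordinates `(v, v' - u, -u')` at `ℓ` has `4 P R - Q² = 4 - D²`; the factor `k`
  -- rescales this to 4.
  obtain ⟨k, hk⟩ : ∃ k : ℝ, k ^ 2 * (4 - T.disc ℓ lam ^ 2) = 4 := by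
    refine ⟨2 / Real.sqrt (4 - T.disc ℓ lam ^ 2), ?_⟩
    rw [div_pow, Real.sq_sqrt (by linarith)]
    have : 4 - T.disc ℓ lam ^ 2 ≠ 0 := by linarith
    field_simp
    norm_num
  have h4 := T.disc_sq_sub_four hq hℓ lam
  have hu := (T.solution_u lam).isPrimitive
  have hv := (T.solution_v lam).isPrimitive
  have hdu := (T.solution_u lam).isPrimitive_deriv hq
  have hdv := (T.solution_v lam).isPrimitive_deriv hq
  have hW := T.wronskian hq lam hℓ
  have hwr {x : ℝ} (hx : 0 ≤ x) := T.wronskian hq lam hx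
  have htu {x : ℝ} (hx : 0 ≤ x) := T.translate hq hℓ hper (T.solution_u lam) hx
  have htv {x : ℝ} (hx : 0 ≤ x) := T.translate hq hℓ hper (T.solution_v lam) hx
  set u := T.u lam
  set v := T.v lam
  set du := T.du lam
  set dv := T.dv lam
  obtain ⟨m₁, hm₁⟩ : ∃ m, m = u ℓ := ⟨_, rfl⟩
  obtain ⟨m₂, hm₂⟩ : ∃ m, m = v ℓ := ⟨_, rfl⟩
  obtain ⟨m₃, hm₃⟩ : ∃ m, m = du ℓ := ⟨_, rfl⟩
  obtain ⟨m₄, hm₄⟩ : ∃ m, m = dv ℓ := ⟨_, rfl⟩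
  rw [← hm₁, ← hm₂, ← hm₃, ← hm₄] at hW h4
  simp only [← hm₁, ← hm₂, ← hm₃, ← hm₄] at htu htv
  -- The coordinates are those of the quadratic form invariant under `M`, which makes the solution
  -- periodic.
  set P : ℝ → ℝ := fun x =>
    k * (m₂ * (du x * du x) + (m₄ - m₁) * (du x * dv x) + -m₃ * (dv x * dv x)) with hP
  set Q : ℝ → ℝ := fun x => k * (m₂ * (-2 * (u x * du x)) +
    (m₄ - m₁) * (-1 * (du x * v x + u x * dv x)) + -m₃ * (-2 * (v x * dv x))) with hQ
  set R : ℝ → ℝ := fun x =>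
    k * (m₂ * (u x * u x) + (m₄ - m₁) * (u x * v x) + -m₃ * (v x * v x)) with hR
  have pP : IsPrimitive P fun t => (lam - q t) * Q t := by
    refine IsPrimitive.congr_density (((((hdu.mul hdu).const_mul m₂).add
      ((hdu.mul hdv).const_mul (m₄ - m₁))).add ((hdv.mul hdv).const_mul (-m₃))).const_mul k)
      fun x _ => ?_
    simp only [hQ, RCLike.ofReal_real_eq_id, id_eq]
    ring
  have pQ : IsPrimitive Q fun t => -2 * P t + 2 * (lam - q t) * R t := by
    refine IsPrimitive.congr_density ((((((hu.mul hdu).const_mul (-2)).const_mul m₂).add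
      ((((hdu.mul hv).add (hu.mul hdv)).const_mul (-1)).const_mul (m₄ - m₁))).add
      (((hv.mul hdv).const_mul (-2)).const_mul (-m₃))).const_mul k) fun x _ => ?_
    simp only [hP, hR, RCLike.ofReal_real_eq_id, id_eq]
    ring
  have pR : IsPrimitive R fun t => -Q t := by
    refine IsPrimitive.congr_density (((((hu.mul hu).const_mul m₂).add
      ((hu.mul hv).const_mul (m₄ - m₁))).add ((hv.mul hv).const_mul (-m₃))).const_mul k)
      fun x _ => ?_
    simp only [hQ]
    ring
  refine ⟨P, Q, R, ⟨pP.continuousOn, pQ.continuousOn, pR.continuousOn, pP.eq, pQ.eq, pR.eq⟩,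
    fun x hx => ?_, fun x hx => ?_, fun x hx => ?_, fun x hx => ?_⟩
  · simp only [hP, (htu hx).2, (htv hx).2]
    linear_combination k * (m₂ * (du x * du x) + (m₄ - m₁) * (du x * dv x)
      + -m₃ * (dv x * dv x)) * hW
  · simp only [hQ, (htu hx).1, (htv hx).1, (htu hx).2, (htv hx).2]
    linear_combination k * (m₂ * (-2 * (u x * du x)) +
      (m₄ - m₁) * (-1 * (du x * v x + u x * dv x)) + -m₃ * (-2 * (v x * dv x))) * hW
  · simp only [hR, (htu hx).1, (htv hx).1]
    linear_combination k * (m₂ * (u x * u x) + (m₄ - m₁) * (u x * v x)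
      + -m₃ * (v x * v x)) * hW
  · have hw2 : (u x * dv x - v x * du x) ^ 2 = 1 := by rw [hwr hx, one_pow]
    simp only [hP, hQ, hR]
    linear_combination hk + k ^ 2 * h4
      - k ^ 2 * (4 * m₂ * m₃ + (m₄ - m₁) ^ 2) * hw2

/-- The initial values of a normalized periodic solution of Appell's system are proportional to the
coefficients of the quadratic form that is invariant under the monodromy matrix. -/
theorem exists_initial_eq (hq : LocallyIntegrable q volume) (hℓ : 0 ≤ ℓ)
    (hD : T.disc ℓ lam ^ 2 < 4) {P Q R : ℝ → ℝ} (h : IsNormalizedPeriodicAppell q ℓ lam P Q R) :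
    ∃ k : ℝ, k ^ 2 * (4 - T.disc ℓ lam ^ 2) = 4 ∧ P 0 = k * -T.du lam ℓ ∧
      Q 0 = k * (T.u lam ℓ - T.dv lam ℓ) ∧ R 0 = k * T.v lam ℓ := by
  have hv := T.v_ne_zero hq hℓ hD
  have h4 := T.disc_sq_sub_four hq hℓ lam
  have hW := T.wronskian hq lam hℓ
  have e1 := h.solution.bilinear_eq hq (T.solution_u lam) (T.solution_u lam) hℓ
  have e2 := h.solution.bilinear_eq hq (T.solution_u lam) (T.solution_v lam) hℓ
  have e3 := h.solution.bilinear_eq hq (T.solution_v lam) (T.solution_v lam) hℓ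
  have pP := h.periodic_P 0 le_rfl
  have pQ := h.periodic_Q 0 le_rfl
  have pR := h.periodic_R 0 le_rfl
  rw [zero_add] at pP pQ pR
  have hn := h.normalized 0 le_rfl
  simp only [T.u_zero, T.du_zero, T.v_zero, T.dv_zero, pP, pQ, pR, mul_zero, mul_one, add_zero,
    zero_add] at e1 e2 e3
  -- By periodicity `e1`, `e2`, `e3` say that the form at 0 is invariant under `M`. As `v ℓ ≠ 0`,
  -- these equations determine `P 0` and `Q 0` from `R 0`.
  have f1 : P 0 * T.v lam ℓ = -(R 0 * T.du lam ℓ) := by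
    linear_combination (T.dv lam ℓ / 2) * e2 - (T.du lam ℓ / 2) * e3
      - (P 0 * T.v lam ℓ + Q 0 / 2 * T.dv lam ℓ) * hW
  have f2 : Q 0 * T.v lam ℓ = R 0 * (T.u lam ℓ - T.dv lam ℓ) := by
    linear_combination (-T.v lam ℓ / 2) * e2 + (T.u lam ℓ / 2) * e3
      - (Q 0 / 2 * T.v lam ℓ + R 0 * T.dv lam ℓ) * hW
  have gP : P 0 = R 0 / T.v lam ℓ * -T.du lam ℓ := by
    field_simp
    linarith
  have gQ : Q 0 = R 0 / T.v lam ℓ * (T.u lam ℓ - T.dv lam ℓ) := by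
    field_simp
    linarith
  have gR : R 0 = R 0 / T.v lam ℓ * T.v lam ℓ := by field_simp
  refine ⟨R 0 / T.v lam ℓ, ?_, gP, gQ, gR⟩
  generalize R 0 / T.v lam ℓ = k at gP gQ gR
  rw [gP, gQ, gR] at hn
  linear_combination hn - k ^ 2 * h4

end HillSystem

/-! ### The formulas for the spectral density -/

theorem theorem2 (q : ℝ → ℝ) (ℓ : ℝ) (hℓ : 0 < ℓ) (hper : Function.Periodic q ℓ)
    (hq : LocallyIntegrable q volume) (α : ℝ) (hα : α ∈ Set.Ico 0 Real.pi)
    (lam : ℝ) (hlam : InStabilityInterval q ℓ lam) :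
    -- the normalized periodic solution of Appell's system exists and is unique up to sign
    (∃ P Q R : ℝ → ℝ, IsNormalizedPeriodicAppell q ℓ lam P Q R) ∧
    (∀ P Q R P₁ Q₁ R₁ : ℝ → ℝ, IsNormalizedPeriodicAppell q ℓ lam P Q R →
      IsNormalizedPeriodicAppell q ℓ lam P₁ Q₁ R₁ →
      (∀ x, 0 ≤ x → P₁ x = P x ∧ Q₁ x = Q x ∧ R₁ x = R x) ∨
      (∀ x, 0 ≤ x → P₁ x = -P x ∧ Q₁ x = -Q x ∧ R₁ x = -R x)) ∧
    -- the limit that defines the spectral density exists, is positive, and is the derivative of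
    -- the spectral function
    Tendsto (fun ε : ℝ => 1 / Real.pi * (weylM q α (lam + ε * Complex.I)).im)
      (𝓝[>] 0) (𝓝 (spectralDensity q α lam)) ∧
    0 < spectralDensity q α lam ∧
    (∀ (Λ : ℝ) (ρ : ℝ → ℝ), IsCutoff q Λ → IsSpectralFunction q α Λ ρ →
      HasDerivAt ρ (spectralDensity q α lam) lam) ∧
    -- the three representations
    ∀ P Q R : ℝ → ℝ, IsNormalizedPeriodicAppell q ℓ lam P Q R →
      (∀ u du v dv : ℝ → ℝ, IsHillSolution q lam u du → IsHillSolution q lam v dv →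
        u 0 = 1 → du 0 = 0 → v 0 = 0 → dv 0 = 1 →
        (∃ a b c : ℝ, HasAppellCoordinates u du v dv P Q R a b c) ∧
        ∀ a b c : ℝ, HasAppellCoordinates u du v dv P Q R a b c →
          spectralDensity q α lam =
            |1 / (Real.pi * (c * Real.sin α ^ 2 + b * Real.sin α * Real.cos α
              + a * Real.cos α ^ 2))|) ∧
      spectralDensity q α lam =
        |1 / (Real.pi * (P 0 * Real.sin α ^ 2 - Q 0 * Real.sin α * Real.cos α
          + R 0 * Real.cos α ^ 2))| ∧
      ∀ φ dφ : ℝ → ℝ, IsHillSolution q lam φ dφ → φ 0 = -Real.sin α → dφ 0 = Real.cos α →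
        ∀ x, 0 ≤ x →
          P x * φ x ^ 2 + Q x * φ x * dφ x + R x * dφ x ^ 2 =
            P 0 * φ 0 ^ 2 + Q 0 * φ 0 * dφ 0 + R 0 * dφ 0 ^ 2 ∧
          spectralDensity q α lam =
            |1 / (Real.pi * (P x * φ x ^ 2 + Q x * φ x * dφ x + R x * dφ x ^ 2))| := by
  obtain ⟨T⟩ := nonempty_hillSystem ℝ hq
  have hD := T.disc_sq_lt_four hq hℓ hlam
  obtain ⟨hlim, hpos, hder, hval⟩ := T.spectralDensity_eq hq hℓ hper α hD
  refine ⟨T.exists_isNormalizedPeriodicAppell hq hℓ.le hper hD, ?_, hlim, hpos, hder, ?_⟩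
  · intro P Q R P₁ Q₁ R₁ h h₁
    obtain ⟨k, hk, hP, hQ, hR⟩ := T.exists_initial_eq hq hℓ.le hD h
    obtain ⟨k₁, hk₁, hP₁, hQ₁, hR₁⟩ := T.exists_initial_eq hq hℓ.le hD h₁
    have hc := h.solution.hasAppellCoordinates hq (T.solution_u lam) (T.solution_v lam)
      (T.u_zero lam) (T.du_zero lam) (T.v_zero lam) (T.dv_zero lam)
    have hc₁ := h₁.solution.hasAppellCoordinates hq (T.solution_u lam) (T.solution_v lam)
      (T.u_zero lam) (T.du_zero lam) (T.v_zero lam) (T.dv_zero lam)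
    rw [hP, hQ, hR] at hc
    rw [hP₁, hQ₁, hR₁] at hc₁
    -- The normalization fixes the factor up to sign, which is the only freedom left.
    have hkk : k₁ ^ 2 = k ^ 2 :=
      mul_right_cancel₀ (by linarith : 4 - T.disc ℓ lam ^ 2 ≠ 0) (hk₁.trans hk.symm)
    rcases sq_eq_sq_iff_eq_or_eq_neg.1 hkk with rfl | rfl
    · left
      intro x hx
      obtain ⟨a1, a2, a3⟩ := hc x hx
      obtain ⟨b1, b2, b3⟩ := hc₁ x hx
      exact ⟨b1.trans a1.symm, b2.trans a2.symm, b3.trans a3.symm⟩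
    · right
      intro x hx
      obtain ⟨a1, a2, a3⟩ := hc x hx
      obtain ⟨b1, b2, b3⟩ := hc₁ x hx
      rw [a1, a2, a3, b1, b2, b3]
      refine ⟨?_, ?_, ?_⟩ <;> ring
  · intro P Q R h
    have hmain : spectralDensity q α lam =
        |1 / (Real.pi * (P 0 * Real.sin α ^ 2 - Q 0 * Real.sin α * Real.cos α
          + R 0 * Real.cos α ^ 2))| := by
      obtain ⟨k, hk, hP, hQ, hR⟩ := T.exists_initial_eq hq hℓ.le hD h
      set s := Real.sqrt (4 - T.disc ℓ lam ^ 2) with hs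
      have hs0 : 0 < s := Real.sqrt_pos.2 (by linarith)
      have hks : |k| * s = 2 := by
        refine (sq_eq_sq₀ (by positivity) two_pos.le).1 ?_
        rw [mul_pow, sq_abs, hs, Real.sq_sqrt (by linarith), hk]
        norm_num
      set N := T.v lam ℓ * Real.cos α ^ 2 + (T.dv lam ℓ - T.u lam ℓ) * Real.sin α * Real.cos α
        - T.du lam ℓ * Real.sin α ^ 2 with hN
      -- The denominator is `k` times the form in the boundary value of `m`, and `|k| = 2 / s` turns
      -- the factor `s / 2` there into `1 / |k|`.
      have hform : P 0 * Real.sin α ^ 2 - Q 0 * Real.sin α * Real.cos α + R 0 * Real.cos α ^ 2 =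
          k * N := by
        rw [hP, hQ, hR, hN]
        ring
      have hk0 : |k| = 2 / s := by
        rw [eq_div_iff hs0.ne']
        exact hks
      rw [hval, hform, abs_div, abs_mul, abs_mul, abs_of_pos Real.pi_pos, hk0, abs_one]
      field_simp
    refine ⟨fun u du v dv hu hv hu0 hdu0 hv0 hdv0 => ⟨⟨_, _, _,
      h.solution.hasAppellCoordinates hq hu hv hu0 hdu0 hv0 hdv0⟩, fun a b c hc => ?_⟩, hmain,
      fun φ dφ hφ hφ0 hdφ0 x hx => ?_⟩
    · obtain ⟨h1, h2, h3⟩ := hc.eq_initial hu0 hdu0 hv0 hdv0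
      rw [hmain, h1, h2, h3]
      congr 3
      ring
    · have hb := h.solution.bilinear_eq hq hφ hφ hx
      have hconst : P x * φ x ^ 2 + Q x * φ x * dφ x + R x * dφ x ^ 2 =
          P 0 * φ 0 ^ 2 + Q 0 * φ 0 * dφ 0 + R 0 * dφ 0 ^ 2 := by
        linear_combination hb / 2
      refine ⟨hconst, ?_⟩
      rw [hmain, hconst, hφ0, hdφ0]
      congr 3
      ring
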